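/- **Setting.** Let $r>3$ be an integer and let $H_i(q_i,p_i)=\tfrac12p_i^2+V_i(q_i)$, $i=1,2$, where each $V_i:\mathbb R\to\mathbb R$ is $C^{r+1}$, bounded below, tends to $+\infty$ as $|q|\to\infty$, and has finitely many critical points, all nondegenerate. A saddle of $V_i$ is a nondegenerate local maximum point $q_{is}$. Consider the unperturbed system $H=H_1+H_2$ with an impassable vertical wall at $q_1=0$ (elastic reflection), the wall being in regular position: $V_1'(0)\neq0$ and $V_1(0)\ne V_1(q_{1s})$ for every saddle $q_{1s}$ of $V_1$. A (compact, regular) leaf of $H_i$ of energy $h$ is a connected component of $\{H_i=h\}$ which is either a closed curve without fixed points, or an elliptic fixed point; it is determined by its projection $[a,b]$ to the $q_i$-axis. A branch is a maximal connected family of leaves. On a branch $B$ the leaves are labelled by the action $\frac1{\pi}\int_a^b\sqrt{2(h-V_i(q))}\,dq$, which vanishes exactly at elliptic fixed points; $H_i(\cdot)$ denotes the energy as a function of the action on the branch, $\omega_i=H_i'$ and $T_i=2\pi/\omega_i$. For $\delta>0$ put $$\mathbb S_i^{\delta}(H)=\bigcup_{q_{is}}(V_i(q_{is})-\delta,V_i(q_{is})+\delta)\cup\bigcup_{q_{\bar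 i s}}(H-V_{\bar i}(q_{\bar is})-\delta,H-V_{\bar i}(q_{\bar is})+\delta),\qquad \mathbb H_i^{R,\delta}(H)=[\min V_i,\,H-\min V_{\bar i}]\setminus\mathbb S_i^\delta(H),$$ where $\bar i$ is the other index. The total energy $H$ is $\delta$-regular if $V_1(0)\in\mathbb H_1^{R,\delta}(H)$. On each branch $B_2$ of $H_2$ let $I_{tan}(H)=H_2^{-1}(H-V_1(0))$ (if $B_2$ has a leaf of that energy), let $\mathcal N_\rho(I_{tan}(H))$ be the open interval $(I_{tan}-\rho,I_{tan}+\rho)$ (empty if there is no $I_{tan}$), and let the regular set be $$\mathcal R_{\delta,\rho}=H_2^{-1}(\mathbb H_2^{R,\delta}(H))\setminus\mathcal N_\rho(I_{tan}(H)),$$ with $H_2^{-1}$ multi-valued, i.e. taken on every branch. For branches $B_1,B_2$ of $H_1,H_2$ and an action $I$ of $B_2$ such that $B_1$ has a leaf $[a,b]$ of energy $h_1=H-H_2(I)$, let $J=J(H,I)$ be the action of that leaf, $\Delta t_{travel}=2\int_a^0\frac{dq}{\sqrt{2(h_1-V_1(q))}}$ if $a<0<b$ (impact) and $\Delta t_{travel}=0$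 otherwise, and $$\mathcal F_0(I,\theta)=(I,\theta+\Theta(I)),\qquad \Theta(I)=\omega_2(I)\,\bigl(T_1(J)-\Delta t_{travel}\bigr),$$ the integrable impact return map. **Theorem.** Fix $H$. 1. Let $\delta,\rho>0$ and let $H$ be $\delta$-regular. Consider all pairs of branches $B_1,B_2$ and all $I\in\mathcal R_{\delta,\rho}$ on $B_2$ for which $J(H,I)$ exists on $B_1$, with $I>0$ and $J(H,I)>0$ (no elliptic tori). (a) At each such $I$ and every $\theta$, $\mathcal F_0$ is $C^r$ and preserves $dI\wedge d\theta$. (b) For every $\eta>0$ there is $M=M_r(\rho,\delta,\eta)<\infty$ such that $|\Theta^{(k)}(I)|<M$ for all $0\le k\le r$, for all such $B_1,B_2,I$ with $I\ge\eta$ and $J(H,I)\ge\eta$. (c) If moreover $V_1,V_2$ are $C^{2r+2}$, then there is $M=M_r(\rho,\delta)<\infty$ such that $|\Theta^{(k)}(I)|<M$ for all $0\le k\le r$ and all such $B_1,B_2,I$ (up to the elliptic tori). 2. Suppose $H$ is $\delta$-regular for some $\delta>0$. Then there are $C,c,\delta_0,\rho_0>0$ such that, the Lebesgue measures of sets of actions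 being added over all branches $B_2$: (a) for all $0<\delta<\delta_0$ and $\rho>0$ the excluded set satisfies $|H_2^{-1}(\mathbb S_2^\delta(H))\cup\mathcal N_\rho(I_{tan}(H))|\le C(\delta|\ln\delta|+\rho)$; (b) for all $0<\delta<\delta_0$ and $0<\rho<\rho_0$ the regular set is of order one: $c\le|\mathcal R_{\delta,\rho}|\le C$. -/

import Mathlib

open Set MeasureTheory Filter Topology

noncomputable section

namespace ImpactMap

/-- A one degree of freedom potential of the S3B class, of smoothness `C^n`: finitely many critical
points, all of them nondegenerate (no parabolic points), bounded below, tending to `+∞` at `±∞`. -/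
structure IsS3B (n : ℕ) (V : ℝ → ℝ) : Prop where
  smooth : ContDiff ℝ n V
  finite_crit : {q : ℝ | deriv V q = 0}.Finite
  simple : ∀ q : ℝ, deriv V q = 0 → deriv (deriv V) q ≠ 0
  bddBelow : BddBelow (range V)
  atTop : Tendsto V (cocompact ℝ) atTop

/-- `min V` (attained for S3B potentials). -/
def minV (V : ℝ → ℝ) : ℝ := sInf (range V)

/-- Positions `q` of the saddle fixed points `(q, 0)` of `p ^ 2 / 2 + V q`. -/
def saddles (V : ℝ → ℝ) : Set ℝ := {q | deriv V q = 0 ∧ deriv (deriv V) q < 0}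

/-- The energies of a degree of freedom with potential `V` that are removed on the total energy
level `H`: the open `δ`-neighbourhoods of the saddle energies of `V`, and those energies for which
the complementary energy is `δ`-close to a saddle energy of the other potential `W`. -/
def singularEnergies (V W : ℝ → ℝ) (δ H : ℝ) : Set ℝ :=
  (⋃ q ∈ saddles V, Ioo (V q - δ) (V q + δ)) ∪
    ⋃ q ∈ saddles W, Ioo (H - W q - δ) (H - W q + δ)

/-- The `δ`-regular energies of the degree of freedom with potential `V` on the total energy level
`H`, where `W` is the potential of the other degree of freedom. -/
def regularEnergies (V W : ℝ → ℝ) (δ H : ℝ) : Set ℝ :=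
  Icc (minV V) (H - minV W) \ singularEnergies V W δ H

/-- The wall `q₁ = 0` is in regular position. -/
def RegularWall (V₁ : ℝ → ℝ) : Prop :=
  deriv V₁ 0 ≠ 0 ∧ ∀ q ∈ saddles V₁, V₁ 0 ≠ V₁ q

/-- The total energy `H` is `δ`-regular with respect to the wall position. -/
def DeltaRegular (V₁ V₂ : ℝ → ℝ) (δ H : ℝ) : Prop :=
  V₁ 0 ∈ regularEnergies V₁ V₂ δ H

/-! ### Liouville leaves, branches and actions in one degree of freedom -/

/-- The compact regular leaves of `p ^ 2 / 2 + V q`. A leaf (a connected component of a level set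
`p ^ 2 / 2 + V q = h`) is recorded by its projection `[a, b]` to the `q`-axis, as the pair `(a, b)`:
it is `{(q, p) | q ∈ [a, b], p ^ 2 / 2 + V q = h}`. Either it is a circle without fixed points
(`a < b` and both turning points are noncritical), or it is an elliptic fixed point
(`a = b`, a nondegenerate minimum). -/
def leaves (V : ℝ → ℝ) : Set (ℝ × ℝ) :=
  {x | (x.1 < x.2 ∧ V x.1 = V x.2 ∧ (∀ q ∈ Ioo x.1 x.2, V q < V x.1) ∧
          deriv V x.1 ≠ 0 ∧ deriv V x.2 ≠ 0) ∨
       (x.1 = x.2 ∧ deriv V x.1 = 0 ∧ 0 < deriv (deriv V) x.1)}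

/-- A branch of the foliation: a maximal connected family of regular leaves. -/
def IsBranch (V : ℝ → ℝ) (B : Set (ℝ × ℝ)) : Prop :=
  ∃ x ∈ leaves V, B = connectedComponentIn (leaves V) x

/-- Energy of a leaf. -/
def energy (V : ℝ → ℝ) (x : ℝ × ℝ) : ℝ := V x.1

/-- Action of a leaf, `(1 / 2π) ∮ p dq`. -/
def action (V : ℝ → ℝ) (x : ℝ × ℝ) : ℝ :=
  (1 / Real.pi) * ∫ q in x.1..x.2, Real.sqrt (2 * (energy V x - V q))

/-- The leaf of the branch `B` with the given energy. -/
def leafOfEnergy (V : ℝ → ℝ) (B : Set (ℝ × ℝ)) (h : ℝ) : ℝ × ℝ :=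
  Function.invFunOn (energy V) B h

/-- The leaf of the branch `B` with the given action. -/
def leafOfAction (V : ℝ → ℝ) (B : Set (ℝ × ℝ)) (I : ℝ) : ℝ × ℝ :=
  Function.invFunOn (action V) B I

/-- The Hamiltonian `I ↦ H_i(I)` of the branch `B` as a function of the action. -/
def hamiltonian (V : ℝ → ℝ) (B : Set (ℝ × ℝ)) (I : ℝ) : ℝ :=
  energy V (leafOfAction V B I)

/-- The frequency `ω_i(I) = H_i'(I)` on the branch `B`. -/
def frequency (V : ℝ → ℝ) (B : Set (ℝ × ℝ)) (I : ℝ) : ℝ := deriv (hamiltonian V B) I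

/-- The period `T_i(I) = 2π / ω_i(I)` on the branch `B`. -/
def period (V : ℝ → ℝ) (B : Set (ℝ × ℝ)) (I : ℝ) : ℝ := 2 * Real.pi / frequency V B I

/-! ### The integrable impact return map -/

/-- The action `J(H, I) = H₁⁻¹(H - H₂(I))`, with `H₁⁻¹` taken on `B₁` and `H₂(I)` on `B₂`. -/
def complementaryAction (V₁ V₂ : ℝ → ℝ) (B₁ B₂ : Set (ℝ × ℝ)) (H I : ℝ) : ℝ :=
  action V₁ (leafOfEnergy V₁ B₁ (H - hamiltonian V₂ B₂ I))

/-- The travel time behind the wall `q₁ = 0`. A leaf impacts the wall iff `0` is interior to its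
projection; otherwise (tangency or no intersection) no time is lost. -/
def travelTime (V₁ : ℝ → ℝ) (x : ℝ × ℝ) : ℝ :=
  open Classical in
  if x.1 < 0 ∧ 0 < x.2 then
    2 * ∫ q in x.1..0, 1 / Real.sqrt (2 * (energy V₁ x - V₁ q))
  else 0

/-- `Θ(I) = ω₂(I) (T₁(J) - Δt_travel(J))` with `J = J(H, I)`. -/
def rotation (V₁ V₂ : ℝ → ℝ) (B₁ B₂ : Set (ℝ × ℝ)) (H I : ℝ) : ℝ :=
  frequency V₂ B₂ I *
    (period V₁ B₁ (complementaryAction V₁ V₂ B₁ B₂ H I) -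
      travelTime V₁ (leafOfEnergy V₁ B₁ (H - hamiltonian V₂ B₂ I)))

/-- The return map `(I, θ) ↦ (I, θ + Θ(I))`, lifted to the universal cover `θ ∈ ℝ`. -/
def returnMap (V₁ V₂ : ℝ → ℝ) (B₁ B₂ : Set (ℝ × ℝ)) (H : ℝ) (z : ℝ × ℝ) : ℝ × ℝ :=
  (z.1, z.2 + rotation V₁ V₂ B₁ B₂ H z.1)

/-- The symplectic form `dI ∧ dθ`. -/
def sympForm (u v : ℝ × ℝ) : ℝ := u.1 * v.2 - u.2 * v.1

/-- `F` is differentiable at `z` and preserves `dI ∧ dθ` there. -/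
def IsSymplecticAt (F : ℝ × ℝ → ℝ × ℝ) (z : ℝ × ℝ) : Prop :=
  DifferentiableAt ℝ F z ∧
    ∀ u v : ℝ × ℝ, sympForm (fderiv ℝ F z u) (fderiv ℝ F z v) = sympForm u v

/-! ### The regular and the excluded actions -/

/-- The open `ρ`-interval around `I_tan(H) = H₂⁻¹(H - V₁(0))` on the branch `B₂` (empty if no leaf
of `B₂` has the energy `H - V₁(0)`). -/
def tangentInterval (V₁ V₂ : ℝ → ℝ) (B₂ : Set (ℝ × ℝ)) (ρ H : ℝ) : Set ℝ :=
  ⋃ x ∈ {x ∈ B₂ | energy V₂ x = H - V₁ 0}, Ioo (action V₂ x - ρ) (action V₂ x + ρ)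

/-- The part on the branch `B₂` of the regular set
`H₂⁻¹(regular energies) \ (ρ-interval around I_tan)`. -/
def regularActions (V₁ V₂ : ℝ → ℝ) (B₂ : Set (ℝ × ℝ)) (δ ρ H : ℝ) : Set ℝ :=
  action V₂ '' {x ∈ B₂ | energy V₂ x ∈ regularEnergies V₂ V₁ δ H} \
    tangentInterval V₁ V₂ B₂ ρ H

/-- The excluded actions on the branch `B₂`. -/
def excludedActions (V₁ V₂ : ℝ → ℝ) (B₂ : Set (ℝ × ℝ)) (δ ρ H : ℝ) : Set ℝ :=
  action V₂ '' {x ∈ B₂ | energy V₂ x ∈ singularEnergies V₂ V₁ δ H} ∪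
    tangentInterval V₁ V₂ B₂ ρ H

/-- The domain of the return map on the pair of branches `B₁`, `B₂`: regular actions `I` of `B₂`
such that `B₁` has a leaf of energy `H - H₂(I)`. Leaves with `I = 0` or `J = 0` are exactly the
elliptic fixed points, where the angle variable degenerates. -/
def InDomain (V₁ V₂ : ℝ → ℝ) (B₁ B₂ : Set (ℝ × ℝ)) (δ ρ H I : ℝ) : Prop :=
  IsBranch V₁ B₁ ∧ IsBranch V₂ B₂ ∧ I ∈ regularActions V₁ V₂ B₂ δ ρ H ∧
    H - hamiltonian V₂ B₂ I ∈ energy V₁ '' B₁ ∧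
    0 < I ∧ 0 < complementaryAction V₁ V₂ B₁ B₂ H I

end ImpactMap

end

noncomputable section

namespace ImpactMap

/-! ### Calculus -/

lemma exists_ball_bound {F : ℝ × ℝ → ℝ} {U : Set ℝ} (hU : IsOpen U) {a b : ℝ}
    (hF : ∀ h ∈ U, ∀ u ∈ Icc a b, ContinuousAt F (h, u)) {h₀ : ℝ} (h₀U : h₀ ∈ U) :
    ∃ ε > 0, Metric.closedBall h₀ ε ⊆ U ∧
      ∃ C, ∀ h ∈ Metric.closedBall h₀ ε, ∀ u ∈ Icc a b, |F (h, u)| ≤ C := by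
  obtain ⟨ε, hε, hεU⟩ := Metric.nhds_basis_closedBall.mem_iff.1 (hU.mem_nhds h₀U)
  have hK : IsCompact (Metric.closedBall h₀ ε ×ˢ Icc a b) :=
    (isCompact_closedBall h₀ ε).prod isCompact_Icc
  obtain ⟨C, hC⟩ := hK.exists_bound_of_continuousOn (f := F)
    fun z hz => (hF z.1 (hεU hz.1) z.2 hz.2).continuousWithinAt
  exact ⟨ε, hε, hεU, C, fun h hh u hu => hC (h, u) ⟨hh, hu⟩⟩

lemma continuousOn_slice {F : ℝ × ℝ → ℝ} {U : Set ℝ} {a b : ℝ}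
    (hF : ∀ h ∈ U, ∀ u ∈ Icc a b, ContinuousAt F (h, u)) {h : ℝ} (hh : h ∈ U) :
    ContinuousOn (fun u => F (h, u)) (Icc a b) := fun u hu =>
  (ContinuousAt.comp (f := fun u : ℝ => (h, u)) (g := F) (hF h hh u hu)
    (by fun_prop)).continuousWithinAt

lemma continuousOn_parametric_integral {F : ℝ × ℝ → ℝ} {U : Set ℝ} (hU : IsOpen U) {a b : ℝ}
    (hab : a ≤ b) (hF : ∀ h ∈ U, ∀ u ∈ Icc a b, ContinuousAt F (h, u)) :
    ContinuousOn (fun h => ∫ u in a..b, F (h, u)) U := by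
  intro h₀ h₀U
  obtain ⟨ε, hε, hεU, C, hC⟩ := exists_ball_bound hU hF h₀U
  have hnhds : Metric.closedBall h₀ ε ∈ 𝓝 h₀ := Metric.closedBall_mem_nhds _ hε
  refine (intervalIntegral.continuousAt_of_dominated_interval (bound := fun _ => C)
    ?_ ?_ (by simp) ?_).continuousWithinAt
  · filter_upwards [hnhds] with h hh
    exact ((continuousOn_slice hF (hεU hh)).mono
      (by rw [uIoc_of_le hab]; exact Ioc_subset_Icc_self)).aestronglyMeasurable measurableSet_uIoc
  · filter_upwards [hnhds] with h hh
    refine Eventually.of_forall fun u hu => ?_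
    rw [uIoc_of_le hab] at hu
    exact hC h hh u ⟨hu.1.le, hu.2⟩
  · refine Eventually.of_forall fun u hu => ?_
    rw [uIoc_of_le hab] at hu
    exact ContinuousAt.comp (f := fun h : ℝ => (h, u)) (g := F) (hF h₀ h₀U u ⟨hu.1.le, hu.2⟩)
      (by fun_prop)

lemma hasDerivAt_slice {F : ℝ × ℝ → ℝ} {h u : ℝ} (hF : DifferentiableAt ℝ F (h, u)) :
    HasDerivAt (fun h => F (h, u)) (fderiv ℝ F (h, u) (1, 0)) h :=
  hF.hasFDerivAt.comp_hasDerivAt (f := fun h : ℝ => (h, u)) h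
    ((hasDerivAt_id h).prodMk (hasDerivAt_const h u))

lemma contDiffAt_fderiv_slice {n : ℕ} {F : ℝ × ℝ → ℝ} {z : ℝ × ℝ}
    (hF : ContDiffAt ℝ (n + 1 : ℕ) F z) :
    ContDiffAt ℝ n (fun z => fderiv ℝ F z (1, 0)) z :=
  (hF.fderiv_right (m := n) (by norm_cast)).clm_apply contDiffAt_const

lemma hasDerivAt_parametric_integral {F : ℝ × ℝ → ℝ} {U : Set ℝ} (hU : IsOpen U)
    {a b : ℝ} (hab : a ≤ b) (hF : ∀ h ∈ U, ∀ u ∈ Icc a b, ContDiffAt ℝ 1 F (h, u))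
    {h₀ : ℝ} (h₀U : h₀ ∈ U) :
    HasDerivAt (fun h => ∫ u in a..b, F (h, u)) (∫ u in a..b, fderiv ℝ F (h₀, u) (1, 0)) h₀ := by
  set F' : ℝ × ℝ → ℝ := fun z => fderiv ℝ F z (1, 0) with hF'
  have hF'c : ∀ h ∈ U, ∀ u ∈ Icc a b, ContinuousAt F' (h, u) := fun h hh u hu =>
    (contDiffAt_fderiv_slice (n := 0) (by exact_mod_cast hF h hh u hu)).continuousAt
  have hFc : ∀ h ∈ U, ∀ u ∈ Icc a b, ContinuousAt F (h, u) :=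
    fun h hh u hu => (hF h hh u hu).continuousAt
  obtain ⟨ε, hε, hεU, C, hC⟩ := exists_ball_bound hU hF'c h₀U
  have hnhds : Metric.closedBall h₀ ε ∈ 𝓝 h₀ := Metric.closedBall_mem_nhds _ hε
  refine (intervalIntegral.hasDerivAt_integral_of_dominated_loc_of_deriv_le
    (F := fun h u => F (h, u)) (F' := fun h u => F' (h, u)) (bound := fun _ => C) hnhds
    ?_ ?_ ?_ ?_ (by simp) ?_).2
  · filter_upwards [hnhds] with h hh
    exact ((continuousOn_slice hFc (hεU hh)).mono
      (by rw [uIoc_of_le hab]; exact Ioc_subset_Icc_self)).aestronglyMeasurable measurableSet_uIoc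
  · exact ContinuousOn.intervalIntegrable
      (by rw [uIcc_of_le hab]; exact continuousOn_slice hFc h₀U)
  · exact ((continuousOn_slice hF'c h₀U).mono
      (by rw [uIoc_of_le hab]; exact Ioc_subset_Icc_self)).aestronglyMeasurable measurableSet_uIoc
  · refine Eventually.of_forall fun u hu h hh => ?_
    rw [uIoc_of_le hab] at hu
    exact hC h hh u ⟨hu.1.le, hu.2⟩
  · refine Eventually.of_forall fun u hu h hh => ?_
    rw [uIoc_of_le hab] at hu
    exact hasDerivAt_slice ((hF h (hεU hh) u ⟨hu.1.le, hu.2⟩).differentiableAt one_ne_zero)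

lemma contDiffOn_parametric_integral (n : ℕ) {F : ℝ × ℝ → ℝ} {U : Set ℝ} (hU : IsOpen U)
    {a b : ℝ} (hab : a ≤ b) (hF : ∀ h ∈ U, ∀ u ∈ Icc a b, ContDiffAt ℝ n F (h, u)) :
    ContDiffOn ℝ n (fun h => ∫ u in a..b, F (h, u)) U := by
  induction n generalizing F with
  | zero =>
    exact contDiffOn_zero.2 (continuousOn_parametric_integral hU hab
      fun h hh u hu => (hF h hh u hu).continuousAt)
  | succ n ih =>
    have hder := fun h (hh : h ∈ U) => hasDerivAt_parametric_integral hU hab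
      (fun h hh u hu => (hF h hh u hu).of_le (by norm_cast; omega)) hh
    push_cast
    rw [contDiffOn_succ_iff_deriv_of_isOpen hU]
    refine ⟨fun h hh => (hder h hh).differentiableAt.differentiableWithinAt, by simp, ?_⟩
    exact (ih (F := fun z => fderiv ℝ F z (1, 0))
      fun h hh u hu => contDiffAt_fderiv_slice (hF h hh u hu)).congr fun h hh => (hder h hh).deriv

lemma contDiff_parametric_integral {n : ℕ} {F : ℝ × ℝ → ℝ} {a b : ℝ} (hab : a ≤ b)
    (hF : ContDiff ℝ n F) : ContDiff ℝ n (fun h => ∫ u in a..b, F (h, u)) :=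
  contDiffOn_univ.1 (contDiffOn_parametric_integral n isOpen_univ hab
    fun _ _ _ _ => hF.contDiffAt)

lemma contDiff_deriv {n : ℕ} {f : ℝ → ℝ} (hf : ContDiff ℝ (n + 1 : ℕ) f) :
    ContDiff ℝ n (deriv f) := by
  push_cast at hf
  exact (contDiff_succ_iff_deriv.1 hf).2.2

/-- A `C^{n+1}` function vanishing at zero is `x` times a `C^n` function. -/
lemma eq_mul_integral_deriv {f : ℝ → ℝ} (hf : ContDiff ℝ 1 f) (x : ℝ) :
    f x = f 0 + x * ∫ t in (0 : ℝ)..1, deriv f (x * t) := by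
  have hc : Continuous (deriv f) := (contDiff_one_iff_deriv.1 hf).2
  have h1 : x * ∫ t in (0 : ℝ)..1, deriv f (x * t) = ∫ t in (x * 0)..(x * 1), deriv f t := by
    exact intervalIntegral.smul_integral_comp_mul_left (deriv f) x (a := 0) (b := 1)
  rw [h1, mul_zero, mul_one, intervalIntegral.integral_deriv_eq_sub
    (fun y _ => (hf.differentiable one_ne_zero) y) (hc.intervalIntegrable _ _)]
  ring

lemma exists_contDiff_comp_sq {n : ℕ} {F : ℝ → ℝ} (hF : ContDiff ℝ (2 * n : ℕ) F)
    (heven : ∀ x, F (-x) = F x) : ∃ G : ℝ → ℝ, ContDiff ℝ n G ∧ ∀ x, F x = G (x ^ 2) := by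
  induction n generalizing F with
  | zero =>
    refine ⟨fun e => F (√e), contDiff_zero.2 (hF.continuous.comp Real.continuous_sqrt), ?_⟩
    intro x
    simp only [Real.sqrt_sq_eq_abs]
    rcases abs_choice x with h | h <;> rw [h]
    exact (heven x).symm
  | succ n ih =>
    have hF1 : ContDiff ℝ (2 * n + 1 : ℕ) (deriv F) := contDiff_deriv (n := 2 * n + 1) hF
    have hF2 : ContDiff ℝ (2 * n : ℕ) (deriv (deriv F)) := contDiff_deriv hF1
    have hdF : Differentiable ℝ F := hF.differentiable (by norm_cast)
    have hodd : ∀ x, deriv F (-x) = - deriv F x := by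
      intro x
      have := deriv_comp_neg F x
      simp only [heven] at this
      linarith
    have heven2 : ∀ x, deriv (deriv F) (-x) = deriv (deriv F) x := by
      intro x
      have h := deriv_comp_neg (deriv F) x
      have h2 : (fun x => deriv F (-x)) = fun x => - deriv F x := funext hodd
      rw [h2, deriv.fun_neg] at h
      linarith
    obtain ⟨G₁, hG₁, hG₁F⟩ := ih (F := fun x => ∫ t in (0 : ℝ)..1, deriv (deriv F) (x * t))
      (contDiff_parametric_integral zero_le_one
        (F := fun z : ℝ × ℝ => deriv (deriv F) (z.1 * z.2)) (hF2.comp (by fun_prop)))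
      (fun x => by simp only [neg_mul, heven2])
    have hF'x : ∀ x, deriv F x = x * G₁ (x ^ 2) := by
      intro x
      have h0 : deriv F 0 = 0 := by have := hodd 0; simp at this; linarith
      rw [← hG₁F, eq_mul_integral_deriv (hF1.of_le (by norm_cast; omega)) x, h0, zero_add]
    have hderG : ∀ e, HasDerivAt (fun e => F 0 + (1 / 2) * ∫ s in (0 : ℝ)..e, G₁ s)
        ((1 / 2) * G₁ e) e := fun e =>
      ((intervalIntegral.integral_hasDerivAt_right (hG₁.continuous.intervalIntegrable _ _)
        (hG₁.continuous.stronglyMeasurableAtFilter _ _) hG₁.continuous.continuousAt).const_mul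
        (1 / 2)).const_add (F 0)
    refine ⟨fun e => F 0 + (1 / 2) * ∫ s in (0 : ℝ)..e, G₁ s, ?_, ?_⟩
    · push_cast
      rw [contDiff_succ_iff_deriv]
      refine ⟨fun e => (hderG e).differentiableAt, by simp, ?_⟩
      rw [show deriv (fun e => F 0 + (1 / 2) * ∫ s in (0 : ℝ)..e, G₁ s)
        = fun e => (1 / 2) * G₁ e from funext fun e => (hderG e).deriv]
      fun_prop
    · intro x
      have hd : ∀ y, HasDerivAt (fun x => F x - (F 0 + (1 / 2) * ∫ s in (0 : ℝ)..(x ^ 2), G₁ s))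
          0 y := by
        intro y
        have h1 := (hderG (y ^ 2)).comp y (hasDerivAt_pow 2 y)
        refine ((hdF y).hasDerivAt.sub h1).congr_deriv ?_
        rw [hF'x]; norm_num; ring
      have hconst := is_const_of_deriv_eq_zero (fun y => (hd y).differentiableAt)
        (fun y => (hd y).deriv) x 0
      simp at hconst
      simp only [one_div]
      linarith

lemma exists_contDiff_eventuallyEq {n : ℕ} {f : ℝ → ℝ} {x₀ : ℝ} (hf : ContDiffAt ℝ n f x₀) :
    ∃ g : ℝ → ℝ, ContDiff ℝ n g ∧ g =ᶠ[𝓝 x₀] f := by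
  obtain ⟨u, hu, hfu⟩ := hf.contDiffOn (m := n) le_rfl (by simp)
  obtain ⟨ε, hε, hεu⟩ := Metric.nhds_basis_ball.mem_iff.1 hu
  let φ : ContDiffBump x₀ := ⟨ε / 4, ε / 2, by positivity, by linarith⟩
  refine ⟨fun x => φ x * f x, ?_, ?_⟩
  · refine contDiff_iff_contDiffAt.2 fun x => ?_
    by_cases hx : x ∈ Metric.ball x₀ ε
    · exact φ.contDiffAt.mul (((hfu.mono hεu).contDiffAt (Metric.isOpen_ball.mem_nhds hx)))
    · have : (fun x => φ x * f x) =ᶠ[𝓝 x] fun _ => 0 := by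
        have : (Metric.closedBall x₀ (ε / 2))ᶜ ∈ 𝓝 x := by
          refine Metric.isClosed_closedBall.isOpen_compl.mem_nhds fun hx' => hx ?_
          exact Metric.closedBall_subset_ball (by linarith) hx'
        filter_upwards [this] with y hy
        have h0 : φ y = 0 := φ.zero_of_le_dist
          (by simp only [mem_compl_iff, Metric.mem_closedBall, not_le] at hy; exact hy.le)
        rw [h0, zero_mul]
      exact contDiffAt_const.congr_of_eventuallyEq this
  · filter_upwards [φ.eventuallyEq_one] with x hx
    simp [hx]

lemma exists_local_inverse {n : ℕ} (hn : n ≠ 0) {V : ℝ → ℝ} {b : ℝ} (hV : ContDiffAt ℝ n V b)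
    (hb : deriv V b ≠ 0) :
    ∃ g : ℝ → ℝ, ContDiff ℝ n g ∧ (∀ᶠ q in 𝓝 b, g (V q) = q) ∧
      (∀ᶠ v in 𝓝 (V b), V (g v) = v) := by
  have hn' : (n : WithTop ℕ∞) ≠ 0 := by exact_mod_cast hn
  have hd := (hV.differentiableAt hn').hasDerivAt.hasFDerivAt_equiv hb
  set e := hV.toOpenPartialHomeomorph V hd hn' with he
  have hbs : b ∈ e.source := hV.mem_toOpenPartialHomeomorph_source hd hn'
  have hg : ContDiffAt ℝ n (hV.localInverse hd hn') (V b) := hV.to_localInverse hd hn'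
  obtain ⟨g, hgc, hge⟩ := exists_contDiff_eventuallyEq hg
  refine ⟨g, hgc, ?_, ?_⟩
  · filter_upwards [hV.continuousAt.eventually hge, e.open_source.mem_nhds hbs] with q h1 h2
    rw [h1]
    exact e.left_inv h2
  · filter_upwards [hge, e.open_target.mem_nhds (e.map_source hbs)] with v h1 h2
    rw [h1]
    exact e.right_inv h2

section

/-! ### Leaves and branches -/

variable {V : ℝ → ℝ} {x y : ℝ × ℝ} {B : Set (ℝ × ℝ)}

lemma IsS3B.of_le {m n : ℕ} (hV : IsS3B n V) (h : m ≤ n) : IsS3B m V :=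
  ⟨hV.smooth.of_le (by exact_mod_cast h), hV.finite_crit, hV.simple, hV.bddBelow, hV.atTop⟩

lemma IsS3B.differentiable (hV : IsS3B 2 V) : Differentiable ℝ V :=
  hV.smooth.differentiable (by norm_num)

lemma IsS3B.continuous (hV : IsS3B 2 V) : Continuous V := hV.smooth.continuous

lemma IsS3B.continuous_deriv (hV : IsS3B 2 V) : Continuous (deriv V) :=
  (contDiff_deriv (n := 1) hV.smooth).continuous

lemma leaf_le (hx : x ∈ leaves V) : x.1 ≤ x.2 := by
  rcases hx with h | h
  exacts [h.1.le, h.1.le]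

lemma leaf_eq (hx : x ∈ leaves V) : V x.2 = V x.1 := by
  rcases hx with h | h
  exacts [h.2.1.symm, by rw [h.1]]

lemma leaf_lt (hx : x ∈ leaves V) {q : ℝ} (hq : q ∈ Ioo x.1 x.2) : V q < V x.1 := by
  rcases hx with h | h
  · exact h.2.2.1 q hq
  · exact absurd (hq.1.trans hq.2) (by rw [h.1]; exact lt_irrefl _)

lemma leaf_le_energy (hx : x ∈ leaves V) {q : ℝ} (hq : q ∈ Icc x.1 x.2) : V q ≤ V x.1 := by
  rcases eq_or_lt_of_le hq.1 with h | h
  · rw [h]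
  rcases eq_or_lt_of_le hq.2 with h' | h'
  · rw [h', leaf_eq hx]
  exact (leaf_lt hx ⟨h, h'⟩).le

/-- A maximum at the left end of an interval cannot be at a point of positive derivative. -/
lemma deriv_nonpos_of_left_max {a b : ℝ} (hab : a < b) (h : ∀ q ∈ Icc a b, V q ≤ V a) :
    deriv V a ≤ 0 := by
  by_contra! hpos
  have h1 := eventually_nhdsWithin_sign_eq_of_deriv_pos (f := fun x => V x - V a) (x₀ := a)
    (by rw [deriv_sub_const]; exact hpos) (by simp)
  obtain ⟨q, hq1, hq2⟩ := ((h1.filter_mono nhdsWithin_le_nhds).and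
    (Ioo_mem_nhdsGT hab)).exists
  rw [sign_pos (sub_pos.2 hq2.1), sign_eq_one_iff] at hq1
  linarith [h q ⟨hq2.1.le, hq2.2.le⟩]

lemma deriv_nonneg_of_right_max {a b : ℝ} (hab : a < b) (h : ∀ q ∈ Icc a b, V q ≤ V b) :
    0 ≤ deriv V b := by
  have := deriv_nonpos_of_left_max (V := fun x => V (-x)) (a := -b) (b := -a) (by linarith)
    (fun q hq => by simpa using h (-q) ⟨by linarith [hq.2], by linarith [hq.1]⟩)
  rw [deriv_comp_neg] at this
  simpa using this

lemma deriv_deriv_nonpos_of_left_max (hV : Differentiable ℝ V) {a b : ℝ} (hab : a < b)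
    (h : ∀ q ∈ Icc a b, V q ≤ V a) (hd : deriv V a = 0) : deriv (deriv V) a ≤ 0 := by
  by_contra! hpos
  have h1 := eventually_nhdsWithin_sign_eq_of_deriv_pos hpos hd
  obtain ⟨ε, hε, hεs⟩ := Metric.eventually_nhds_iff_ball.1 h1
  set c := min b (a + ε / 2) with hc
  have hac : a < c := lt_min hab (by linarith)
  have hmono : StrictMonoOn V (Icc a c) := by
    refine strictMonoOn_of_deriv_pos (convex_Icc a c) hV.continuous.continuousOn fun q hq => ?_
    rw [interior_Icc] at hq
    have hqε : q < a + ε := by linarith [hq.2, min_le_right b (a + ε / 2)]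
    have := hεs q (by rw [Real.ball_eq_Ioo]; exact ⟨by linarith [hq.1], hqε⟩)
    rwa [sign_pos (sub_pos.2 hq.1), sign_eq_one_iff] at this
  have h2 := hmono (left_mem_Icc.2 hac.le) (right_mem_Icc.2 hac.le) hac
  linarith [h c ⟨hac.le, min_le_left _ _⟩]

lemma deriv_deriv_nonpos_of_right_max (hV : Differentiable ℝ V) {a b : ℝ} (hab : a < b)
    (h : ∀ q ∈ Icc a b, V q ≤ V b) (hd : deriv V b = 0) : deriv (deriv V) b ≤ 0 := by
  have := deriv_deriv_nonpos_of_left_max (V := fun x => V (-x)) (a := -b) (b := -a)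
    (hV.comp differentiable_neg) (by linarith)
    (fun q hq => by simpa using h (-q) ⟨by linarith [hq.2], by linarith [hq.1]⟩)
    (by rw [deriv_comp_neg]; simpa using hd)
  rw [show (deriv fun x => V (-x)) = fun x => - deriv V (-x) from
    funext fun x => deriv_comp_neg V x, deriv.fun_neg, deriv_comp_neg] at this
  simpa using this

lemma leaf_deriv_left_neg (hx : x ∈ leaves V) (hlt : x.1 < x.2) : deriv V x.1 < 0 := by
  have h : deriv V x.1 ≤ 0 := deriv_nonpos_of_left_max hlt fun q hq => leaf_le_energy hx hq
  rcases hx with h' | h'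
  exacts [lt_of_le_of_ne h h'.2.2.2.1, absurd h'.1 hlt.ne]

lemma leaf_deriv_right_pos (hx : x ∈ leaves V) (hlt : x.1 < x.2) : 0 < deriv V x.2 := by
  have h := deriv_nonneg_of_right_max hlt fun q hq =>
    (leaf_le_energy hx hq).trans_eq (leaf_eq hx).symm
  rcases hx with h' | h'
  exacts [lt_of_le_of_ne h h'.2.2.2.2.symm, absurd h'.1 hlt.ne]

lemma leaf_elliptic (hx : x ∈ leaves V) (he : x.1 = x.2) :
    deriv V x.1 = 0 ∧ 0 < deriv (deriv V) x.1 := by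
  rcases hx with h | h
  exacts [absurd he h.1.ne, h.2]

lemma leaf_exists_crit (hV : IsS3B 2 V) (hx : x ∈ leaves V) :
    ∃ c ∈ Icc x.1 x.2, deriv V c = 0 := by
  rcases hx with h | h
  · obtain ⟨c, hc, hc'⟩ := exists_deriv_eq_zero h.1 hV.continuous.continuousOn h.2.1
    exact ⟨c, Ioo_subset_Icc_self hc, hc'⟩
  · exact ⟨x.1, ⟨le_rfl, h.1.le⟩, h.2.1⟩

lemma leaf_crit_mem_Ioo (hx : x ∈ leaves V) (hlt : x.1 < x.2) {c : ℝ} (hc : deriv V c = 0)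
    (hcx : c ∈ Icc x.1 x.2) : c ∈ Ioo x.1 x.2 := by
  refine ⟨lt_of_le_of_ne hcx.1 ?_, lt_of_le_of_ne hcx.2 ?_⟩
  · rintro rfl; exact (leaf_deriv_left_neg hx hlt).ne hc
  · rintro rfl; exact (leaf_deriv_right_pos hx hlt).ne' hc

/-- The critical points inside a leaf are locally constant along the foliation. -/
lemma eventually_crit_mem_iff (hV : IsS3B 2 V) (hx : x ∈ leaves V) {c : ℝ}
    (hc : deriv V c = 0) : ∀ᶠ y in 𝓝[leaves V] x, (c ∈ Icc x.1 x.2 ↔ c ∈ Icc y.1 y.2) := by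
  have t1 : Tendsto (fun y : ℝ × ℝ => y.1) (𝓝[leaves V] x) (𝓝 x.1) :=
    continuous_fst.continuousAt.mono_left nhdsWithin_le_nhds
  have t2 : Tendsto (fun y : ℝ × ℝ => y.2) (𝓝[leaves V] x) (𝓝 x.2) :=
    continuous_snd.continuousAt.mono_left nhdsWithin_le_nhds
  rcases lt_or_ge c x.1 with h1 | h1
  · filter_upwards [t1.eventually (lt_mem_nhds h1)] with y hy
    exact iff_of_false (fun h => absurd h.1 h1.not_ge) (fun h => absurd h.1 hy.not_ge)
  rcases lt_or_ge x.2 c with h2 | h2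
  · filter_upwards [t2.eventually (gt_mem_nhds h2)] with y hy
    exact iff_of_false (fun h => absurd h.2 h2.not_ge) (fun h => absurd h.2 hy.not_ge)
  rcases eq_or_lt_of_le (leaf_le hx) with he | hlt
  · have hcx : c = x.1 := le_antisymm (by rw [he]; exact h2) h1
    obtain ⟨ε, hε, hεs⟩ := Metric.nhds_basis_ball.mem_iff.1
      ((hV.finite_crit.sdiff (t := {c})).isClosed.isOpen_compl.mem_nhds
        (show c ∈ ({q : ℝ | deriv V q = 0} \ {c})ᶜ by simp))
    rw [Real.ball_eq_Ioo] at hεs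
    rw [← he, ← hcx] at t2
    rw [← hcx] at t1
    filter_upwards [t1.eventually (lt_mem_nhds (show c - ε < c by linarith)),
      t2.eventually (gt_mem_nhds (show c < c + ε by linarith)), self_mem_nhdsWithin] with y h3 h4 hy
    refine iff_of_true ⟨h1, h2⟩ ?_
    obtain ⟨c', hc', hd⟩ := leaf_exists_crit hV hy
    have : c' = c := by
      by_contra hne
      exact hεs ⟨h3.trans_le hc'.1, hc'.2.trans_lt h4⟩ ⟨hd, hne⟩
    exact this ▸ hc'
  · have h3 := leaf_crit_mem_Ioo hx hlt hc ⟨h1, h2⟩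
    filter_upwards [t1.eventually (gt_mem_nhds h3.1), t2.eventually (lt_mem_nhds h3.2)]
      with y hy1 hy2
    exact iff_of_true ⟨h1, h2⟩ ⟨hy1.le, hy2.le⟩

lemma IsBranch.subset_leaves (hB : IsBranch V B) : B ⊆ leaves V := by
  obtain ⟨x, _, rfl⟩ := hB
  exact connectedComponentIn_subset _ _

lemma IsBranch.eq_component (hB : IsBranch V B) (hx : x ∈ B) :
    B = connectedComponentIn (leaves V) x := by
  obtain ⟨y, _, rfl⟩ := hB
  exact connectedComponentIn_eq hx

lemma IsBranch.crit_mem_iff (hV : IsS3B 2 V) (hB : IsBranch V B) (hx : x ∈ B) (hy : y ∈ B)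
    {c : ℝ} (hc : deriv V c = 0) : c ∈ Icc x.1 x.2 ↔ c ∈ Icc y.1 y.2 := by
  have hpre : IsPreconnected B := by
    obtain ⟨z, _, rfl⟩ := hB
    exact isPreconnected_connectedComponentIn
  refine hpre.induction₂ (fun x y => c ∈ Icc x.1 x.2 ↔ c ∈ Icc y.1 y.2) (fun z hz => ?_)
    (fun _ _ _ _ _ _ h h' => h.trans h') (fun _ _ _ _ h => h.symm) hx hy
  exact (eventually_crit_mem_iff hV (hB.subset_leaves hz) hc).filter_mono
    (nhdsWithin_mono _ hB.subset_leaves)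

/-- Two leaves around the same critical points. -/
def SameCrit (V : ℝ → ℝ) (x y : ℝ × ℝ) : Prop :=
  ∀ c, deriv V c = 0 → (c ∈ Icc x.1 x.2 ↔ c ∈ Icc y.1 y.2)

lemma IsBranch.sameCrit (hV : IsS3B 2 V) (hB : IsBranch V B) (hx : x ∈ B) (hy : y ∈ B) :
    SameCrit V x y := fun _ hc => hB.crit_mem_iff hV hx hy hc

lemma leaf_nested {c : ℝ} (hx : x ∈ leaves V) (hy : y ∈ leaves V) (hcx : c ∈ Icc x.1 x.2)
    (hcy : c ∈ Icc y.1 y.2) (hlt : V x.1 < V y.1) : y.1 < x.1 ∧ x.2 < y.2 := by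
  constructor
  · by_contra! h
    exact absurd (leaf_le_energy hx ⟨h, hcy.1.trans hcx.2⟩) hlt.not_ge
  · by_contra! h
    have := leaf_le_energy hx ⟨hcx.1.trans hcy.2, h⟩
    rw [leaf_eq hy] at this
    exact absurd this hlt.not_ge

lemma leaf_eq_of_energy_eq {c : ℝ} (hx : x ∈ leaves V) (hy : y ∈ leaves V)
    (hc : deriv V c = 0) (hcx : c ∈ Icc x.1 x.2) (hcy : c ∈ Icc y.1 y.2) (h : V x.1 = V y.1) :
    x = y := by
  have key : ∀ {x y : ℝ × ℝ}, x ∈ leaves V → y ∈ leaves V → c ∈ Icc x.1 x.2 →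
      c ∈ Icc y.1 y.2 → V x.1 = V y.1 → y.1 ≤ x.1 ∧ x.2 ≤ y.2 := by
    intro x y hx hy hcx hcy h
    constructor
    · by_contra! hlt
      have hlt' : x.1 < x.2 := hlt.trans_le (hcy.1.trans hcx.2)
      have hc' := leaf_crit_mem_Ioo hx hlt' hc hcx
      exact absurd (leaf_lt hx ⟨hlt, hcy.1.trans_lt hc'.2⟩) (by rw [h]; exact lt_irrefl _)
    · by_contra! hlt
      have hlt' : x.1 < x.2 := (hcx.1.trans hcy.2).trans_lt hlt
      have hc' := leaf_crit_mem_Ioo hx hlt' hc hcx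
      exact absurd (leaf_lt hx ⟨hc'.1.trans_le hcy.2, hlt⟩)
        (by rw [leaf_eq hy, h]; exact lt_irrefl _)
  have h1 := key hx hy hcx hcy h
  have h2 := key hy hx hcy hcx h.symm
  exact Prod.ext (le_antisymm h2.1 h1.1) (le_antisymm h1.2 h2.2)

lemma IsBranch.energy_injOn (hV : IsS3B 2 V) (hB : IsBranch V B) : InjOn (energy V) B := by
  intro x hx y hy h
  obtain ⟨c, hcx, hc⟩ := leaf_exists_crit hV (hB.subset_leaves hx)
  exact leaf_eq_of_energy_eq (hB.subset_leaves hx) (hB.subset_leaves hy) hc hcx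
    ((hB.crit_mem_iff hV hx hy hc).1 hcx) h

lemma continuous_momentum (hV : IsS3B 2 V) (h : ℝ) :
    Continuous fun q => Real.sqrt (2 * (h - V q)) := by
  have := hV.continuous
  fun_prop

lemma action_lt_action {c : ℝ} (hV : IsS3B 2 V) (hx : x ∈ leaves V) (hy : y ∈ leaves V)
    (hcx : c ∈ Icc x.1 x.2) (hcy : c ∈ Icc y.1 y.2) (hlt : V x.1 < V y.1) :
    action V x < action V y := by
  obtain ⟨h1, h2⟩ := leaf_nested hx hy hcx hcy hlt
  have hx12 := leaf_le hx
  have hcx' := continuous_momentum hV (V x.1)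
  have hcy' := continuous_momentum hV (V y.1)
  have e1 : 0 < ∫ q in y.1..x.1, Real.sqrt (2 * (V y.1 - V q)) := by
    refine intervalIntegral.intervalIntegral_pos_of_pos_on (hcy'.intervalIntegrable _ _)
      (fun q hq => Real.sqrt_pos.2 ?_) h1
    linarith [leaf_lt hy ⟨hq.1, hq.2.trans (hx12.trans_lt h2)⟩]
  have e2 : ∫ q in x.1..x.2, Real.sqrt (2 * (V x.1 - V q)) ≤
      ∫ q in x.1..x.2, Real.sqrt (2 * (V y.1 - V q)) :=
    intervalIntegral.integral_mono_on hx12 (hcx'.intervalIntegrable _ _)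
      (hcy'.intervalIntegrable _ _) fun q _ => Real.sqrt_le_sqrt (by linarith)
  have e3 : 0 ≤ ∫ q in x.2..y.2, Real.sqrt (2 * (V y.1 - V q)) :=
    intervalIntegral.integral_nonneg h2.le fun q _ => Real.sqrt_nonneg _
  have e4 := intervalIntegral.integral_add_adjacent_intervals
    (hcy'.intervalIntegrable (μ := volume) y.1 x.1) (hcy'.intervalIntegrable x.1 x.2)
  have e5 := intervalIntegral.integral_add_adjacent_intervals
    (hcy'.intervalIntegrable (μ := volume) y.1 x.2) (hcy'.intervalIntegrable x.2 y.2)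
  unfold action energy
  have hpi := Real.pi_pos
  gcongr
  linarith

lemma IsBranch.action_injOn (hV : IsS3B 2 V) (hB : IsBranch V B) : InjOn (action V) B := by
  intro x hx y hy h
  obtain ⟨c, hcx, hc⟩ := leaf_exists_crit hV (hB.subset_leaves hx)
  have hcy := (hB.crit_mem_iff hV hx hy hc).1 hcx
  rcases lt_trichotomy (V x.1) (V y.1) with h1 | h1 | h1
  · exact absurd h
      (action_lt_action hV (hB.subset_leaves hx) (hB.subset_leaves hy) hcx hcy h1).ne
  · exact hB.energy_injOn hV hx hy h1
  · exact absurd h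
      (action_lt_action hV (hB.subset_leaves hy) (hB.subset_leaves hx) hcy hcx h1).ne'

lemma lt_of_action_pos (hx : x ∈ leaves V) (h : 0 < action V x) : x.1 < x.2 := by
  refine lt_of_le_of_ne (leaf_le hx) fun he => ?_
  simp [action, he] at h

lemma leafOfEnergy_energy (hV : IsS3B 2 V) (hB : IsBranch V B) (hx : x ∈ B) :
    leafOfEnergy V B (energy V x) = x :=
  hB.energy_injOn hV (Function.invFunOn_mem ⟨x, hx, rfl⟩) hx
    (Function.invFunOn_eq ⟨x, hx, rfl⟩)

lemma leafOfAction_action (hV : IsS3B 2 V) (hB : IsBranch V B) (hx : x ∈ B) :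
    leafOfAction V B (action V x) = x :=
  hB.action_injOn hV (Function.invFunOn_mem ⟨x, hx, rfl⟩) hx
    (Function.invFunOn_eq ⟨x, hx, rfl⟩)

lemma hamiltonian_action (hV : IsS3B 2 V) (hB : IsBranch V B) (hx : x ∈ B) :
    hamiltonian V B (action V x) = energy V x := by
  rw [hamiltonian, leafOfAction_action hV hB hx]

/-! Nested leaves around the same critical points -/

lemma SameCrit.injOn_left (hV : IsS3B 2 V) (hs : SameCrit V x y) (hx : x ∈ leaves V)
    (h2 : x.2 < y.2) : InjOn V (Icc y.1 x.1) := by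
  have key : ∀ s ∈ Icc y.1 x.1, ∀ t ∈ Icc y.1 x.1, s < t → V s = V t → False := by
    intro s hs' t ht hst h
    obtain ⟨c, hc, hd⟩ := exists_deriv_eq_zero hst hV.continuous.continuousOn h
    have := (hs c hd).2 ⟨hs'.1.trans hc.1.le,
      (hc.2.le.trans ht.2).trans ((leaf_le hx).trans h2.le)⟩
    exact absurd this.1 (hc.2.trans_le ht.2).not_ge
  intro s hs' t ht h
  rcases lt_trichotomy s t with h1 | h1 | h1
  exacts [(key s hs' t ht h1 h).elim, h1, (key t ht s hs' h1 h.symm).elim]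

lemma SameCrit.injOn_right (hV : IsS3B 2 V) (hs : SameCrit V x y) (hx : x ∈ leaves V)
    (h1 : y.1 < x.1) : InjOn V (Icc x.2 y.2) := by
  have key : ∀ s ∈ Icc x.2 y.2, ∀ t ∈ Icc x.2 y.2, s < t → V s = V t → False := by
    intro s hs' t ht hst h
    obtain ⟨c, hc, hd⟩ := exists_deriv_eq_zero hst hV.continuous.continuousOn h
    have := (hs c hd).2 ⟨h1.le.trans ((leaf_le hx).trans (hs'.1.trans hc.1.le)),
      hc.2.le.trans ht.2⟩
    exact absurd this.2 (hs'.1.trans_lt hc.1).not_ge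
  intro s hs' t ht h
  rcases lt_trichotomy s t with h1 | h1 | h1
  exacts [(key s hs' t ht h1 h).elim, h1, (key t ht s hs' h1 h.symm).elim]

lemma SameCrit.nested (hV : IsS3B 2 V) (hs : SameCrit V x y) (hx : x ∈ leaves V)
    (hy : y ∈ leaves V) (hlt : V x.1 < V y.1) : y.1 < x.1 ∧ x.2 < y.2 := by
  obtain ⟨c, hcx, hc⟩ := leaf_exists_crit hV hx
  exact leaf_nested hx hy hcx ((hs c hc).1 hcx) hlt

lemma SameCrit.strictAntiOn_left (hV : IsS3B 2 V) (hs : SameCrit V x y) (hx : x ∈ leaves V)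
    (hy : y ∈ leaves V) (hlt : V x.1 < V y.1) : StrictAntiOn V (Icc y.1 x.1) := by
  obtain ⟨h1, h2⟩ := hs.nested hV hx hy hlt
  exact hV.continuous.continuousOn.strictAntiOn_of_injOn_Icc h1.le hlt.le
    (hs.injOn_left hV hx h2)

lemma SameCrit.strictMonoOn_right (hV : IsS3B 2 V) (hs : SameCrit V x y) (hx : x ∈ leaves V)
    (hy : y ∈ leaves V) (hlt : V x.1 < V y.1) : StrictMonoOn V (Icc x.2 y.2) := by
  obtain ⟨h1, h2⟩ := hs.nested hV hx hy hlt
  exact hV.continuous.continuousOn.strictMonoOn_of_injOn_Icc h2.le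
    (by rw [leaf_eq hx, leaf_eq hy]; exact hlt.le) (hs.injOn_right hV hx h1)

/-- An interpolating leaf. -/
lemma SameCrit.leaf_between (hV : IsS3B 2 V) (hs : SameCrit V x y) (hx : x ∈ leaves V)
    (hy : y ∈ leaves V) (hlt : V x.1 < V y.1) {s t : ℝ} (hs' : s ∈ Icc y.1 x.1)
    (ht : t ∈ Icc x.2 y.2) (hst : V t = V s) : (s, t) ∈ leaves V := by
  obtain ⟨h1, h2⟩ := hs.nested hV hx hy hlt
  have hanti := hs.strictAntiOn_left hV hx hy hlt
  have hmono := hs.strictMonoOn_right hV hx hy hlt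
  have hx12 := leaf_le hx
  rcases eq_or_lt_of_le hs'.2 with he | hsx
  · have : t = x.2 := hmono.injOn ht (left_mem_Icc.2 h2.le) (by rw [hst, he, leaf_eq hx])
    rw [he, this]
    exact hx
  have hxs : V x.1 < V s := hanti hs' (right_mem_Icc.2 h1.le) hsx
  have htx : x.2 < t := by
    refine lt_of_le_of_ne ht.1 fun he => ?_
    rw [← he, leaf_eq hx] at hst
    exact hxs.ne hst
  refine Or.inl ⟨hsx.trans_le (hx12.trans ht.1), hst.symm, fun q hq => ?_, fun h => ?_,
    fun h => ?_⟩
  · rcases le_total q x.1 with hq1 | hq1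
    · exact hanti hs' ⟨hs'.1.trans hq.1.le, hq1⟩ hq.1
    rcases le_total q x.2 with hq2 | hq2
    · exact (leaf_le_energy hx ⟨hq1, hq2⟩).trans_lt hxs
    · rw [← hst]
      exact hmono ⟨hq2, hq.2.le.trans ht.2⟩ ht hq.2
  · exact absurd ((hs s h).2 ⟨hs'.1, (hsx.trans_le (hx12.trans h2.le)).le⟩).1 hsx.not_ge
  · exact absurd ((hs t h).2 ⟨(h1.trans_le (hx12.trans htx.le)).le, ht.2⟩).2 htx.not_ge

lemma SameCrit.mem_component (hV : IsS3B 2 V) (hs : SameCrit V x y) (hx : x ∈ leaves V)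
    (hy : y ∈ leaves V) (hlt : V x.1 < V y.1) : y ∈ connectedComponentIn (leaves V) x := by
  obtain ⟨h1, h2⟩ := hs.nested hV hx hy hlt
  have hmono := hs.strictMonoOn_right hV hx hy hlt
  have himg : V '' Icc x.2 y.2 = Icc (V x.1) (V y.1) := by
    rw [← leaf_eq hx, ← leaf_eq hy]
    refine Subset.antisymm ?_ (intermediate_value_Icc h2.le hV.continuous.continuousOn)
    rintro _ ⟨q, hq, rfl⟩
    exact ⟨hmono.monotoneOn (left_mem_Icc.2 h2.le) hq hq.1,
      hmono.monotoneOn hq (right_mem_Icc.2 h2.le) hq.2⟩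
  have hmem : ∀ s : Icc y.1 x.1, V s ∈ V '' Icc x.2 y.2 := by
    intro s
    have hanti := (hs.strictAntiOn_left hV hx hy hlt).antitoneOn
    rw [himg]
    exact ⟨hanti s.2 (right_mem_Icc.2 h1.le) s.2.2, hanti (left_mem_Icc.2 h1.le) s.2 s.2.1⟩
  have hord : (V '' Icc x.2 y.2).OrdConnected := by rw [himg]; exact ordConnected_Icc
  set e := hmono.orderIso V (Icc x.2 y.2)
  have hVe : ∀ s : Icc y.1 x.1, V (e.symm ⟨V s, hmem s⟩) = V s := fun s =>
    congrArg Subtype.val (e.apply_symm_apply ⟨V s, hmem s⟩)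
  let γ : Icc y.1 x.1 → ℝ × ℝ := fun s => (s, e.symm ⟨V s, hmem s⟩)
  have hγ : Continuous γ := by
    refine continuous_subtype_val.prodMk (continuous_subtype_val.comp (e.symm.continuous.comp ?_))
    exact (hV.continuous.comp continuous_subtype_val).subtype_mk _
  have hγl : range γ ⊆ leaves V := by
    rintro _ ⟨s, rfl⟩
    exact hs.leaf_between hV hx hy hlt s.2 (e.symm ⟨V s, hmem s⟩).2 (hVe s)
  have hpre : IsPreconnected (range γ) := by
    have : PreconnectedSpace (Icc y.1 x.1) := Subtype.preconnectedSpace isPreconnected_Icc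
    exact isPreconnected_range hγ
  have hinj := hmono.injOn
  have hxγ : x ∈ range γ := ⟨⟨x.1, right_mem_Icc.2 h1.le⟩, Prod.ext rfl
    (hinj (e.symm ⟨V x.1, _⟩).2 (left_mem_Icc.2 h2.le) ((hVe ⟨x.1, right_mem_Icc.2 h1.le⟩).trans (leaf_eq hx).symm))⟩
  have hyγ : y ∈ range γ := ⟨⟨y.1, left_mem_Icc.2 h1.le⟩, Prod.ext rfl
    (hinj (e.symm ⟨V y.1, _⟩).2 (right_mem_Icc.2 h2.le) ((hVe ⟨y.1, left_mem_Icc.2 h1.le⟩).trans (leaf_eq hy).symm))⟩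
  exact hpre.subset_connectedComponentIn hxγ hγl hyγ

lemma finite_branches (hV : IsS3B 2 V) : {B | IsBranch V B}.Finite := by
  let crit := {q : ℝ | deriv V q = 0}
  let f : Set (ℝ × ℝ) → Set ℝ := fun B => {c ∈ crit | ∃ y ∈ B, c ∈ Icc y.1 y.2}
  refine Set.Finite.of_finite_image (f := f)
    (hV.finite_crit.finite_subsets.subset ?_) ?_
  · rintro _ ⟨B, _, rfl⟩
    exact fun c hc => hc.1
  · intro B hB B' hB' h
    have hf : ∀ {B : Set (ℝ × ℝ)}, IsBranch V B → ∀ {x}, x ∈ B → ∀ c, deriv V c = 0 →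
        (c ∈ f B ↔ c ∈ Icc x.1 x.2) := fun {B} hB {x} hx c hc =>
      ⟨fun ⟨_, y, hy, hcy⟩ => (hB.crit_mem_iff hV hx hy hc).2 hcy, fun h => ⟨hc, x, hx, h⟩⟩
    obtain ⟨x, hx, hBx⟩ := id hB
    obtain ⟨y, hy, hBy⟩ := id hB'
    have hxB : x ∈ B := hBx ▸ mem_connectedComponentIn hx
    have hyB : y ∈ B' := hBy ▸ mem_connectedComponentIn hy
    have hs : SameCrit V x y := fun c hc => by rw [← hf hB hxB c hc, ← hf hB' hyB c hc, h]
    have hs' : SameCrit V y x := fun c hc => (hs c hc).symm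
    rcases lt_trichotomy (V x.1) (V y.1) with h1 | h1 | h1
    · rw [hBx, hBy]
      exact connectedComponentIn_eq (hs.mem_component hV hx hy h1)
    · obtain ⟨c, hcx, hc⟩ := leaf_exists_crit hV hx
      rw [hBx, hBy, leaf_eq_of_energy_eq hx hy hc hcx ((hs c hc).1 hcx) h1]
    · rw [hBx, hBy]
      exact (connectedComponentIn_eq (hs'.mem_component hV hy hx h1)).symm

lemma IsS3B.isCompact_sublevel (hV : IsS3B 2 V) (M : ℝ) : IsCompact {q | V q ≤ M} := by
  have h := hV.atTop.eventually (eventually_gt_atTop M)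
  obtain ⟨K, hK, hKs⟩ := mem_cocompact.1 h
  refine hK.of_isClosed_subset (isClosed_le hV.continuous continuous_const) fun q hq => ?_
  by_contra hqK
  have : M < V q := hKs hqK
  exact this.not_ge hq

/-- Leaves with energies in a compact set free of saddle energies form a compact set. -/
lemma isCompact_leaves (hV : IsS3B 2 V) {K : Set ℝ} (hK : IsCompact K)
    (hKs : ∀ q ∈ saddles V, V q ∉ K) : IsCompact {x ∈ leaves V | V x.1 ∈ K} := by
  have heq : {x ∈ leaves V | V x.1 ∈ K} = {x : ℝ × ℝ | x.1 ≤ x.2} ∩ {x | V x.1 = V x.2} ∩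
      {x | V x.1 ∈ K} ∩ (⋂ t ∈ Icc (0 : ℝ) 1, {x | V (x.1 + t * (x.2 - x.1)) ≤ V x.1}) ∩
      ⋃ c ∈ {q : ℝ | deriv V q = 0}, {x | x.1 ≤ c} ∩ {x | c ≤ x.2} := by
    ext x
    simp only [mem_inter_iff, mem_ofPred_eq, mem_iInter, mem_iUnion]
    constructor
    · rintro ⟨hx, hxK⟩
      obtain ⟨c, hcx, hc⟩ := leaf_exists_crit hV hx
      have h12 := leaf_le hx
      refine ⟨⟨⟨⟨h12, (leaf_eq hx).symm⟩, hxK⟩, fun t ht => leaf_le_energy hx ⟨?_, ?_⟩⟩,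
        c, hc, hcx⟩
      · nlinarith [ht.1]
      · nlinarith [ht.2]
    · rintro ⟨⟨⟨⟨h12, heq⟩, hxK⟩, hle⟩, c, hc, hcx⟩
      refine ⟨?_, hxK⟩
      have hsad : ∀ q, deriv V q = 0 → V q = V x.1 → 0 < deriv (deriv V) q := by
        intro q hq hqx
        rcases lt_or_gt_of_ne (hV.simple q hq) with h | h
        · exact absurd (hqx ▸ hxK) (hKs q ⟨hq, h⟩)
        · exact h
      rcases eq_or_lt_of_le h12 with he | hlt
      · have : c = x.1 := le_antisymm (by rw [he]; exact hcx.2) hcx.1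
        exact Or.inr ⟨he, this ▸ hc, hsad _ (this ▸ hc) rfl⟩
      · have hle' : ∀ q ∈ Icc x.1 x.2, V q ≤ V x.1 := by
          intro q hq
          have hpos : 0 < x.2 - x.1 := by linarith
          have h := hle ((q - x.1) / (x.2 - x.1)) ⟨div_nonneg (by linarith [hq.1]) hpos.le,
            (div_le_one hpos).2 (by linarith [hq.2])⟩
          rwa [div_mul_cancel₀ _ hpos.ne', add_sub_cancel] at h
        refine Or.inl ⟨hlt, heq, fun q hq => lt_of_le_of_ne (hle' q ⟨hq.1.le, hq.2.le⟩)
          fun h => ?_, fun h => ?_, fun h => ?_⟩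
        · have hmax : IsLocalMax V q := by
            filter_upwards [Icc_mem_nhds hq.1 hq.2] with p hp
            rw [h]; exact hle' p hp
          have hd := hmax.deriv_eq_zero
          exact absurd (deriv_deriv_nonpos_of_left_max hV.differentiable hq.2
            (fun p hp => h ▸ hle' p ⟨hq.1.le.trans hp.1, hp.2⟩) hd) (hsad q hd h).not_ge
        · exact absurd (deriv_deriv_nonpos_of_left_max hV.differentiable hlt hle' h)
            (hsad _ h rfl).not_ge
        · exact absurd (deriv_deriv_nonpos_of_right_max hV.differentiable hlt
            (fun q hq => heq ▸ hle' q hq) h) (hsad _ h heq.symm).not_ge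
  obtain ⟨M, hM⟩ := hK.bddAbove
  have hsub : {x ∈ leaves V | V x.1 ∈ K} ⊆ {q | V q ≤ M} ×ˢ {q | V q ≤ M} := by
    rintro x ⟨hx, hxK⟩
    exact ⟨hM hxK, by rw [mem_ofPred_eq, leaf_eq hx]; exact hM hxK⟩
  refine ((hV.isCompact_sublevel M).prod (hV.isCompact_sublevel M)).of_isClosed_subset ?_ hsub
  have hc := hV.continuous
  rw [heq]
  refine IsClosed.inter (IsClosed.inter (IsClosed.inter (IsClosed.inter ?_ ?_) ?_) ?_) ?_
  · exact isClosed_le continuous_fst continuous_snd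
  · exact isClosed_eq (by fun_prop) (by fun_prop)
  · exact hK.isClosed.preimage (by fun_prop)
  · exact isClosed_biInter fun t _ => isClosed_le (by fun_prop) (by fun_prop)
  · exact hV.finite_crit.isClosed_biUnion fun c _ =>
      (isClosed_le continuous_fst continuous_const).inter
        (isClosed_le continuous_const continuous_snd)

end

section

/-! ### Local structure near a nonelliptic leaf -/

variable {V : ℝ → ℝ} {x y : ℝ × ℝ} {B : Set (ℝ × ℝ)}

/-- The substitution `V q = h - (h - e) u ^ 2` near a turning point. -/
lemma integral_turning_point {g : ℝ → ℝ} (hg : ContDiff ℝ 1 g) (hV : Continuous V) {d β : ℝ}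
    (hdβ : d < β) (hgV : ∀ q ∈ Icc d β, g (V q) = q) (hmono : StrictMonoOn V (Icc d β))
    (hg' : ∀ v ∈ Icc (V d) (V β), 0 ≤ deriv g v) (F : ℝ → ℝ) :
    ∫ q in d..β, F (V β - V q) = ∫ u in (0 : ℝ)..1, (2 * (V β - V d) * u *
      deriv g (V β - (V β - V d) * u ^ 2)) * F ((V β - V d) * u ^ 2) := by
  set w := V β - V d with hw
  have hwpos : 0 < w := sub_pos.2 (hmono (left_mem_Icc.2 hdβ.le) (right_mem_Icc.2 hdβ.le) hdβ)
  let φ : ℝ → ℝ := fun u => g (V β - w * u ^ 2)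
  have hsurj : ∀ v ∈ Icc (V d) (V β), ∃ q ∈ Icc d β, V q = v :=
    fun v hv => intermediate_value_Icc hdβ.le hV.continuousOn hv
  have hin : ∀ u ∈ Ioo (0 : ℝ) 1, V β - w * u ^ 2 ∈ Ioo (V d) (V β) := by
    intro u hu
    have h1 : 0 < w * u ^ 2 := by have := hu.1; positivity
    have h2 : w * u ^ 2 < w := by
      have : u ^ 2 < 1 := by nlinarith [hu.1, hu.2]
      nlinarith
    constructor <;> linarith
  have hVφ : ∀ u ∈ Ioo (0 : ℝ) 1, V (φ u) = V β - w * u ^ 2 := by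
    intro u hu
    obtain ⟨q, hq, hqv⟩ := hsurj _ (Ioo_subset_Icc_self (hin u hu))
    simp only [φ]
    rw [← hqv, hgV q hq]
  have himg : φ '' Ioo 0 1 = Ioo d β := by
    ext q
    constructor
    · rintro ⟨u, hu, rfl⟩
      obtain ⟨q, hq, hqv⟩ := hsurj _ (Ioo_subset_Icc_self (hin u hu))
      have hh := hin u hu
      simp only [φ]
      rw [← hqv] at hh ⊢
      rw [hgV q hq]
      exact ⟨(hmono.lt_iff_lt (left_mem_Icc.2 hdβ.le) hq).1 hh.1,
        (hmono.lt_iff_lt hq (right_mem_Icc.2 hdβ.le)).1 hh.2⟩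
    · intro hq
      have hq' := Ioo_subset_Icc_self hq
      have h1 : V d < V q := hmono (left_mem_Icc.2 hdβ.le) hq' hq.1
      have h2 : V q < V β := hmono hq' (right_mem_Icc.2 hdβ.le) hq.2
      have h3 : 0 < (V β - V q) / w := div_pos (by linarith) hwpos
      have h4 : (V β - V q) / w < 1 := (div_lt_one hwpos).2 (by linarith)
      refine ⟨√((V β - V q) / w), ⟨Real.sqrt_pos.2 h3, ?_⟩, ?_⟩
      · rw [Real.sqrt_lt' one_pos]; simpa using h4
      · simp only [φ]
        rw [Real.sq_sqrt h3.le, mul_div_cancel₀ _ hwpos.ne', sub_sub_cancel, hgV q hq']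
  have hinj : InjOn φ (Ioo 0 1) := by
    intro u hu u' hu' h
    have h1 := hVφ u hu
    rw [h, hVφ u' hu'] at h1
    have : u ^ 2 = u' ^ 2 := by
      have : w * u ^ 2 = w * u' ^ 2 := by linarith
      exact mul_left_cancel₀ hwpos.ne' this
    exact (pow_left_inj₀ hu.1.le hu'.1.le two_ne_zero).1 this
  have hder : ∀ u ∈ Ioo (0 : ℝ) 1,
      HasDerivWithinAt φ (-(2 * w * u) * deriv g (V β - w * u ^ 2)) (Ioo 0 1) u := by
    intro u _
    have h1 : HasDerivAt (fun u : ℝ => V β - w * u ^ 2) (-(2 * w * u)) u := by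
      have := ((hasDerivAt_pow 2 u).const_mul w).const_sub (V β)
      refine this.congr_deriv ?_
      norm_num; ring
    have h2 := ((hg.differentiable one_ne_zero) (V β - w * u ^ 2)).hasDerivAt
    refine (h2.comp u h1).hasDerivWithinAt.congr_deriv ?_
    ring
  have hcv := integral_image_eq_integral_abs_deriv_smul measurableSet_Ioo hder hinj
    (fun q => F (V β - V q))
  rw [himg] at hcv
  rw [intervalIntegral.integral_of_le hdβ.le, integral_Ioc_eq_integral_Ioo, hcv,
    intervalIntegral.integral_of_le zero_le_one, integral_Ioc_eq_integral_Ioo]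
  refine setIntegral_congr_fun measurableSet_Ioo fun u hu => ?_
  have hh := hg' _ (Ioo_subset_Icc_self (hin u hu))
  simp only [smul_eq_mul, hVφ u hu, sub_sub_cancel]
  rw [neg_mul, abs_neg, abs_of_nonneg]
  have := hu.1
  positivity

lemma sqrt_two_mul_sq {w u : ℝ} (hw : 0 ≤ w) (hu : 0 ≤ u) : √(2 * (w * u ^ 2)) = √(2 * w) * u := by
  rw [← mul_assoc, Real.sqrt_mul (by positivity), Real.sqrt_sq hu]

lemma integral_momentum_turning_point {g : ℝ → ℝ} (hg : ContDiff ℝ 1 g) (hV : Continuous V)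
    {d β : ℝ} (hdβ : d < β) (hgV : ∀ q ∈ Icc d β, g (V q) = q)
    (hmono : StrictMonoOn V (Icc d β)) (hg' : ∀ v ∈ Icc (V d) (V β), 0 ≤ deriv g v) :
    ∫ q in d..β, √(2 * (V β - V q)) = √(2 * (V β - V d)) *
      ∫ u in (0 : ℝ)..1, (g (V β - (V β - V d) * u ^ 2) - d) := by
  rw [integral_turning_point hg hV hdβ hgV hmono hg' (fun z => √(2 * z))]
  set w := V β - V d with hw
  have hwpos : 0 < w := sub_pos.2 (hmono (left_mem_Icc.2 hdβ.le) (right_mem_Icc.2 hdβ.le) hdβ)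
  have hgc : Continuous (deriv g) := (contDiff_one_iff_deriv.1 hg).2
  have hparts := intervalIntegral.integral_mul_deriv_eq_deriv_mul (a := 0) (b := 1)
    (u := fun u => √(2 * w) * u) (u' := fun _ => √(2 * w))
    (v := fun u => g (V β - w * u ^ 2) - d)
    (v' := fun u => -(2 * w * u) * deriv g (V β - w * u ^ 2))
    (fun u _ => by simpa using (hasDerivAt_id u).const_mul √(2 * w))
    (fun u _ => by
      have h1 : HasDerivAt (fun u : ℝ => V β - w * u ^ 2) (-(2 * w * u)) u := by
        refine (((hasDerivAt_pow 2 u).const_mul w).const_sub (V β)).congr_deriv ?_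
        norm_num; ring
      have h2 := ((hg.differentiable one_ne_zero) (V β - w * u ^ 2)).hasDerivAt
      refine ((h2.comp u h1).sub_const d).congr_deriv ?_
      ring)
    (continuous_const.intervalIntegrable _ _)
    ((by fun_prop : Continuous fun u => -(2 * w * u) * deriv g (V β - w * u ^ 2)).intervalIntegrable
      _ _)
  have hgd : g (V d) = d := hgV d (left_mem_Icc.2 hdβ.le)
  have e1 : V β - w * 1 ^ 2 = V d := by rw [hw]; ring
  simp only [e1, hgd, sub_self, mul_zero, zero_mul] at hparts
  rw [zero_sub, intervalIntegral.integral_const_mul] at hparts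
  rw [← neg_eq_iff_eq_neg.2 hparts.symm.symm, ← intervalIntegral.integral_neg]
  refine intervalIntegral.integral_congr fun u hu => ?_
  rw [uIcc_of_le zero_le_one] at hu
  simp only [sqrt_two_mul_sq hwpos.le hu.1]
  ring

lemma integral_time_turning_point {g : ℝ → ℝ} (hg : ContDiff ℝ 1 g) (hV : Continuous V)
    {d β : ℝ} (hdβ : d < β) (hgV : ∀ q ∈ Icc d β, g (V q) = q)
    (hmono : StrictMonoOn V (Icc d β)) (hg' : ∀ v ∈ Icc (V d) (V β), 0 ≤ deriv g v) :
    ∫ q in d..β, 1 / √(2 * (V β - V q)) = √(2 * (V β - V d)) *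
      ∫ u in (0 : ℝ)..1, deriv g (V β - (V β - V d) * u ^ 2) := by
  rw [integral_turning_point hg hV hdβ hgV hmono hg' (fun z => 1 / √(2 * z)),
    ← intervalIntegral.integral_const_mul]
  set w := V β - V d with hw
  have hwpos : 0 < w := sub_pos.2 (hmono (left_mem_Icc.2 hdβ.le) (right_mem_Icc.2 hdβ.le) hdβ)
  rw [intervalIntegral.integral_of_le zero_le_one, intervalIntegral.integral_of_le zero_le_one]
  refine setIntegral_congr_fun measurableSet_Ioc fun u hu => ?_
  have hu0 := hu.1
  have hs : 0 < √(2 * w) := Real.sqrt_pos.2 (by positivity)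
  simp only [sqrt_two_mul_sq hwpos.le hu0.le]
  have hsq : √(2 * w) * √(2 * w) = 2 * w := Real.mul_self_sqrt (by positivity)
  field_simp
  rw [sq √(2 * w), hsq]
  ring

/-- Local data at a turning point `b` with `V' b > 0`: the inverse `g` of `V`, and a point `d`
left of `b` such that the action and time integrals between `d` and the turning point are smooth
functions `A`, `τ` of the energy. -/
lemma exists_right_end {n : ℕ} (hV : ContDiff ℝ (n + 1 : ℕ) V) {b c : ℝ} (hcb : c < b)
    (hb : 0 < deriv V b) :
    ∃ d ∈ Ioo c b, ∃ A τ g : ℝ → ℝ, ContDiffAt ℝ (n + 1 : ℕ) A (V b) ∧ ContDiffAt ℝ n τ (V b) ∧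
      ContDiff ℝ (n + 1 : ℕ) g ∧ g (V b) = b ∧ (∀ᶠ v in 𝓝 (V b), V (g v) = v) ∧
      ∀ᶠ β in 𝓝 b, d < β ∧ StrictMonoOn V (Icc d β) ∧ 0 < deriv V β ∧ g (V β) = β ∧
        ∫ q in d..β, √(2 * (V β - V q)) = A (V β) ∧
        ∫ q in d..β, 1 / √(2 * (V β - V q)) = τ (V β) ∧ 0 < τ (V β) := by
  have hdV : Differentiable ℝ V := hV.differentiable (by norm_cast)
  obtain ⟨g, hg, hgV, hVg⟩ := exists_local_inverse (by omega) hV.contDiffAt hb.ne'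
  have hg1 : ContDiff ℝ 1 g := hg.of_le (by norm_cast; omega)
  have hgc : Continuous (deriv g) := (contDiff_one_iff_deriv.1 hg1).2
  have hVc : Continuous (deriv V) :=
    (contDiff_one_iff_deriv.1 (hV.of_le (by norm_cast; omega))).2
  have hgb : g (V b) = b := hgV.self_of_nhds
  have hg'b : 0 < deriv g (V b) := by
    have h1 : HasDerivAt (fun q => g (V q)) (deriv g (V b) * deriv V b) b :=
      ((hg1.differentiable one_ne_zero) (V b)).hasDerivAt.comp b (hdV b).hasDerivAt
    have h2 : HasDerivAt (fun q => g (V q)) 1 b :=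
      (hasDerivAt_id b).congr_of_eventuallyEq hgV
    have h3 := h1.unique h2
    by_contra! h
    nlinarith
  have hall : ∀ᶠ q in 𝓝 b, g (V q) = q ∧ 0 < deriv V q ∧ 0 < deriv g (V q) := by
    filter_upwards [hgV, hVc.continuousAt.eventually (lt_mem_nhds hb),
      (hgc.comp hdV.continuous).continuousAt.eventually (lt_mem_nhds hg'b)] with q h1 h2 h3
    exact ⟨h1, h2, h3⟩
  obtain ⟨ε, hε, hεs⟩ := Metric.eventually_nhds_iff_ball.1 hall
  rw [Real.ball_eq_Ioo] at hεs
  set d := max ((c + b) / 2) (b - ε / 2) with hd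
  have hdb : d < b := max_lt (by linarith) (by linarith)
  have hcd : c < d := lt_of_lt_of_le (by linarith) (le_max_left _ _)
  have hdε : b - ε < d := lt_of_lt_of_le (by linarith) (le_max_right ((c + b) / 2) _)
  have hmono : StrictMonoOn V (Ico d (b + ε)) := by
    refine strictMonoOn_of_deriv_pos (convex_Ico _ _) hdV.continuous.continuousOn fun q hq => ?_
    rw [interior_Ico] at hq
    exact (hεs q ⟨hdε.trans hq.1, hq.2⟩).2.1
  have hVdb : V d < V b := hmono ⟨le_rfl, by linarith⟩ ⟨hdb.le, by linarith⟩ hdb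
  have hS : ContDiffAt ℝ (n + 1 : ℕ) (fun h => √(2 * (h - V d))) (V b) :=
    (by fun_prop : ContDiffAt ℝ (n + 1 : ℕ) (fun h => 2 * (h - V d)) (V b)).sqrt
      (by linarith)
  refine ⟨d, ⟨hcd, hdb⟩, fun h => √(2 * (h - V d)) *
      ∫ u in (0 : ℝ)..1, (g (h - (h - V d) * u ^ 2) - d),
    fun h => √(2 * (h - V d)) * ∫ u in (0 : ℝ)..1, deriv g (h - (h - V d) * u ^ 2), g,
    hS.mul ?_, (hS.of_le (by norm_cast; omega)).mul ?_, hg, hgb, hVg, ?_⟩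
  · exact (contDiff_parametric_integral zero_le_one
      (F := fun z : ℝ × ℝ => g (z.1 - (z.1 - V d) * z.2 ^ 2) - d)
      ((hg.comp (by fun_prop)).sub contDiff_const)).contDiffAt
  · exact (contDiff_parametric_integral zero_le_one
      (F := fun z : ℝ × ℝ => deriv g (z.1 - (z.1 - V d) * z.2 ^ 2))
      ((contDiff_deriv hg).comp (by fun_prop))).contDiffAt
  · filter_upwards [Ioo_mem_nhds hdb (show b < b + ε by linarith)] with β hβ
    have hsub : ∀ q ∈ Icc d β, q ∈ Ioo (b - ε) (b + ε) := fun q hq =>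
      ⟨hdε.trans_le hq.1, hq.2.trans_lt hβ.2⟩
    have hmono' : StrictMonoOn V (Icc d β) :=
      hmono.mono fun q hq => ⟨hq.1, hq.2.trans_lt hβ.2⟩
    have hgV' : ∀ q ∈ Icc d β, g (V q) = q := fun q hq => (hεs q (hsub q hq)).1
    have hg'' : ∀ v ∈ Icc (V d) (V β), 0 < deriv g v := by
      intro v hv
      obtain ⟨q, hq, rfl⟩ := intermediate_value_Icc hβ.1.le hdV.continuous.continuousOn hv
      exact (hεs q (hsub q hq)).2.2
    have hg' : ∀ v ∈ Icc (V d) (V β), 0 ≤ deriv g v := fun v hv => (hg'' v hv).le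
    have hβm : β ∈ Icc d β := right_mem_Icc.2 hβ.1.le
    refine ⟨hβ.1, hmono', (hεs β (hsub β hβm)).2.1, hgV' β hβm,
      integral_momentum_turning_point hg1 hdV.continuous hβ.1 hgV' hmono' hg',
      integral_time_turning_point hg1 hdV.continuous hβ.1 hgV' hmono' hg', ?_⟩
    have hw : 0 < V β - V d := sub_pos.2 (hmono' (left_mem_Icc.2 hβ.1.le) hβm hβ.1)
    refine mul_pos (Real.sqrt_pos.2 (by linarith)) ?_
    refine intervalIntegral.intervalIntegral_pos_of_pos_on
      ((by fun_prop : Continuous fun u => deriv g (V β - (V β - V d) * u ^ 2)).intervalIntegrable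
        _ _) (fun u hu => hg'' _ ⟨?_, ?_⟩) one_pos
    · nlinarith [mul_nonneg hw.le (show 0 ≤ 1 - u ^ 2 by nlinarith [hu.1, hu.2])]
    · nlinarith [mul_nonneg hw.le (sq_nonneg u)]

lemma exists_left_end {n : ℕ} (hV : ContDiff ℝ (n + 1 : ℕ) V) {a c : ℝ} (hac : a < c)
    (ha : deriv V a < 0) :
    ∃ d ∈ Ioo a c, ∃ A τ g : ℝ → ℝ, ContDiffAt ℝ (n + 1 : ℕ) A (V a) ∧ ContDiffAt ℝ n τ (V a) ∧
      ContDiff ℝ (n + 1 : ℕ) g ∧ g (V a) = a ∧ (∀ᶠ v in 𝓝 (V a), V (g v) = v) ∧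
      ∀ᶠ α in 𝓝 a, α < d ∧ StrictAntiOn V (Icc α d) ∧ deriv V α < 0 ∧ g (V α) = α ∧
        ∫ q in α..d, √(2 * (V α - V q)) = A (V α) ∧
        ∫ q in α..d, 1 / √(2 * (V α - V q)) = τ (V α) ∧ 0 < τ (V α) := by
  obtain ⟨d, hd, A, τ, g, hA, hτ, hg, hgb, hVg, hev⟩ := exists_right_end
    (V := fun q => V (-q)) (hV.comp contDiff_neg) (b := -a) (c := -c) (by linarith)
    (by rw [deriv_comp_neg]; simpa using ha)
  simp only [neg_neg] at hA hτ hgb hVg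
  refine ⟨-d, ⟨by linarith [hd.2], by linarith [hd.1]⟩, A, τ, fun v => -g v, hA, hτ, hg.neg,
    by linarith, hVg, ?_⟩
  have hneg : Tendsto (fun q : ℝ => -q) (𝓝 a) (𝓝 (-a)) := continuous_neg.continuousAt
  filter_upwards [hneg.eventually hev] with α hα
  obtain ⟨h1, h2, h3, h4, h5, h6, h7⟩ := hα
  simp only [neg_neg] at h4 h5 h6 h7
  refine ⟨by linarith, fun p hp q hq hpq => ?_, ?_, by linarith, ?_, ?_, h7⟩
  · have := h2 (a := -q) ⟨by linarith [hq.2], by linarith [hq.1]⟩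
      (b := -p) ⟨by linarith [hp.2], by linarith [hp.1]⟩ (by linarith)
    simpa using this
  · rw [deriv_comp_neg] at h3
    simpa using h3
  · rw [← h5]
    have := intervalIntegral.integral_comp_neg (a := d) (b := -α)
      (fun q => √(2 * (V α - V q)))
    rw [neg_neg] at this
    exact this.symm
  · rw [← h6]
    have := intervalIntegral.integral_comp_neg (a := d) (b := -α)
      (fun q => 1 / √(2 * (V α - V q)))
    rw [neg_neg] at this
    exact this.symm

end

section

variable {V : ℝ → ℝ} {x y : ℝ × ℝ} {B : Set (ℝ × ℝ)}

lemma contDiffAt_integral_interior {n : ℕ} {φ : ℝ → ℝ} (hφ : ∀ z, 0 < z → ContDiffAt ℝ n φ z)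
    (hV : ContDiff ℝ n V) {a b h₀ : ℝ} (hab : a ≤ b) (hlt : ∀ q ∈ Icc a b, V q < h₀) :
    ContDiffAt ℝ n (fun h => ∫ q in a..b, φ (2 * (h - V q))) h₀ := by
  obtain ⟨q₀, hq₀, hmax⟩ := isCompact_Icc.exists_isMaxOn (nonempty_Icc.2 hab)
    hV.continuous.continuousOn
  refine (contDiffOn_parametric_integral n (F := fun z : ℝ × ℝ => φ (2 * (z.1 - V z.2)))
    (isOpen_Ioi (a := V q₀)) hab fun h hh u hu => ?_).contDiffAt (Ioi_mem_nhds (hlt q₀ hq₀))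
  have hh' : V q₀ < h := hh
  have hu' : V u ≤ V q₀ := hmax hu
  exact ContDiffAt.comp (g := φ) (h, u) (hφ _ (by simp only; linarith))
    (by have := hV.contDiffAt (x := u); fun_prop)

lemma contDiffAt_sqrt {n : ℕ} {z : ℝ} (hz : 0 < z) : ContDiffAt ℝ n Real.sqrt z :=
  Real.contDiffAt_sqrt hz.ne'

lemma contDiffAt_one_div_sqrt {n : ℕ} {z : ℝ} (hz : 0 < z) :
    ContDiffAt ℝ n (fun z => 1 / √z) z :=
  contDiffAt_const.div (contDiffAt_sqrt hz) (Real.sqrt_pos.2 hz).ne'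

lemma tendsto_fst_leaves : Tendsto (fun y : ℝ × ℝ => y.1) (𝓝[leaves V] x) (𝓝 x.1) :=
  continuous_fst.continuousAt.mono_left nhdsWithin_le_nhds

lemma tendsto_snd_leaves : Tendsto (fun y : ℝ × ℝ => y.2) (𝓝[leaves V] x) (𝓝 x.2) :=
  continuous_snd.continuousAt.mono_left nhdsWithin_le_nhds

lemma tendsto_energy_leaves (hV : Continuous V) :
    Tendsto (fun y : ℝ × ℝ => V y.1) (𝓝[leaves V] x) (𝓝 (V x.1)) :=
  (hV.tendsto _).comp tendsto_fst_leaves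

/-- The leaves through a nonelliptic leaf form a curve parametrized by the energy. -/
lemma exists_leaf_curve (hV : IsS3B 2 V) (hx : x ∈ leaves V) (hlt : x.1 < x.2) :
    ∃ γ : ℝ → ℝ × ℝ, γ (V x.1) = x ∧ ContinuousAt γ (V x.1) ∧
      ∀ᶠ h in 𝓝 (V x.1), γ h ∈ connectedComponentIn (leaves V) x ∧ V (γ h).1 = h := by
  set c := (x.1 + x.2) / 2 with hc
  have h2 := leaf_eq hx
  obtain ⟨dl, hdl, _, _, gl, _, _, hgl, hgla, hVgl, hevl⟩ :=
    exists_left_end (n := 1) hV.smooth (show x.1 < c by linarith) (leaf_deriv_left_neg hx hlt)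
  obtain ⟨dr, hdr, _, _, gr, _, _, hgr, hgra, hVgr, hevr⟩ :=
    exists_right_end (n := 1) hV.smooth (show c < x.2 by linarith) (leaf_deriv_right_pos hx hlt)
  rw [h2] at hgra hVgr
  have hdlr : dl ≤ dr := (hdl.2.trans hdr.1).le
  obtain ⟨q₀, hq₀, hmax⟩ := isCompact_Icc.exists_isMaxOn (nonempty_Icc.2 hdlr)
    hV.continuous.continuousOn
  have hq₀' : V q₀ < V x.1 := leaf_lt hx ⟨hdl.1.trans_le hq₀.1, hq₀.2.trans_lt hdr.2⟩
  have tl : Tendsto gl (𝓝 (V x.1)) (𝓝 x.1) := by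
    simpa only [hgla] using hgl.continuous.tendsto (V x.1)
  have tr : Tendsto gr (𝓝 (V x.1)) (𝓝 x.2) := by
    simpa only [hgra] using hgr.continuous.tendsto (V x.1)
  have hleaf : ∀ᶠ h in 𝓝 (V x.1), (gl h, gr h) ∈ leaves V ∧ V (gl h) = h := by
    filter_upwards [hVgl, hVgr, tl.eventually hevl, tr.eventually hevr, lt_mem_nhds hq₀']
      with h e1 e2 el er hq
    obtain ⟨l1, l2, l3, -⟩ := el
    obtain ⟨r1, r2, r3, -⟩ := er
    refine ⟨Or.inl ⟨l1.trans_le (hdlr.trans r1.le), e1.trans e2.symm, fun q hq' => ?_, l3.ne,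
      r3.ne'⟩, e1⟩
    rcases le_total q dl with hl | hl
    · exact l2 (left_mem_Icc.2 l1.le) ⟨hq'.1.le, hl⟩ hq'.1
    rcases le_total q dr with hr | hr
    · have : V q ≤ V q₀ := hmax ⟨hl, hr⟩
      simp only [e1]
      linarith
    · have := r2 ⟨hr, hq'.2.le⟩ (right_mem_Icc.2 r1.le) hq'.2
      simp only [e1]
      rwa [e2] at this
  have hcont : Continuous fun h => (gl h, gr h) := hgl.continuous.prodMk hgr.continuous
  have hγx : (gl (V x.1), gr (V x.1)) = x := Prod.ext hgla hgra
  refine ⟨fun h => (gl h, gr h), hγx, hcont.continuousAt, ?_⟩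
  obtain ⟨ε, hε, hεs⟩ := Metric.eventually_nhds_iff_ball.1 hleaf
  have hpre : IsPreconnected ((fun h => (gl h, gr h)) '' Metric.ball (V x.1) ε) :=
    (convex_ball _ _).isPreconnected.image _ hcont.continuousOn
  filter_upwards [Metric.ball_mem_nhds _ hε] with h hh
  refine ⟨hpre.subset_connectedComponentIn ⟨V x.1, Metric.mem_ball_self hε, hγx⟩ ?_
    ⟨h, hh, rfl⟩, (hεs h hh).2⟩
  rintro _ ⟨h', hh', rfl⟩
  exact (hεs h' hh').1

/-- The action is a smooth function `J` of the energy near the leaf `x`, with `J' > 0`. -/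
def LocalAction (V : ℝ → ℝ) (n : ℕ) (x : ℝ × ℝ) (J : ℝ → ℝ) : Prop :=
  ContDiffAt ℝ n J (V x.1) ∧ 0 < deriv J (V x.1) ∧
    ∀ᶠ y in 𝓝[leaves V] x, action V y = J (V y.1)

/-- The travel time is a smooth function `T` of the energy near the leaf `x`. -/
def LocalTravel (V : ℝ → ℝ) (n : ℕ) (x : ℝ × ℝ) (T : ℝ → ℝ) : Prop :=
  ContDiffAt ℝ n T (V x.1) ∧ ∀ᶠ y in 𝓝[leaves V] x, travelTime V y = T (V y.1)

lemma sqrt_sub_sqrt_ge {A B K : ℝ} (hB : 0 ≤ B) (hAB : B < A) (hK : A ≤ K) :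
    (A - B) / (2 * √K) ≤ √A - √B := by
  have hA : 0 < A := hB.trans_lt hAB
  have h1 : 0 < √A := Real.sqrt_pos.2 hA
  have h2 : √A ≤ √K := Real.sqrt_le_sqrt hK
  have h3 : √B ≤ √A := Real.sqrt_le_sqrt hAB.le
  rw [div_le_iff₀ (by linarith)]
  nlinarith [Real.mul_self_sqrt hA.le, Real.mul_self_sqrt hB, Real.sqrt_nonneg B]

/-- A lower bound for the growth of the action with the energy. -/
lemma action_sub_action_ge {c m K : ℝ} (hV : IsS3B 2 V) (hm : ∀ q, m ≤ V q) (hx : x ∈ leaves V)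
    (hy : y ∈ leaves V) (hcx : c ∈ Icc x.1 x.2) (hcy : c ∈ Icc y.1 y.2) (hlt : V x.1 < V y.1)
    (hK : 2 * (V y.1 - m) ≤ K) :
    (1 / Real.pi) * ((x.2 - x.1) * ((V y.1 - V x.1) / √K)) ≤ action V y - action V x := by
  obtain ⟨h1, h2⟩ := leaf_nested hx hy hcx hcy hlt
  have hx12 := leaf_le hx
  have hcx' := continuous_momentum hV (V x.1)
  have hcy' := continuous_momentum hV (V y.1)
  have e2 : ∫ q in x.1..x.2, (√(2 * (V x.1 - V q)) + (V y.1 - V x.1) / √K) ≤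
      ∫ q in x.1..x.2, √(2 * (V y.1 - V q)) := by
    refine intervalIntegral.integral_mono_on hx12
      ((hcx'.add continuous_const).intervalIntegrable _ _)
      (hcy'.intervalIntegrable _ _) fun q hq => ?_
    have hh := sqrt_sub_sqrt_ge (A := 2 * (V y.1 - V q)) (B := 2 * (V x.1 - V q)) (K := K)
      (by linarith [leaf_le_energy hx hq]) (by linarith) (by linarith [hm q])
    have : (2 * (V y.1 - V q) - 2 * (V x.1 - V q)) / (2 * √K) = (V y.1 - V x.1) / √K := by
      rw [show 2 * (V y.1 - V q) - 2 * (V x.1 - V q) = 2 * (V y.1 - V x.1) by ring,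
        mul_div_mul_left _ _ two_ne_zero]
    linarith
  rw [intervalIntegral.integral_add (hcx'.intervalIntegrable _ _)
    (continuous_const.intervalIntegrable _ _), intervalIntegral.integral_const, smul_eq_mul] at e2
  have e3 : ∫ q in x.1..x.2, √(2 * (V y.1 - V q)) ≤ ∫ q in y.1..y.2, √(2 * (V y.1 - V q)) :=
    intervalIntegral.integral_mono_interval h1.le hx12 h2.le
      (Eventually.of_forall fun q => Real.sqrt_nonneg _) (hcy'.intervalIntegrable _ _)
  unfold action energy
  rw [← mul_sub]
  have hpi := Real.pi_pos
  gcongr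
  linarith

lemma exists_localAction_of_lt {n : ℕ} (hn : 1 ≤ n) (hV : IsS3B (n + 1) V) (hx : x ∈ leaves V)
    (hlt : x.1 < x.2) : ∃ J, LocalAction V (n + 1) x J := by
  have hV2 : IsS3B 2 V := hV.of_le (by omega)
  set c := (x.1 + x.2) / 2 with hc
  have h2 := leaf_eq hx
  obtain ⟨dl, hdl, Al, _, _, hAl, _, _, _, _, hevl⟩ :=
    exists_left_end (n := n) hV.smooth (show x.1 < c by linarith) (leaf_deriv_left_neg hx hlt)
  obtain ⟨dr, hdr, Ar, _, _, hAr, _, _, _, _, hevr⟩ :=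
    exists_right_end (n := n) hV.smooth (show c < x.2 by linarith) (leaf_deriv_right_pos hx hlt)
  rw [h2] at hAr
  have hdlr : dl ≤ dr := (hdl.2.trans hdr.1).le
  have hmid := contDiffAt_integral_interior (n := n + 1) (h₀ := V x.1)
    (fun z hz => contDiffAt_sqrt hz) hV.smooth hdlr
    fun q hq => leaf_lt hx ⟨hdl.1.trans_le hq.1, hq.2.trans_lt hdr.2⟩
  set J : ℝ → ℝ := fun h => (1 / Real.pi) * (Al h + (∫ q in dl..dr, √(2 * (h - V q))) + Ar h)
    with hJ
  have hJc : ContDiffAt ℝ (n + 1 : ℕ) J (V x.1) :=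
    contDiffAt_const.mul ((hAl.add hmid).add hAr)
  have hJe : ∀ᶠ y in 𝓝[leaves V] x, action V y = J (V y.1) := by
    filter_upwards [tendsto_fst_leaves.eventually hevl, tendsto_snd_leaves.eventually hevr,
      self_mem_nhdsWithin] with y hl hr hy
    obtain ⟨-, -, -, -, l5, -⟩ := hl
    obtain ⟨-, -, -, -, r5, -⟩ := hr
    have hcy' := continuous_momentum hV2 (V y.1)
    rw [leaf_eq hy] at r5
    simp only [hJ, action, energy]
    rw [← l5, ← r5, intervalIntegral.integral_add_adjacent_intervals
      (hcy'.intervalIntegrable _ _) (hcy'.intervalIntegrable _ _),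
      intervalIntegral.integral_add_adjacent_intervals
      (hcy'.intervalIntegrable _ _) (hcy'.intervalIntegrable _ _)]
  refine ⟨J, hJc, ?_, hJe⟩
  obtain ⟨γ, hγx, hγc, hγe⟩ := exists_leaf_curve hV2 hx hlt
  obtain ⟨m, hm⟩ := hV.bddBelow
  have hm' : ∀ q, m ≤ V q := fun q => hm ⟨q, rfl⟩
  obtain ⟨p, hpx, hp⟩ := leaf_exists_crit hV2 hx
  have hγt : Tendsto γ (𝓝 (V x.1)) (𝓝[leaves V] x) := by
    refine tendsto_nhdsWithin_iff.2 ⟨by simpa only [hγx] using hγc.tendsto, ?_⟩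
    filter_upwards [hγe] with h hh
    exact connectedComponentIn_subset _ _ hh.1
  set K := 2 * (V x.1 + 1 - m) with hK
  have hKpos : 0 < K := by linarith [hm' x.1]
  have hB : IsBranch V (connectedComponentIn (leaves V) x) := ⟨x, hx, rfl⟩
  have hslope : ∀ᶠ h in 𝓝[>] (V x.1),
      (1 / Real.pi) * ((x.2 - x.1) * (1 / √K)) ≤ slope J (V x.1) h := by
    filter_upwards [nhdsWithin_le_nhds hγe, nhdsWithin_le_nhds (hγt.eventually hJe),
      self_mem_nhdsWithin, nhdsWithin_le_nhds (gt_mem_nhds (show V x.1 < V x.1 + 1 by linarith))]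
      with h h1 h3 h4 h5
    have h4' : V x.1 < h := h4
    have hge := action_sub_action_ge hV2 hm' hx (connectedComponentIn_subset _ _ h1.1) hpx
      ((hB.crit_mem_iff hV2 (mem_connectedComponentIn hx) h1.1 hp).1 hpx)
      (by rw [h1.2]; exact h4) (K := K) (by rw [h1.2]; linarith)
    rw [h3, hJe.self_of_nhdsWithin hx, h1.2] at hge
    rw [slope_def_field, le_div_iff₀ (by linarith)]
    refine le_trans (le_of_eq ?_) hge
    ring
  have hder : HasDerivAt J (deriv J (V x.1)) (V x.1) :=
    (hJc.differentiableAt (by norm_cast)).hasDerivAt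
  have hlim := (hasDerivAt_iff_tendsto_slope.1 hder).mono_left
    (nhdsWithin_mono (V x.1) (fun h (hh : V x.1 < h) => ne_of_gt hh) : 𝓝[>] (V x.1) ≤ _)
  refine lt_of_lt_of_le ?_ (ge_of_tendsto hlim hslope)
  have hpi := Real.pi_pos
  have hs : 0 < √K := Real.sqrt_pos.2 hKpos
  have hxx : 0 < x.2 - x.1 := by linarith
  positivity

lemma exists_localTravel {n : ℕ} (hn : 1 ≤ n) (hV : IsS3B (n + 1) V) (hx : x ∈ leaves V)
    (h0 : V x.1 ≠ V 0) : ∃ T, LocalTravel V n x T := by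
  have hV2 : IsS3B 2 V := hV.of_le (by omega)
  by_cases hx0 : x.1 < 0 ∧ 0 < x.2
  · have hlt := hx0.1.trans hx0.2
    obtain ⟨d, hd, _, τ, _, _, hτ, _, _, _, hev⟩ :=
      exists_left_end (n := n) hV.smooth hx0.1 (leaf_deriv_left_neg hx hlt)
    have hltd : ∀ q ∈ Icc d 0, V q < V x.1 := fun q hq =>
      leaf_lt hx ⟨hd.1.trans_le hq.1, hq.2.trans_lt hx0.2⟩
    have hmid := contDiffAt_integral_interior (n := n) (h₀ := V x.1) (φ := fun z => 1 / √z)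
      (fun z hz => contDiffAt_one_div_sqrt hz) (hV.smooth.of_le (by norm_cast; omega)) hd.2.le hltd
    obtain ⟨q₀, hq₀, hmax⟩ := isCompact_Icc.exists_isMaxOn (nonempty_Icc.2 hd.2.le)
      hV2.continuous.continuousOn
    refine ⟨fun h => 2 * (τ h + ∫ q in d..0, 1 / √(2 * (h - V q))),
      contDiffAt_const.mul (hτ.add hmid), ?_⟩
    filter_upwards [tendsto_fst_leaves.eventually hev,
      tendsto_fst_leaves.eventually (gt_mem_nhds hx0.1),
      tendsto_snd_leaves.eventually (lt_mem_nhds hx0.2),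
      (tendsto_energy_leaves hV2.continuous).eventually (lt_mem_nhds (hltd q₀ hq₀))]
      with y hl hy1 hy2 hyq
    obtain ⟨-, -, -, -, -, l6, l7⟩ := hl
    have hi1 : IntervalIntegrable (fun q => 1 / √(2 * (V y.1 - V q))) volume y.1 d := by
      by_contra hni
      rw [intervalIntegral.integral_undef hni] at l6
      exact l7.ne l6
    have hi2 : IntervalIntegrable (fun q => 1 / √(2 * (V y.1 - V q))) volume d 0 := by
      refine ContinuousOn.intervalIntegrable fun q hq => ContinuousAt.continuousWithinAt ?_
      rw [uIcc_of_le hd.2.le] at hq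
      have h1 : V q ≤ V q₀ := hmax hq
      have hc := hV2.continuous
      refine ContinuousAt.div continuousAt_const (by fun_prop) ?_
      exact (Real.sqrt_pos.2 (by linarith)).ne'
    rw [travelTime, if_pos ⟨hy1, hy2⟩, ← l6]
    simp only [energy]
    rw [intervalIntegral.integral_add_adjacent_intervals hi1 hi2]
  · refine ⟨fun _ => 0, contDiffAt_const, ?_⟩
    have hx1 : x.1 ≠ 0 := fun h => h0 (by rw [h])
    have hx2 : x.2 ≠ 0 := fun h => h0 (by rw [← leaf_eq hx, h])
    rcases lt_or_gt_of_ne hx1 with h1 | h1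
    · have h2 : x.2 < 0 := lt_of_le_of_ne (not_lt.1 fun h => hx0 ⟨h1, h⟩) hx2
      filter_upwards [tendsto_snd_leaves.eventually (gt_mem_nhds h2)] with y hy
      rw [travelTime, if_neg fun h => lt_asymm h.2 hy]
    · filter_upwards [tendsto_fst_leaves.eventually (lt_mem_nhds h1)] with y hy
      rw [travelTime, if_neg fun h => lt_asymm h.1 hy]

end

section

/-! ### Local structure near an elliptic leaf -/

variable {V : ℝ → ℝ} {x y : ℝ × ℝ} {B : Set (ℝ × ℝ)}

/-- Near a nondegenerate minimum at `0`, `f = y ^ 2 / 2` for a smooth coordinate `y`. We record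
the inverse coordinate `g`. -/
lemma exists_morse_coordinate {n : ℕ} (hn : 1 ≤ n) {f : ℝ → ℝ}
    (hf : ContDiff ℝ (2 * n + 2 : ℕ) f) (hf0 : f 0 = 0) (hf1 : deriv f 0 = 0)
    (hf2 : 0 < deriv (deriv f) 0) :
    ∃ g : ℝ → ℝ, ContDiff ℝ (2 * n + 1 : ℕ) g ∧ 0 < deriv g 0 ∧
      (∀ᶠ s in 𝓝 0, f (g s) = s ^ 2 / 2) ∧
      ∀ᶠ z in 𝓝 0, (0 ≤ z → g √(2 * f z) = z) ∧ (z ≤ 0 → g (-√(2 * f z)) = z) := by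
  have hf' : ContDiff ℝ (2 * n + 1 : ℕ) (deriv f) := contDiff_deriv (n := 2 * n + 1) hf
  have hf'' : ContDiff ℝ (2 * n : ℕ) (deriv (deriv f)) := contDiff_deriv hf'
  set U : ℝ → ℝ := fun z => ∫ t in (0 : ℝ)..1, deriv (deriv f) (z * t) with hU
  have hUc : ContDiff ℝ (2 * n : ℕ) U := contDiff_parametric_integral zero_le_one
    (F := fun z : ℝ × ℝ => deriv (deriv f) (z.1 * z.2)) (hf''.comp (by fun_prop))
  have hfU : ∀ z, deriv f z = z * U z := fun z => by
    rw [eq_mul_integral_deriv (hf'.of_le (by norm_cast; omega)) z, hf1, zero_add]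
  set W : ℝ → ℝ := fun z => ∫ t in (0 : ℝ)..1, t * U (z * t) with hW
  have hWc : ContDiff ℝ (2 * n : ℕ) W := contDiff_parametric_integral zero_le_one
    (F := fun z : ℝ × ℝ => z.2 * U (z.1 * z.2)) (contDiff_snd.mul (hUc.comp (by fun_prop)))
  have hfW : ∀ z, f z = z ^ 2 * W z := fun z => by
    rw [eq_mul_integral_deriv (hf.of_le (by norm_cast; omega)) z, hf0, zero_add]
    simp only [hfU, hW, mul_assoc]
    rw [intervalIntegral.integral_const_mul, sq, mul_assoc]
  have hU0 : U 0 = deriv (deriv f) 0 := by simp [hU]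
  have hW0 : W 0 = U 0 / 2 := by
    simp only [hW, zero_mul]
    rw [intervalIntegral.integral_mul_const, integral_id]
    norm_num; ring
  set Ω : Set ℝ := {z | 0 < W z} with hΩ
  have hΩo : IsOpen Ω := isOpen_lt continuous_const hWc.continuous
  have h0Ω : (0 : ℝ) ∈ Ω := by
    show 0 < W 0
    rw [hW0, hU0]; linarith
  set Y : ℝ → ℝ := fun z => z * √(2 * W z) with hY
  have hYsq : ∀ z ∈ Ω, Y z ^ 2 = 2 * f z := fun z hz => by
    have hz' : 0 < W z := hz
    simp only [hY]
    rw [mul_pow, Real.sq_sqrt (by linarith), hfW]; ring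
  have hsW : ∀ z ∈ Ω, ContDiffAt ℝ (2 * n : ℕ) (fun z => √(2 * W z)) z := fun z hz => by
    have hz' : 0 < W z := hz
    exact (contDiffAt_const.mul hWc.contDiffAt).sqrt (by linarith)
  have hspos : ∀ z ∈ Ω, 0 < √(2 * W z) := fun z hz => by
    have hz' : 0 < W z := hz
    exact Real.sqrt_pos.2 (by linarith)
  have hYd : ∀ z ∈ Ω, HasDerivAt Y (U z / √(2 * W z)) z := by
    intro z hz
    have hs := (hsW z hz).differentiableAt (by norm_cast; omega)
    have h1 := (hasDerivAt_id z).mul hs.hasDerivAt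
    simp only [id, one_mul] at h1
    rcases eq_or_ne z 0 with rfl | hz0
    · refine h1.congr_deriv ?_
      rw [zero_mul, add_zero, eq_div_iff (hspos 0 hz).ne', Real.mul_self_sqrt, hW0]
      · ring
      · rw [hW0, hU0]; linarith
    · have h2 : HasDerivAt Y (deriv Y z) z := (h1.differentiableAt).hasDerivAt
      have h3 : HasDerivAt (fun z => 2 * f z) (2 * Y z * deriv Y z) z := by
        have := h2.pow 2
        refine (this.congr_of_eventuallyEq ?_).congr_deriv (by norm_num)
        filter_upwards [hΩo.mem_nhds hz] with w hw
        exact (hYsq w hw).symm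
      have h4 : HasDerivAt (fun z => 2 * f z) (2 * (z * U z)) z := by
        rw [← hfU]
        exact ((hf.differentiable (by norm_cast)) z).hasDerivAt.const_mul 2
      refine h2.congr_deriv ?_
      have h5 := h3.unique h4
      rw [eq_div_iff (hspos z hz).ne']
      have h6 : z * (√(2 * W z) * deriv Y z) = z * U z := by
        have hYz : Y z = z * √(2 * W z) := rfl
        rw [hYz] at h5
        linarith
      rw [mul_comm]
      exact mul_left_cancel₀ hz0 h6
  have hYc : ContDiffOn ℝ (2 * n + 1 : ℕ) Y Ω := by
    rw [show ((2 * n + 1 : ℕ) : WithTop ℕ∞) = ((2 * n : ℕ) : WithTop ℕ∞) + 1 from rfl,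
      contDiffOn_succ_iff_deriv_of_isOpen hΩo]
    refine ⟨fun z hz => (hYd z hz).differentiableAt.differentiableWithinAt,
      fun h => absurd h (WithTop.natCast_ne_top (2 * n)), ?_⟩
    have : ContDiffOn ℝ (2 * n : ℕ) (fun z => U z / √(2 * W z)) Ω := fun z hz =>
      (hUc.contDiffAt.div (hsW z hz) (hspos z hz).ne').contDiffWithinAt
    exact this.congr fun z hz => (hYd z hz).deriv
  have hY'0 : 0 < deriv Y 0 := by
    rw [(hYd 0 h0Ω).deriv]
    exact div_pos (hf2.trans_eq hU0.symm) (hspos 0 h0Ω)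
  obtain ⟨g, hg, hgY, hYg⟩ := exists_local_inverse (by omega)
    (hYc.contDiffAt (hΩo.mem_nhds h0Ω)) hY'0.ne'
  have hY0 : Y 0 = 0 := by simp [hY]
  have hg0 : g 0 = 0 := by simpa only [hY0] using hgY.self_of_nhds
  rw [hY0] at hYg
  have hgt : Tendsto g (𝓝 0) (𝓝 0) := by simpa only [hg0] using hg.continuous.tendsto 0
  refine ⟨g, hg, ?_, ?_, ?_⟩
  · have h1 : HasDerivAt (fun s => Y (g s)) (deriv Y 0 * deriv g 0) 0 := by
      have hY' : HasDerivAt Y (deriv Y 0) (g 0) := by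
        rw [hg0]; exact (hYd 0 h0Ω).differentiableAt.hasDerivAt
      exact hY'.comp 0 ((hg.differentiable (by norm_cast)) 0).hasDerivAt
    have h2 : HasDerivAt (fun s => Y (g s)) 1 0 := (hasDerivAt_id 0).congr_of_eventuallyEq hYg
    have h3 := h1.unique h2
    by_contra! h
    nlinarith
  · filter_upwards [hYg, hgt.eventually (hΩo.mem_nhds h0Ω)] with s h1 h2
    have := hYsq _ h2
    rw [h1] at this
    linarith
  · filter_upwards [hgY, hΩo.mem_nhds h0Ω] with z h1 h2
    rw [← hYsq z h2, Real.sqrt_sq_eq_abs]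
    constructor
    · intro hz
      rw [abs_of_nonneg (mul_nonneg hz (Real.sqrt_nonneg _)), h1]
    · intro hz
      rw [abs_of_nonpos (mul_nonpos_of_nonpos_of_nonneg hz (Real.sqrt_nonneg _)), neg_neg, h1]

/-- The area integral `∫ s² cos² φ g'(s sin φ) dφ` is a smooth function of `s ^ 2`. -/
lemma exists_contDiff_area {n : ℕ} {g : ℝ → ℝ} (hg : ContDiff ℝ (2 * n + 1 : ℕ) g) :
    ∃ J : ℝ → ℝ, ContDiff ℝ (n + 1 : ℕ) J ∧ deriv J 0 = Real.pi * deriv g 0 / 2 ∧ ∀ s,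
      ∫ φ in (-(Real.pi / 2))..(Real.pi / 2),
        (s * Real.cos φ) * (deriv g (s * Real.sin φ) * (s * Real.cos φ)) = J (s ^ 2) := by
  set a := -(Real.pi / 2) with ha
  set b := Real.pi / 2 with hb
  have hab : a ≤ b := by have := Real.pi_pos; linarith
  have hg1 : ContDiff ℝ 1 g := hg.of_le (by norm_cast; omega)
  have hgc : Continuous (deriv g) := (contDiff_one_iff_deriv.1 hg1).2
  have hgd : ∀ z, HasDerivAt g (deriv g z) z := fun z =>
    ((hg1.differentiable one_ne_zero) z).hasDerivAt
  have hcb : Real.cos b = 0 := Real.cos_pi_div_two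
  have hca : Real.cos a = 0 := by rw [ha, Real.cos_neg, hcb]
  set K : ℝ → ℝ := fun s => ∫ φ in a..b, deriv g (s * Real.sin φ) with hK
  have hKc : ContDiff ℝ (2 * n : ℕ) K := contDiff_parametric_integral hab
    (F := fun z : ℝ × ℝ => deriv g (z.1 * Real.sin z.2)) ((contDiff_deriv hg).comp (by fun_prop))
  have hKe : ∀ s, K (-s) = K s := by
    intro s
    have := intervalIntegral.integral_comp_neg (a := a) (b := b)
      (fun φ => deriv g (s * Real.sin φ))
    simp only [Real.sin_neg, mul_neg] at this
    simp only [hK, neg_mul]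
    rw [this, ha, neg_neg]
  obtain ⟨k, hk, hkK⟩ := exists_contDiff_comp_sq hKc hKe
  have hJd : ∀ e, HasDerivAt (fun e => (1 / 2) * ∫ t in (0 : ℝ)..e, k t) ((1 / 2) * k e) e :=
    fun e => (intervalIntegral.integral_hasDerivAt_right (hk.continuous.intervalIntegrable _ _)
      (hk.continuous.stronglyMeasurableAtFilter _ _) hk.continuous.continuousAt).const_mul (1 / 2)
  set Q : ℝ → ℝ := fun s => ∫ φ in a..b, Real.sin φ * g (s * Real.sin φ) with hQ
  have hQparts : ∀ s, Q s = ∫ φ in a..b, Real.cos φ * (deriv g (s * Real.sin φ) *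
      (s * Real.cos φ)) := by
    intro s
    have := intervalIntegral.integral_mul_deriv_eq_deriv_mul (a := a) (b := b)
      (u := Real.cos) (u' := fun φ => -Real.sin φ)
      (v := fun φ => g (s * Real.sin φ))
      (v' := fun φ => deriv g (s * Real.sin φ) * (s * Real.cos φ))
      (fun φ _ => Real.hasDerivAt_cos φ)
      (fun φ _ => (hgd _).comp φ ((Real.hasDerivAt_sin φ).const_mul s))
      ((by fun_prop : Continuous fun φ => -Real.sin φ).intervalIntegrable _ _)
      ((by fun_prop : Continuous fun φ => deriv g (s * Real.sin φ) * (s * Real.cos φ)).intervalIntegrable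
        _ _)
    simp only [hca, hcb, zero_mul, sub_zero, zero_sub] at this
    rw [this, ← intervalIntegral.integral_neg]
    exact intervalIntegral.integral_congr fun φ _ => by ring
  have hQd : ∀ s, HasDerivAt Q (∫ φ in a..b, Real.sin φ * (deriv g (s * Real.sin φ) * Real.sin φ))
      s := by
    intro s
    have := hasDerivAt_parametric_integral isOpen_univ hab
      (F := fun z : ℝ × ℝ => Real.sin z.2 * g (z.1 * Real.sin z.2))
      (fun _ _ _ _ => ((Real.contDiff_sin.comp contDiff_snd).mul
        (hg1.comp (by fun_prop))).contDiffAt) (mem_univ s)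
    refine this.congr_deriv (intervalIntegral.integral_congr fun φ _ => ?_)
    have h1 := hasDerivAt_slice (h := s) (u := φ)
      (F := fun z : ℝ × ℝ => Real.sin z.2 * g (z.1 * Real.sin z.2))
      (((Real.contDiff_sin.comp contDiff_snd).mul (hg1.comp (by fun_prop))).differentiable
        one_ne_zero _)
    have h2 : HasDerivAt (fun s => Real.sin φ * g (s * Real.sin φ))
        (Real.sin φ * (deriv g (s * Real.sin φ) * Real.sin φ)) s :=
      ((hgd _).comp s (by simpa using (hasDerivAt_id s).mul_const (Real.sin φ))).const_mul _
    exact h1.unique h2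
  have hsQ : ∀ s, HasDerivAt (fun s => s * Q s) (s * K s) s := by
    intro s
    refine ((hasDerivAt_id s).mul (hQd s)).congr_deriv ?_
    simp only [id, one_mul]
    rw [hQparts, ← intervalIntegral.integral_const_mul, ← intervalIntegral.integral_const_mul,
      ← intervalIntegral.integral_add (Continuous.intervalIntegrable (by fun_prop) _ _)
      (Continuous.intervalIntegrable (by fun_prop) _ _)]
    refine intervalIntegral.integral_congr fun φ _ => ?_
    have := Real.sin_sq_add_cos_sq φ
    linear_combination (s * deriv g (s * Real.sin φ)) * this
  refine ⟨fun e => (1 / 2) * ∫ t in (0 : ℝ)..e, k t, ?_, ?_, ?_⟩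
  · push_cast
    rw [contDiff_succ_iff_deriv]
    refine ⟨fun e => (hJd e).differentiableAt, by simp, ?_⟩
    rw [show deriv (fun e => (1 / 2) * ∫ t in (0 : ℝ)..e, k t) = fun e => (1 / 2) * k e from
      funext fun e => (hJd e).deriv]
    exact contDiff_const.mul hk
  · rw [(hJd 0).deriv]
    have h0 := hkK 0
    simp only [hK, zero_mul, intervalIntegral.integral_const, smul_eq_mul] at h0
    rw [show (0 : ℝ) ^ 2 = 0 by norm_num] at h0
    rw [← h0, ha, hb]
    ring
  · intro s
    have hd : ∀ s, HasDerivAt (fun s => s * Q s - (1 / 2) * ∫ t in (0 : ℝ)..(s ^ 2), k t) 0 s := by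
      intro s
      refine ((hsQ s).sub ((hJd (s ^ 2)).comp s (hasDerivAt_pow 2 s))).congr_deriv ?_
      rw [hkK]
      norm_num
      ring
    have hconst := is_const_of_deriv_eq_zero (fun y => (hd y).differentiableAt)
      (fun y => (hd y).deriv) s 0
    simp only [zero_mul, ne_eq, OfNat.ofNat_ne_zero, not_false_eq_true, zero_pow,
      intervalIntegral.integral_same, mul_zero, sub_zero] at hconst
    show _ = (1 / 2) * ∫ t in (0 : ℝ)..(s ^ 2), k t
    rw [← sub_eq_zero.1 hconst, hQparts, ← intervalIntegral.integral_const_mul]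
    exact intervalIntegral.integral_congr fun φ _ => by ring

lemma exists_localAction_elliptic {n : ℕ} (hn : 1 ≤ n) (hV : IsS3B 2 V)
    (hs : ContDiff ℝ (2 * n + 2 : ℕ) V) (hx : x ∈ leaves V) (he : x.1 = x.2) :
    ∃ J, LocalAction V (n + 1) x J := by
  obtain ⟨hd1, hd2⟩ := leaf_elliptic hx he
  set q₀ := x.1 with hq₀
  have hdf : deriv (fun z => V (q₀ + z) - V q₀) = fun z => deriv V (q₀ + z) := by
    funext z
    rw [deriv_sub_const, deriv_comp_const_add]
  obtain ⟨g, hg, hg0, hfg, hgf⟩ := exists_morse_coordinate hn (f := fun z => V (q₀ + z) - V q₀)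
    ((hs.comp (by fun_prop)).sub contDiff_const) (by simp) (by rw [hdf]; simpa using hd1)
    (by rw [hdf, deriv_comp_const_add]; simpa using hd2)
  obtain ⟨J, hJ, hJ0, hJs⟩ := exists_contDiff_area hg
  have hg1 : ContDiff ℝ 1 g := hg.of_le (by norm_cast; omega)
  have hgc : Continuous (deriv g) := (contDiff_one_iff_deriv.1 hg1).2
  have hpi := Real.pi_pos
  set J' : ℝ → ℝ := fun h => (1 / Real.pi) * J (2 * (h - V q₀)) with hJ'
  have hJ'd : HasDerivAt J' ((1 / Real.pi) * (deriv J 0 * 2)) (V q₀) := by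
    have h1 : HasDerivAt (fun h => 2 * (h - V q₀)) 2 (V q₀) := by
      simpa using ((hasDerivAt_id (V q₀)).sub_const (V q₀)).const_mul 2
    have h2 : HasDerivAt J (deriv J 0) (2 * (V q₀ - V q₀)) := by
      rw [sub_self, mul_zero]
      exact ((hJ.differentiable (by norm_cast)) 0).hasDerivAt
    exact (h2.comp (V q₀) h1).const_mul _
  refine ⟨J', (contDiff_const.mul (hJ.comp (by fun_prop))).contDiffAt, ?_, ?_⟩
  · rw [hJ'd.deriv, hJ0]
    positivity
  have hx1 : Tendsto (fun y : ℝ × ℝ => y.1 - q₀) (𝓝[leaves V] x) (𝓝 0) := by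
    simpa [hq₀] using (tendsto_fst_leaves (V := V) (x := x)).sub_const q₀
  have hx2 : Tendsto (fun y : ℝ × ℝ => y.2 - q₀) (𝓝[leaves V] x) (𝓝 0) := by
    have := (tendsto_snd_leaves (V := V) (x := x)).sub_const q₀
    rwa [← he, sub_self] at this
  have hst : Tendsto (fun y : ℝ × ℝ => √(2 * (V y.1 - V q₀))) (𝓝[leaves V] x) (𝓝 0) := by
    have h1 : Continuous fun q => √(2 * (V q - V q₀)) := by
      have := hV.continuous
      fun_prop
    have := (h1.tendsto x.1).comp (tendsto_fst_leaves (V := V))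
    rwa [← hq₀, sub_self, mul_zero, Real.sqrt_zero] at this
  obtain ⟨ε, hε, hεs⟩ := Metric.eventually_nhds_iff_ball.1 hfg
  filter_upwards [hx1.eventually hgf, hx2.eventually hgf, self_mem_nhdsWithin,
    eventually_crit_mem_iff hV hx hd1, hst.eventually (Metric.ball_mem_nhds 0 hε)]
    with y h1 h2 hy hcr hyε
  have hq₀y : q₀ ∈ Icc y.1 y.2 := hcr.1 ⟨le_rfl, he.le⟩
  have e1 := h1.2 (by linarith [hq₀y.1])
  have e2 := h2.1 (by linarith [hq₀y.2])
  simp only [add_sub_cancel, leaf_eq hy] at e1 e2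
  set s := √(2 * (V y.1 - V q₀)) with hs'
  have hle : 0 ≤ V y.1 - V q₀ := sub_nonneg.2 (leaf_le_energy hy hq₀y)
  have hssq : s ^ 2 = 2 * (V y.1 - V q₀) := Real.sq_sqrt (by linarith)
  have hs0 : 0 ≤ s := Real.sqrt_nonneg _
  rw [Real.dist_eq, sub_zero, abs_of_nonneg hs0] at hyε
  rw [Real.ball_eq_Ioo] at hεs
  have hcomp := intervalIntegral.integral_comp_mul_deriv
    (a := -(Real.pi / 2)) (b := Real.pi / 2)
    (f := fun φ => q₀ + g (s * Real.sin φ))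
    (f' := fun φ => deriv g (s * Real.sin φ) * (s * Real.cos φ))
    (g := fun q => √(2 * (V y.1 - V q)))
    (fun φ _ => (((hg1.differentiable one_ne_zero) _).hasDerivAt.comp φ
      ((Real.hasDerivAt_sin φ).const_mul s)).const_add q₀)
    (by fun_prop) (continuous_momentum hV _)
  simp only [Real.sin_neg, Real.sin_pi_div_two, mul_neg, mul_one, e1, e2, add_sub_cancel] at hcomp
  rw [action, energy, ← hcomp]
  show _ = (1 / Real.pi) * J (2 * (V y.1 - V q₀))
  rw [← hssq, ← hJs]
  congr 1
  refine intervalIntegral.integral_congr fun φ hφ => ?_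
  rw [uIcc_of_le (by linarith)] at hφ
  have hcos : 0 ≤ Real.cos φ := Real.cos_nonneg_of_mem_Icc hφ
  have hb1 := Real.neg_one_le_sin φ
  have hb2 := Real.sin_le_one φ
  have hV' := hεs (s * Real.sin φ) ⟨by nlinarith, by nlinarith⟩
  have hsq : 2 * (V y.1 - V (q₀ + g (s * Real.sin φ))) = (s * Real.cos φ) ^ 2 := by
    have := Real.sin_sq_add_cos_sq φ
    have h3 : V (q₀ + g (s * Real.sin φ)) = V q₀ + (s * Real.sin φ) ^ 2 / 2 := by linarith
    rw [h3]
    linear_combination (-1 : ℝ) * hssq - s ^ 2 * this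
  rw [Function.comp_apply, hsq, Real.sqrt_sq (mul_nonneg hs0 hcos)]

end

section

/-! ### Derivatives of functions given through a change of variables -/

/-- If `F ∘ J = R` locally, with `J` a local diffeomorphism, then `F` is as smooth as `R` and
`F' ∘ J = R' / J'`. -/
lemma contDiffAt_and_deriv_of_comp {n m : ℕ} (hm : 1 ≤ m) (hnm : n ≤ m) {F J R : ℝ → ℝ} {h₀ : ℝ}
    (hJ : ContDiffAt ℝ m J h₀) (hJ0 : deriv J h₀ ≠ 0) (hR : ContDiffAt ℝ n R h₀)
    (hF : ∀ᶠ h in 𝓝 h₀, F (J h) = R h) :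
    ContDiffAt ℝ n F (J h₀) ∧
      (1 ≤ n → ∀ᶠ h in 𝓝 h₀, deriv F (J h) = deriv R h / deriv J h) := by
  obtain ⟨g, hg, hgJ, hJg⟩ := exists_local_inverse (by omega) hJ hJ0
  have hg0 : g (J h₀) = h₀ := hgJ.self_of_nhds
  have hgt : Tendsto g (𝓝 (J h₀)) (𝓝 h₀) := by
    simpa only [hg0] using hg.continuous.tendsto (J h₀)
  have hFe : F =ᶠ[𝓝 (J h₀)] fun v => R (g v) := by
    filter_upwards [hgt.eventually hF, hJg] with v h1 h2
    rw [← h1, h2]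
  have hgd : ContDiff ℝ n g := hg.of_le (by exact_mod_cast hnm)
  refine ⟨(ContDiffAt.comp (J h₀) (by rw [hg0]; exact hR) hgd.contDiffAt).congr_of_eventuallyEq
    hFe, fun hn => ?_⟩
  have hn' : (n : WithTop ℕ∞) ≠ 0 := by exact_mod_cast (by omega : n ≠ 0)
  have hm' : (m : WithTop ℕ∞) ≠ 0 := by exact_mod_cast (by omega : m ≠ 0)
  filter_upwards [hJ.continuousAt.eventually hFe.eventuallyEq_nhds, hgJ.eventually_nhds,
    hR.eventually (by simp), hJ.eventually (by simp)] with h h1 h2 h3 h4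
  have hgJh : g (J h) = h := h2.self_of_nhds
  have hgdh : HasDerivAt g (deriv g (J h)) (J h) :=
    ((hg.differentiable hm') (J h)).hasDerivAt
  have hRd : HasDerivAt R (deriv R h) (g (J h)) := by
    rw [hgJh]; exact (h3.differentiableAt hn').hasDerivAt
  have hJd : HasDerivAt J (deriv J h) h := (h4.differentiableAt hm').hasDerivAt
  have h5 : HasDerivAt F (deriv R h * deriv g (J h)) (J h) :=
    (hRd.comp (J h) hgdh).congr_of_eventuallyEq h1
  have h6 : deriv g (J h) * deriv J h = 1 :=
    (hgdh.comp h hJd).unique ((hasDerivAt_id h).congr_of_eventuallyEq h2)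
  have h7 : deriv J h ≠ 0 := right_ne_zero_of_mul_eq_one h6
  rw [h5.deriv, eq_div_iff h7, mul_assoc, h6, mul_one]

/-- The derivatives of `F` in the variable `J h`, if `F (J h) = R h`. -/
def iterDerivAlong (J R : ℝ → ℝ) : ℕ → ℝ → ℝ
  | 0 => R
  | k + 1 => fun h => deriv (iterDerivAlong J R k) h / deriv J h

lemma contDiffAt_deriv {n : ℕ} {f : ℝ → ℝ} {h₀ : ℝ} (hf : ContDiffAt ℝ (n + 1 : ℕ) f h₀) :
    ContDiffAt ℝ n (deriv f) h₀ := by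
  obtain ⟨g, hg, hgf⟩ := exists_contDiff_eventuallyEq hf
  exact (contDiff_deriv hg).contDiffAt.congr_of_eventuallyEq hgf.symm.deriv

lemma contDiffAt_iterDerivAlong {n : ℕ} {J R : ℝ → ℝ} {h₀ : ℝ}
    (hJ : ContDiffAt ℝ (n + 1 : ℕ) J h₀) (hJ0 : deriv J h₀ ≠ 0) (hR : ContDiffAt ℝ n R h₀) :
    ∀ k m : ℕ, k + m = n → ContDiffAt ℝ m (iterDerivAlong J R k) h₀ := by
  intro k
  induction k with
  | zero => intro m hm; rw [zero_add] at hm; subst hm; exact hR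
  | succ k ih =>
    intro m hm
    exact (contDiffAt_deriv (ih (m + 1) (by omega))).div
      ((contDiffAt_deriv hJ).of_le (by exact_mod_cast (by omega : m ≤ n))) hJ0

lemma iteratedDeriv_eq_iterDerivAlong {n : ℕ} {F J R : ℝ → ℝ} {h₀ : ℝ}
    (hJ : ContDiffAt ℝ (n + 1 : ℕ) J h₀) (hJ0 : deriv J h₀ ≠ 0) (hR : ContDiffAt ℝ n R h₀)
    (hF : ∀ᶠ h in 𝓝 h₀, F (J h) = R h) :
    ∀ k, k ≤ n → ∀ᶠ h in 𝓝 h₀, iteratedDeriv k F (J h) = iterDerivAlong J R k h := by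
  intro k
  induction k with
  | zero => intro _; simpa [iterDerivAlong] using hF
  | succ k ih =>
    intro hk
    have := (contDiffAt_and_deriv_of_comp (n := n - k) (by omega) (by omega) hJ hJ0
      (contDiffAt_iterDerivAlong hJ hJ0 hR k (n - k) (by omega)) (ih (by omega))).2 (by omega)
    simp only [iteratedDeriv_succ]
    exact this

/-! ### The rotation function near a pair of leaves -/

variable {V V₁ V₂ : ℝ → ℝ} {x y y₁ y₂ x₁ x₂ : ℝ × ℝ} {B : Set (ℝ × ℝ)} {H : ℝ}

lemma eventually_component_eq (hV : IsS3B 2 V) (hx : x ∈ leaves V) :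
    ∀ᶠ y in 𝓝[leaves V] x,
      connectedComponentIn (leaves V) y = connectedComponentIn (leaves V) x := by
  have hs : ∀ᶠ y in 𝓝[leaves V] x, SameCrit V x y := by
    have := (eventually_all_finite hV.finite_crit (l := 𝓝[leaves V] x)
      (p := fun c y => c ∈ Icc x.1 x.2 ↔ c ∈ Icc y.1 y.2)).2
      fun c hc => eventually_crit_mem_iff hV hx hc
    exact this
  filter_upwards [hs, self_mem_nhdsWithin] with y hy hyl
  rcases lt_trichotomy (V x.1) (V y.1) with h1 | h1 | h1
  · exact (connectedComponentIn_eq (hy.mem_component hV hx hyl h1)).symm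
  · obtain ⟨c, hcx, hc⟩ := leaf_exists_crit hV hx
    rw [leaf_eq_of_energy_eq hx hyl hc hcx ((hy c hc).1 hcx) h1]
  · have hs' : SameCrit V y x := fun c hc => (hy c hc).symm
    exact connectedComponentIn_eq (hs'.mem_component hV hyl hx h1)

lemma continuous_action (hV : Continuous V) : Continuous (action V) := by
  have hf : Continuous (Function.uncurry fun (y : ℝ × ℝ) q => √(2 * (V y.1 - V q))) := by
    simp only [Function.uncurry_def]
    fun_prop
  have h1 := intervalIntegral.continuous_parametric_intervalIntegral_of_continuous (μ := volume)
    hf (a₀ := 0) (s := fun y : ℝ × ℝ => y.2) continuous_snd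
  have h2 := intervalIntegral.continuous_parametric_intervalIntegral_of_continuous (μ := volume)
    hf (a₀ := 0) (s := fun y : ℝ × ℝ => y.1) continuous_fst
  have heq : action V = fun y => (1 / Real.pi) * ((∫ q in (0 : ℝ)..y.2, √(2 * (V y.1 - V q))) -
      ∫ q in (0 : ℝ)..y.1, √(2 * (V y.1 - V q))) := by
    funext y
    have hi : ∀ a b, IntervalIntegrable (fun q => √(2 * (V y.1 - V q))) volume a b := fun a b =>
      Continuous.intervalIntegrable (by fun_prop) a b
    rw [intervalIntegral.integral_interval_sub_left (hi _ _) (hi _ _)]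
    rfl
  rw [heq]
  exact continuous_const.mul (h1.sub h2)

lemma LocalAction.eventually {n : ℕ} {J : ℝ → ℝ} (hV : Continuous V) (hn : 1 ≤ n)
    (h : LocalAction V n x J) : ∀ᶠ y in 𝓝[leaves V] x, LocalAction V n y J := by
  obtain ⟨h1, h2, h3⟩ := h
  obtain ⟨m, rfl⟩ : ∃ m, n = m + 1 := ⟨n - 1, by omega⟩
  have ht := tendsto_energy_leaves (x := x) hV
  filter_upwards [ht.eventually (h1.eventually (by simp)),
    ht.eventually ((contDiffAt_deriv h1).continuousAt.eventually (lt_mem_nhds h2)),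
    eventually_eventually_nhdsWithin.2 h3] with y e1 e2 e3
  exact ⟨e1, e2, e3⟩

lemma LocalTravel.eventually {n : ℕ} {T : ℝ → ℝ} (hV : Continuous V)
    (h : LocalTravel V n x T) : ∀ᶠ y in 𝓝[leaves V] x, LocalTravel V n y T := by
  obtain ⟨h1, h3⟩ := h
  filter_upwards [(tendsto_energy_leaves (x := x) hV).eventually (h1.eventually (by simp)),
    eventually_eventually_nhdsWithin.2 h3] with y e1 e3
  exact ⟨e1, e3⟩

/-- On the branch through a nonelliptic leaf, all energies close to the energy of the leaf occur,
on close leaves. -/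
lemma eventually_exists_leaf (hV : IsS3B 2 V) (hy : y ∈ leaves V) (hlt : y.1 < y.2)
    {p : ℝ × ℝ → Prop} (hp : ∀ᶠ z in 𝓝[leaves V] y, p z) :
    ∀ᶠ h in 𝓝 (V y.1), ∃ z ∈ connectedComponentIn (leaves V) y, V z.1 = h ∧ p z := by
  obtain ⟨γ, hγx, hγc, hγe⟩ := exists_leaf_curve hV hy hlt
  have hγt : Tendsto γ (𝓝 (V y.1)) (𝓝[leaves V] y) := by
    refine tendsto_nhdsWithin_iff.2 ⟨by simpa only [hγx] using hγc.tendsto, ?_⟩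
    filter_upwards [hγe] with h hh
    exact connectedComponentIn_subset _ _ hh.1
  filter_upwards [hγe, hγt.eventually hp] with h h1 h2
  exact ⟨γ h, h1.1, h1.2, h2⟩

lemma LocalAction.eventually_hamiltonian {n : ℕ} {J : ℝ → ℝ} (hV : IsS3B 2 V)
    (hy : y ∈ leaves V) (hlt : y.1 < y.2) (h : LocalAction V n y J) :
    ∀ᶠ h in 𝓝 (V y.1), hamiltonian V (connectedComponentIn (leaves V) y) (J h) = h := by
  have hB : IsBranch V (connectedComponentIn (leaves V) y) := ⟨y, hy, rfl⟩
  filter_upwards [eventually_exists_leaf hV hy hlt h.2.2] with e he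
  obtain ⟨z, hz, hze, hzJ⟩ := he
  have := hamiltonian_action hV hB hz
  rwa [hzJ, energy, hze] at this

lemma LocalAction.eventually_frequency {n : ℕ} {J : ℝ → ℝ} (hn : 1 ≤ n) (hV : IsS3B 2 V)
    (hy : y ∈ leaves V) (hlt : y.1 < y.2) (h : LocalAction V n y J) :
    ∀ᶠ h in 𝓝 (V y.1),
      frequency V (connectedComponentIn (leaves V) y) (J h) = 1 / deriv J h := by
  have := (contDiffAt_and_deriv_of_comp hn hn h.1 h.2.1.ne' (R := fun h => h) contDiffAt_fun_id
    (h.eventually_hamiltonian hV hy hlt)).2 (by omega)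
  simpa only [deriv_id'', frequency] using this

/-- The rotation in terms of the energy of the second degree of freedom. -/
def rotationOfEnergy (J₁ T₁ J₂ : ℝ → ℝ) (H h : ℝ) : ℝ :=
  1 / deriv J₂ h * (2 * Real.pi * deriv J₁ (H - h) - T₁ (H - h))

lemma eventually_rotation {n : ℕ} {J₁ T₁ J₂ : ℝ → ℝ} (hn : 1 ≤ n) (hV₁ : IsS3B 2 V₁)
    (hV₂ : IsS3B 2 V₂) (hy₁ : y₁ ∈ leaves V₁) (hlt₁ : y₁.1 < y₁.2) (hy₂ : y₂ ∈ leaves V₂)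
    (hlt₂ : y₂.1 < y₂.2) (hH : V₁ y₁.1 = H - V₂ y₂.1) (hJ₁ : LocalAction V₁ n y₁ J₁)
    (hT₁ : LocalTravel V₁ n y₁ T₁) (hJ₂ : LocalAction V₂ n y₂ J₂) :
    ∀ᶠ h in 𝓝 (V₂ y₂.1), rotation V₁ V₂ (connectedComponentIn (leaves V₁) y₁)
      (connectedComponentIn (leaves V₂) y₂) H (J₂ h) = rotationOfEnergy J₁ T₁ J₂ H h := by
  have hB₁ : IsBranch V₁ (connectedComponentIn (leaves V₁) y₁) := ⟨y₁, hy₁, rfl⟩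
  have hsub : Tendsto (fun h => H - h) (𝓝 (V₂ y₂.1)) (𝓝 (V₁ y₁.1)) := by
    rw [hH]
    exact (continuous_const.sub continuous_id).continuousAt
  filter_upwards [hJ₂.eventually_hamiltonian hV₂ hy₂ hlt₂,
    hJ₂.eventually_frequency hn hV₂ hy₂ hlt₂,
    hsub.eventually (hJ₁.eventually_frequency hn hV₁ hy₁ hlt₁),
    hsub.eventually (eventually_exists_leaf hV₁ hy₁ hlt₁ (hJ₁.2.2.and hT₁.2))] with h e1 e2 e3 e4
  obtain ⟨z, hz, hze, hzJ, hzT⟩ := e4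
  have hlz : leafOfEnergy V₁ (connectedComponentIn (leaves V₁) y₁) (H - h) = z := by
    rw [← hze]
    exact leafOfEnergy_energy hV₁ hB₁ hz
  rw [rotation, complementaryAction, e1, hlz, hzJ, hzT, hze, period, e2, e3, rotationOfEnergy,
    div_div_eq_mul_div, div_one]

lemma contDiffAt_rotationOfEnergy {n : ℕ} {J₁ T₁ J₂ : ℝ → ℝ} (hH : V₁ x₁.1 = H - V₂ x₂.1)
    (hJ₁ : LocalAction V₁ (n + 1) x₁ J₁) (hT₁ : LocalTravel V₁ n x₁ T₁)
    (hJ₂ : LocalAction V₂ (n + 1) x₂ J₂) :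
    ContDiffAt ℝ n (rotationOfEnergy J₁ T₁ J₂ H) (V₂ x₂.1) := by
  have hsub : ContDiffAt ℝ n (fun h => H - h) (V₂ x₂.1) := contDiffAt_const.sub contDiffAt_fun_id
  have h1 : ContDiffAt ℝ n (fun h => deriv J₁ (H - h)) (V₂ x₂.1) :=
    ContDiffAt.comp (V₂ x₂.1) (g := deriv J₁) (by rw [← hH]; exact contDiffAt_deriv hJ₁.1) hsub
  have h2 : ContDiffAt ℝ n (fun h => T₁ (H - h)) (V₂ x₂.1) :=
    ContDiffAt.comp (V₂ x₂.1) (g := T₁) (by rw [← hH]; exact hT₁.1) hsub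
  exact (contDiffAt_const.div (contDiffAt_deriv hJ₂.1) hJ₂.2.1.ne').mul
    ((contDiffAt_const.mul h1).sub h2)

lemma LocalTravel.of_le {m n : ℕ} {T : ℝ → ℝ} (h : LocalTravel V n x T) (hmn : m ≤ n) :
    LocalTravel V m x T := ⟨h.1.of_le (by exact_mod_cast hmn), h.2⟩

lemma LocalAction.of_le {m n : ℕ} {J : ℝ → ℝ} (h : LocalAction V n x J) (hmn : m ≤ n) :
    LocalAction V m x J := ⟨h.1.of_le (by exact_mod_cast hmn), h.2⟩

lemma eventually_rotation' {n : ℕ} {J₁ T₁ J₂ : ℝ → ℝ} (hn : 1 ≤ n) (hV₁ : IsS3B 2 V₁)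
    (hV₂ : IsS3B 2 V₂) (hy₁ : y₁ ∈ leaves V₁) (hlt₁ : y₁.1 < y₁.2) (hy₂ : y₂ ∈ leaves V₂)
    (hlt₂ : y₂.1 < y₂.2) (hH : V₁ y₁.1 = H - V₂ y₂.1) (hJ₁ : LocalAction V₁ (n + 1) y₁ J₁)
    (hT₁ : LocalTravel V₁ n y₁ T₁) (hJ₂ : LocalAction V₂ (n + 1) y₂ J₂) :
    ∀ᶠ h in 𝓝 (V₂ y₂.1), rotation V₁ V₂ (connectedComponentIn (leaves V₁) y₁)
      (connectedComponentIn (leaves V₂) y₂) H (J₂ h) = rotationOfEnergy J₁ T₁ J₂ H h :=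
  eventually_rotation hn hV₁ hV₂ hy₁ hlt₁ hy₂ hlt₂ hH (hJ₁.of_le (Nat.le_succ n)) hT₁
    (hJ₂.of_le (Nat.le_succ n))

lemma contDiffAt_rotation {n : ℕ} (hn : 1 ≤ n) (hV₁ : IsS3B (n + 1) V₁)
    (hV₂ : IsS3B (n + 1) V₂) (hy₁ : y₁ ∈ leaves V₁) (hlt₁ : y₁.1 < y₁.2) (hy₂ : y₂ ∈ leaves V₂)
    (hlt₂ : y₂.1 < y₂.2) (hH : V₁ y₁.1 = H - V₂ y₂.1) (h0 : V₁ y₁.1 ≠ V₁ 0) :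
    ContDiffAt ℝ n (rotation V₁ V₂ (connectedComponentIn (leaves V₁) y₁)
      (connectedComponentIn (leaves V₂) y₂) H) (action V₂ y₂) := by
  obtain ⟨J₁, hJ₁⟩ := exists_localAction_of_lt hn hV₁ hy₁ hlt₁
  obtain ⟨J₂, hJ₂⟩ := exists_localAction_of_lt hn hV₂ hy₂ hlt₂
  obtain ⟨T₁, hT₁⟩ := exists_localTravel hn hV₁ hy₁ h0
  rw [hJ₂.2.2.self_of_nhdsWithin hy₂]
  exact (contDiffAt_and_deriv_of_comp (m := n + 1) (by omega) (by omega) hJ₂.1 hJ₂.2.1.ne'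
    (contDiffAt_rotationOfEnergy hH hJ₁ hT₁ hJ₂) (eventually_rotation' hn (hV₁.of_le (by omega))
      (hV₂.of_le (by omega)) hy₁ hlt₁ hy₂ hlt₂ hH hJ₁ hT₁ hJ₂)).1

lemma exists_local_bound {n : ℕ} (hn : 1 ≤ n) (hV₁ : IsS3B 2 V₁)
    (hV₂ : IsS3B 2 V₂) {J₁ T₁ J₂ : ℝ → ℝ} (hH : V₁ x₁.1 = H - V₂ x₂.1)
    (hJ₁ : LocalAction V₁ (n + 1) x₁ J₁) (hT₁ : LocalTravel V₁ n x₁ T₁)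
    (hJ₂ : LocalAction V₂ (n + 1) x₂ J₂) :
    ∃ M : ℝ, ∀ᶠ p in 𝓝[leaves V₁] x₁ ×ˢ 𝓝[leaves V₂] x₂,
      p.1.1 < p.1.2 → p.2.1 < p.2.2 → V₁ p.1.1 = H - V₂ p.2.1 → ∀ k ≤ n,
        |iteratedDeriv k (rotation V₁ V₂ (connectedComponentIn (leaves V₁) p.1)
          (connectedComponentIn (leaves V₂) p.2) H) (action V₂ p.2)| < M := by
  set R := rotationOfEnergy J₁ T₁ J₂ H with hR
  have hRc : ContDiffAt ℝ n R (V₂ x₂.1) := contDiffAt_rotationOfEnergy hH hJ₁ hT₁ hJ₂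
  have hcont : ∀ k ≤ n, ContinuousAt (iterDerivAlong J₂ R k) (V₂ x₂.1) := fun k hk =>
    (contDiffAt_iterDerivAlong hJ₂.1 hJ₂.2.1.ne' hRc k (n - k) (by omega)).continuousAt
  set M := ∑ k ∈ Finset.range (n + 1), (|iterDerivAlong J₂ R k (V₂ x₂.1)| + 1) with hM
  have hbd : ∀ᶠ h in 𝓝 (V₂ x₂.1), ∀ k ≤ n, |iterDerivAlong J₂ R k h| < M := by
    have := (eventually_all_finite (finite_le_nat n) (l := 𝓝 (V₂ x₂.1))
      (p := fun k h => |iterDerivAlong J₂ R k h| < M)).2 ?_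
    · exact this
    intro k hk
    have hk' : k ≤ n := hk
    refine (hcont k hk).abs.eventually (gt_mem_nhds (lt_of_lt_of_le (lt_add_one _) ?_))
    exact Finset.single_le_sum (f := fun k => |iterDerivAlong J₂ R k (V₂ x₂.1)| + 1)
      (fun i _ => by positivity) (Finset.mem_range.2 (by omega))
  have ev1 : ∀ᶠ y₁ in 𝓝[leaves V₁] x₁,
      y₁ ∈ leaves V₁ ∧ LocalAction V₁ (n + 1) y₁ J₁ ∧ LocalTravel V₁ n y₁ T₁ :=
    eventually_mem_nhdsWithin.and
      ((hJ₁.eventually hV₁.continuous (by omega)).and (hT₁.eventually hV₁.continuous))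
  have ev2 : ∀ᶠ y₂ in 𝓝[leaves V₂] x₂, y₂ ∈ leaves V₂ ∧ LocalAction V₂ (n + 1) y₂ J₂ ∧
      ∀ k ≤ n, |iterDerivAlong J₂ R k (V₂ y₂.1)| < M :=
    eventually_mem_nhdsWithin.and ((hJ₂.eventually hV₂.continuous (by omega)).and
      ((tendsto_energy_leaves hV₂.continuous).eventually hbd))
  refine ⟨M, (ev1.prod_mk ev2).mono ?_⟩
  rintro ⟨y₁, y₂⟩ ⟨⟨hy₁, hJ₁', hT₁'⟩, hy₂, hJ₂', hb⟩ hlt₁ hlt₂ hH' k hk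
  simp only at hy₁ hy₂ hlt₁ hlt₂ hH' ⊢
  have hrot := eventually_rotation' hn hV₁ hV₂ hy₁ hlt₁ hy₂ hlt₂ hH' hJ₁' hT₁' hJ₂'
  have := (iteratedDeriv_eq_iterDerivAlong hJ₂'.1 hJ₂'.2.1.ne'
    (contDiffAt_rotationOfEnergy hH' hJ₁' hT₁' hJ₂') hrot k hk).self_of_nhds
  rw [hJ₂'.2.2.self_of_nhdsWithin hy₂, this]
  exact hb k hk

end

section

variable {V V₁ V₂ : ℝ → ℝ} {x y y₁ y₂ x₁ x₂ : ℝ × ℝ} {B B₁ B₂ : Set (ℝ × ℝ)} {H δ ρ I : ℝ}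

/-! ### The regular set -/

/-- The pair of leaves `y₁`, `y₂` on the total energy level `H` is regular, and away from
tangency. -/
structure RegularPair (V₁ V₂ : ℝ → ℝ) (δ ρ H : ℝ) (y₁ y₂ : ℝ × ℝ) : Prop where
  lt₁ : y₁.1 < y₁.2
  lt₂ : y₂.1 < y₂.2
  energy_eq : V₁ y₁.1 = H - V₂ y₂.1
  mem_regular : V₂ y₂.1 ∈ regularEnergies V₂ V₁ δ H
  tangent : ∀ x ∈ connectedComponentIn (leaves V₂) y₂, V₂ x.1 = H - V₁ 0 →
    ρ ≤ |action V₂ x - action V₂ y₂|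

lemma InDomain.exists_regularPair (hV₁ : IsS3B 2 V₁) (hV₂ : IsS3B 2 V₂)
    (h : InDomain V₁ V₂ B₁ B₂ δ ρ H I) :
    ∃ y₁ ∈ leaves V₁, ∃ y₂ ∈ leaves V₂, B₁ = connectedComponentIn (leaves V₁) y₁ ∧
      B₂ = connectedComponentIn (leaves V₂) y₂ ∧ I = action V₂ y₂ ∧
      complementaryAction V₁ V₂ B₁ B₂ H I = action V₁ y₁ ∧ RegularPair V₁ V₂ δ ρ H y₁ y₂ := by
  obtain ⟨hB₁, hB₂, ⟨⟨y₂, ⟨hy₂, hreg⟩, rfl⟩, htan⟩, ⟨y₁, hy₁, hH⟩, hI, hJ⟩ := h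
  rw [hamiltonian_action hV₂ hB₂ hy₂] at hH
  have hJ' : complementaryAction V₁ V₂ B₁ B₂ H (action V₂ y₂) = action V₁ y₁ := by
    rw [complementaryAction, hamiltonian_action hV₂ hB₂ hy₂, ← hH,
      leafOfEnergy_energy hV₁ hB₁ hy₁]
  rw [hJ'] at hJ
  have hl₁ := hB₁.subset_leaves hy₁
  have hl₂ := hB₂.subset_leaves hy₂
  refine ⟨y₁, hl₁, y₂, hl₂, hB₁.eq_component hy₁, hB₂.eq_component hy₂, rfl, hJ',
    lt_of_action_pos hl₁ hJ, lt_of_action_pos hl₂ hI, hH, hreg, fun x hx hxe => ?_⟩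
  rw [← hB₂.eq_component hy₂] at hx
  by_contra! hlt
  rw [abs_lt] at hlt
  exact htan (mem_biUnion (show x ∈ {x ∈ B₂ | energy V₂ x = H - V₁ 0} from ⟨hx, hxe⟩)
    ⟨by linarith, by linarith⟩)

lemma RegularPair.energy_ne (hρ : 0 < ρ) (hy₂ : y₂ ∈ leaves V₂)
    (h : RegularPair V₁ V₂ δ ρ H y₁ y₂) : V₁ y₁.1 ≠ V₁ 0 := by
  intro he
  have := h.tangent y₂ (mem_connectedComponentIn hy₂) (by linarith [h.energy_eq])
  rw [sub_self, abs_zero] at this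
  linarith

lemma isClosed_regularEnergies : IsClosed (regularEnergies V₁ V₂ δ H) := by
  refine isClosed_Icc.sdiff (IsOpen.union ?_ ?_)
  · exact isOpen_biUnion fun _ _ => isOpen_Ioo
  · exact isOpen_biUnion fun _ _ => isOpen_Ioo

lemma isCompact_regularEnergies : IsCompact (regularEnergies V₁ V₂ δ H) :=
  isCompact_Icc.of_isClosed_subset isClosed_regularEnergies sdiff_subset

lemma saddle_notMem_regularEnergies (hδ : 0 < δ) {q : ℝ} (hq : q ∈ saddles V₂) :
    V₂ q ∉ regularEnergies V₂ V₁ δ H := fun h =>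
  h.2 (Or.inl (mem_biUnion hq ⟨by linarith, by linarith⟩))

lemma complement_saddle_notMem_regularEnergies (hδ : 0 < δ) {q : ℝ} (hq : q ∈ saddles V₁) :
    H - V₁ q ∉ regularEnergies V₂ V₁ δ H := fun h =>
  h.2 (Or.inr (mem_biUnion hq ⟨by linarith, by linarith⟩))

/-- Pairs of leaves with regular energies. -/
def regularPairs (V₁ V₂ : ℝ → ℝ) (δ H : ℝ) : Set ((ℝ × ℝ) × (ℝ × ℝ)) :=
  {p | p.1 ∈ leaves V₁ ∧ p.2 ∈ leaves V₂ ∧ V₁ p.1.1 = H - V₂ p.2.1 ∧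
    V₂ p.2.1 ∈ regularEnergies V₂ V₁ δ H}

lemma isCompact_regularPairs (hV₁ : IsS3B 2 V₁) (hV₂ : IsS3B 2 V₂) (hδ : 0 < δ) :
    IsCompact (regularPairs V₁ V₂ δ H) := by
  set K := regularEnergies V₂ V₁ δ H with hK
  have hKc : IsCompact K := isCompact_regularEnergies
  have hK' : IsCompact ((fun h => H - h) '' K) :=
    hKc.image (continuous_const.sub continuous_id)
  have c₁ := isCompact_leaves hV₁ hK' (by
    rintro q hq ⟨h, hh, he⟩
    refine complement_saddle_notMem_regularEnergies (V₂ := V₂) (H := H) hδ hq ?_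
    rw [← he, sub_sub_cancel]
    exact hh)
  have c₂ := isCompact_leaves hV₂ hKc fun q hq => saddle_notMem_regularEnergies hδ hq
  have heq : regularPairs V₁ V₂ δ H = ({x ∈ leaves V₁ | V₁ x.1 ∈ (fun h => H - h) '' K} ×ˢ
      {x ∈ leaves V₂ | V₂ x.1 ∈ K}) ∩ {p | V₁ p.1.1 = H - V₂ p.2.1} := by
    ext p
    constructor
    · rintro ⟨h1, h2, h3, h4⟩
      exact ⟨⟨⟨h1, ⟨_, h4, h3.symm⟩⟩, h2, h4⟩, h3⟩
    · rintro ⟨⟨⟨h1, -⟩, h2, h4⟩, h3⟩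
      exact ⟨h1, h2, h3, h4⟩
  rw [heq]
  have := hV₁.continuous
  have := hV₂.continuous
  exact (c₁.prod c₂).inter_right (isClosed_eq (by fun_prop) (by fun_prop))

/-- Uniform bounds for the derivatives of the rotation over all regular pairs of leaves, under
restrictions `Q₁`, `Q₂` on the leaves such that locally either the action is smooth or the
restriction excludes everything. -/
lemma exists_uniform_bound {n : ℕ} (hn : 1 ≤ n) (hV₁ : IsS3B (n + 1) V₁)
    (hV₂ : IsS3B (n + 1) V₂) (hδ : 0 < δ) (hρ : 0 < ρ) {Q₁ Q₂ : ℝ × ℝ → Prop}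
    (hQ₁ : ∀ x ∈ leaves V₁,
      (∃ J, LocalAction V₁ (n + 1) x J) ∨ ∀ᶠ y in 𝓝[leaves V₁] x, ¬ Q₁ y)
    (hQ₂ : ∀ x ∈ leaves V₂,
      (∃ J, LocalAction V₂ (n + 1) x J) ∨ ∀ᶠ y in 𝓝[leaves V₂] x, ¬ Q₂ y) :
    ∃ M : ℝ, ∀ y₁ ∈ leaves V₁, ∀ y₂ ∈ leaves V₂, Q₁ y₁ → Q₂ y₂ →
      RegularPair V₁ V₂ δ ρ H y₁ y₂ → ∀ k ≤ n,
        |iteratedDeriv k (rotation V₁ V₂ (connectedComponentIn (leaves V₁) y₁)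
          (connectedComponentIn (leaves V₂) y₂) H) (action V₂ y₂)| < M := by
  have hV₁' : IsS3B 2 V₁ := hV₁.of_le (by omega)
  have hV₂' : IsS3B 2 V₂ := hV₂.of_le (by omega)
  let Good : ℝ → (ℝ × ℝ) × (ℝ × ℝ) → Prop := fun M p => Q₁ p.1 → Q₂ p.2 →
    RegularPair V₁ V₂ δ ρ H p.1 p.2 → ∀ k ≤ n,
      |iteratedDeriv k (rotation V₁ V₂ (connectedComponentIn (leaves V₁) p.1)
        (connectedComponentIn (leaves V₂) p.2) H) (action V₂ p.2)| < M
  have key : ∃ M, ∀ p ∈ regularPairs V₁ V₂ δ H, Good M p := by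
    refine (isCompact_regularPairs hV₁' hV₂' hδ).induction_on
      (p := fun s => ∃ M, ∀ p ∈ s, Good M p) ⟨0, by simp⟩
      (fun s t hst ⟨M, hM⟩ => ⟨M, fun p hp => hM p (hst hp)⟩) ?_ ?_
    · rintro s t ⟨M, hM⟩ ⟨M', hM'⟩
      refine ⟨max M M', ?_⟩
      rintro p (hp | hp) h1 h2 h3 k hk
      · exact (hM p hp h1 h2 h3 k hk).trans_le (le_max_left _ _)
      · exact (hM' p hp h1 h2 h3 k hk).trans_le (le_max_right _ _)
    · rintro ⟨x₁, x₂⟩ ⟨hx₁, hx₂, hH, hreg⟩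
      simp only at hx₁ hx₂ hH hreg
      have hle : 𝓝[regularPairs V₁ V₂ δ H] (x₁, x₂) ≤ 𝓝[leaves V₁] x₁ ×ˢ 𝓝[leaves V₂] x₂ := by
        rw [← nhdsWithin_prod_eq]
        exact nhdsWithin_mono _ fun p hp => ⟨hp.1, hp.2.1⟩
      suffices h : ∃ M, ∀ᶠ p in 𝓝[leaves V₁] x₁ ×ˢ 𝓝[leaves V₂] x₂, Good M p by
        obtain ⟨M, hM⟩ := h
        exact ⟨{p | Good M p}, hle hM, M, fun p hp => hp⟩
      by_cases htan : V₁ x₁.1 = V₁ 0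
      · refine ⟨0, ?_⟩
        have hact : ∀ᶠ y in 𝓝[leaves V₂] x₂, |action V₂ x₂ - action V₂ y| < ρ := by
          have h1 := ((continuous_action hV₂'.continuous).tendsto x₂).mono_left
            (nhdsWithin_le_nhds (s := leaves V₂))
          have h2 := (h1.const_sub (action V₂ x₂)).abs
          rw [sub_self, abs_zero] at h2
          exact h2.eventually (gt_mem_nhds hρ)
        have ev := (eventually_component_eq hV₂' hx₂).and hact
        filter_upwards [tendsto_snd.eventually ev] with p hp _ _ hreg'
        have := hreg'.tangent x₂ (by rw [hp.1]; exact mem_connectedComponentIn hx₂)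
          (by linarith)
        exact absurd this hp.2.not_ge
      obtain ⟨T₁, hT₁⟩ := exists_localTravel hn hV₁ hx₁ htan
      rcases hQ₁ x₁ hx₁ with ⟨J₁, hJ₁⟩ | hQ
      · rcases hQ₂ x₂ hx₂ with ⟨J₂, hJ₂⟩ | hQ
        · obtain ⟨M, hM⟩ := exists_local_bound hn hV₁' hV₂' hH hJ₁ hT₁ hJ₂
          exact ⟨M, hM.mono fun p hp _ _ h => hp h.lt₁ h.lt₂ h.energy_eq⟩
        · exact ⟨0, (tendsto_snd.eventually hQ).mono fun p hp _ h => absurd h hp⟩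
      · exact ⟨0, (tendsto_fst.eventually hQ).mono fun p hp h => absurd h hp⟩
  obtain ⟨M, hM⟩ := key
  exact ⟨M, fun y₁ hy₁ y₂ hy₂ h1 h2 h3 =>
    hM (y₁, y₂) ⟨hy₁, hy₂, h3.energy_eq, h3.mem_regular⟩ h1 h2 h3⟩

/-- Near elliptic leaves the action is small. -/
lemma localAction_or_action_lt {n : ℕ} (hn : 1 ≤ n) (hV : IsS3B (n + 1) V) {η : ℝ} (hη : 0 < η)
    (hx : x ∈ leaves V) : (∃ J, LocalAction V (n + 1) x J) ∨
      ∀ᶠ y in 𝓝[leaves V] x, ¬ η ≤ action V y := by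
  rcases eq_or_lt_of_le (leaf_le hx) with he | hlt
  · right
    have h1 := ((continuous_action (hV.of_le (by omega) : IsS3B 2 V).continuous).tendsto x).mono_left
      (nhdsWithin_le_nhds (s := leaves V))
    have h0 : action V x = 0 := by simp [action, he]
    rw [h0] at h1
    filter_upwards [h1.eventually (gt_mem_nhds hη)] with y hy
    exact not_le.2 hy
  · exact Or.inl (exists_localAction_of_lt hn hV hx hlt)

lemma exists_localAction {n : ℕ} (hn : 1 ≤ n) (hV : IsS3B (n + 1) V)
    (hs : ContDiff ℝ (2 * n + 2 : ℕ) V) (hx : x ∈ leaves V) :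
    ∃ J, LocalAction V (n + 1) x J := by
  rcases eq_or_lt_of_le (leaf_le hx) with he | hlt
  · exact exists_localAction_elliptic hn (hV.of_le (by omega)) hs hx he
  · exact exists_localAction_of_lt hn hV hx hlt

lemma contDiffAt_shear {n : ℕ} {f : ℝ → ℝ} {I θ : ℝ} (hf : ContDiffAt ℝ n f I) :
    ContDiffAt ℝ n (fun z : ℝ × ℝ => (z.1, z.2 + f z.1)) (I, θ) :=
  contDiffAt_fst.prodMk (contDiffAt_snd.add
    (ContDiffAt.comp (I, θ) (g := f) (f := Prod.fst) hf contDiffAt_fst))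

lemma isSymplecticAt_shear {f : ℝ → ℝ} {I θ : ℝ} (hf : DifferentiableAt ℝ f I) :
    IsSymplecticAt (fun z : ℝ × ℝ => (z.1, z.2 + f z.1)) (I, θ) := by
  have h1 : HasFDerivAt (fun z : ℝ × ℝ => f z.1)
      (deriv f I • ContinuousLinearMap.fst ℝ ℝ ℝ) (I, θ) :=
    HasDerivAt.comp_hasFDerivAt (f := fun z : ℝ × ℝ => z.1) (I, θ) hf.hasDerivAt hasFDerivAt_fst
  have h2 := (hasFDerivAt_fst (𝕜 := ℝ) (p := (I, θ))).prodMk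
    ((hasFDerivAt_snd (𝕜 := ℝ) (p := (I, θ))).add h1)
  refine ⟨h2.differentiableAt, fun u v => ?_⟩
  have h3 := h2.fderiv
  simp only [Pi.add_def] at h3
  rw [h3]
  simp [sympForm]
  ring

end

section

variable {V V₁ V₂ : ℝ → ℝ} {x y : ℝ × ℝ} {B : Set (ℝ × ℝ)} {H δ ρ : ℝ}

/-! ### Modulus of continuity of the action -/

lemma sqrt_increment_le {u ε : ℝ} (hε : 0 < ε) :
    √(2 * (u + ε)) - √(2 * u) ≤ 4 * ε / (√|u| + √ε) := by
  have hε' : 0 < √ε := Real.sqrt_pos.2 hε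
  have hden : 0 < √|u| + √ε := by positivity
  have hεs : √ε * √ε = ε := Real.mul_self_sqrt hε.le
  rcases le_or_gt 0 u with hu | hu
  · rw [abs_of_nonneg hu] at hden ⊢
    rw [le_div_iff₀ hden]
    have h1 : √u * √u = u := Real.mul_self_sqrt hu
    have h2 : √u + √ε ≤ √(2 * (u + ε)) := by
      refine Real.le_sqrt_of_sq_le ?_
      nlinarith [sq_nonneg (√u - √ε)]
    have h3 : √(2 * (u + ε)) * √(2 * (u + ε)) = 2 * (u + ε) :=
      Real.mul_self_sqrt (by linarith)
    have h4 : √(2 * u) * √(2 * u) = 2 * u := Real.mul_self_sqrt (by linarith)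
    have h5 : √(2 * u) ≤ √(2 * (u + ε)) := Real.sqrt_le_sqrt (by linarith)
    have h6 := Real.sqrt_nonneg (2 * u)
    have h7 : (√(2 * (u + ε)) - √(2 * u)) * (√u + √ε) ≤
        (√(2 * (u + ε)) - √(2 * u)) * (√(2 * (u + ε)) + √(2 * u)) :=
      mul_le_mul_of_nonneg_left (by linarith) (by linarith)
    nlinarith
  · have h0 : √(2 * u) = 0 := Real.sqrt_eq_zero_of_nonpos (by linarith)
    rw [h0, sub_zero]
    rcases le_or_gt (u + ε) 0 with h1 | h1
    · rw [Real.sqrt_eq_zero_of_nonpos (by linarith)]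
      positivity
    · have h2 : √|u| ≤ √ε := Real.sqrt_le_sqrt (by rw [abs_of_neg hu]; linarith)
      rw [le_div_iff₀ hden]
      have h3 : √(2 * (u + ε)) ≤ 2 * √ε := by
        rw [Real.sqrt_le_left (by positivity)]
        nlinarith
      have h4 := Real.sqrt_nonneg (2 * (u + ε))
      nlinarith

/-- Quadratic separation of the values of a monotone function from any level. -/
lemma exists_quadratic_separation_of_deriv_ge {f : ℝ → ℝ} (hf : Differentiable ℝ f)
    {c d q₀ : ℝ} (hc : 0 < c) (hd : 0 < d)
    (hder : ∀ q ∈ Ioo q₀ (q₀ + d), 2 * c * (q - q₀) ≤ deriv f q) (h : ℝ) :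
    ∃ q₁ ∈ Icc q₀ (q₀ + d), ∀ q ∈ Icc q₀ (q₀ + d), c * (q - q₁) ^ 2 ≤ |h - f q| := by
  have hmono : MonotoneOn (fun q => f q - c * (q - q₀) ^ 2) (Icc q₀ (q₀ + d)) := by
    have hdiff : Differentiable ℝ fun q => f q - c * (q - q₀) ^ 2 := by fun_prop
    refine monotoneOn_of_deriv_nonneg (convex_Icc _ _) hdiff.continuous.continuousOn
      hdiff.differentiableOn fun q hq => ?_
    rw [interior_Icc] at hq
    have h1 : HasDerivAt (fun q => f q - c * (q - q₀) ^ 2)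
        (deriv f q - c * (2 * (q - q₀))) q := by
      have h2 := (((hasDerivAt_id q).sub_const q₀).pow 2).const_mul c
      refine ((hf q).hasDerivAt.sub h2).congr_deriv ?_
      simp
    rw [h1.deriv]
    linarith [hder q hq]
  have key : ∀ p ∈ Icc q₀ (q₀ + d), ∀ q ∈ Icc q₀ (q₀ + d), p ≤ q →
      c * (q - p) ^ 2 ≤ f q - f p := by
    intro p hp q hq hpq
    have h1 := hmono hp hq hpq
    simp only at h1
    have h2 : (q - p) ^ 2 ≤ (q - q₀) ^ 2 - (p - q₀) ^ 2 := by
      nlinarith [mul_nonneg (sub_nonneg.2 hpq) (sub_nonneg.2 hp.1)]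
    nlinarith
  have hl : q₀ ∈ Icc q₀ (q₀ + d) := ⟨le_rfl, by linarith⟩
  have hr : q₀ + d ∈ Icc q₀ (q₀ + d) := ⟨by linarith, le_rfl⟩
  rcases le_or_gt h (f q₀) with h1 | h1
  · refine ⟨q₀, hl, fun q hq => ?_⟩
    have := key q₀ hl q hq hq.1
    rw [abs_sub_comm]
    exact le_trans (by linarith) (le_abs_self _)
  rcases le_or_gt (f (q₀ + d)) h with h2 | h2
  · refine ⟨q₀ + d, hr, fun q hq => ?_⟩
    have := key q hq (q₀ + d) hr hq.2
    refine le_trans ?_ (le_abs_self _)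
    nlinarith
  · obtain ⟨q₁, hq₁, rfl⟩ := intermediate_value_Icc (by linarith : q₀ ≤ q₀ + d)
      hf.continuous.continuousOn ⟨h1.le, h2.le⟩
    refine ⟨q₁, hq₁, fun q hq => ?_⟩
    rcases le_total q₁ q with h3 | h3
    · have := key q₁ hq₁ q hq h3
      rw [abs_sub_comm]
      exact this.trans (le_abs_self _)
    · have := key q hq q₁ hq₁ h3
      refine le_trans ?_ (le_abs_self _)
      nlinarith

lemma exists_deriv_ge {f : ℝ → ℝ} {q₀ : ℝ} (hc : ContinuousAt (deriv f) q₀)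
    (h : 0 < deriv f q₀ ∨ deriv f q₀ = 0 ∧ 0 < deriv (deriv f) q₀) :
    ∃ c > 0, ∃ d > 0, ∀ q ∈ Ioo q₀ (q₀ + d), 2 * c * (q - q₀) ≤ deriv f q := by
  rcases h with h | ⟨h0, h⟩
  · obtain ⟨ε, hε, hεs⟩ := Metric.eventually_nhds_iff_ball.1
      (hc.eventually (lt_mem_nhds (show deriv f q₀ / 2 < deriv f q₀ by linarith)))
    rw [Real.ball_eq_Ioo] at hεs
    refine ⟨deriv f q₀ / 4, by linarith, min ε 1, lt_min hε one_pos, fun q hq => ?_⟩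
    have h1 := hεs q ⟨by linarith [hq.1], hq.2.trans_le (by linarith [min_le_left ε 1])⟩
    have h2 : q - q₀ < 1 := by linarith [hq.2, min_le_right ε 1]
    nlinarith
  · have hd : HasDerivAt (deriv f) (deriv (deriv f) q₀) q₀ :=
      (differentiableAt_of_deriv_ne_zero h.ne').hasDerivAt
    have hs := (hasDerivAt_iff_tendsto_slope.1 hd).eventually
      (lt_mem_nhds (show deriv (deriv f) q₀ / 2 < deriv (deriv f) q₀ by linarith))
    rw [eventually_nhdsWithin_iff] at hs
    obtain ⟨ε, hε, hεs⟩ := Metric.eventually_nhds_iff_ball.1 hs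
    rw [Real.ball_eq_Ioo] at hεs
    refine ⟨deriv (deriv f) q₀ / 4, by linarith, ε, hε, fun q hq => ?_⟩
    have h1 := hεs q ⟨by linarith [hq.1], hq.2⟩ (ne_of_gt hq.1)
    have h2 : 0 < q - q₀ := by linarith [hq.1]
    rw [slope_def_field, h0, sub_zero, lt_div_iff₀ h2] at h1
    linarith

lemma exists_quadratic_separation_right {f : ℝ → ℝ} (hf : Differentiable ℝ f)
    (hc : Continuous (deriv f)) {q₀ : ℝ} (hs : deriv f q₀ = 0 → deriv (deriv f) q₀ ≠ 0) :
    ∃ c > 0, ∃ d > 0, ∀ h, ∃ q₁ ∈ Icc q₀ (q₀ + d), ∀ q ∈ Icc q₀ (q₀ + d),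
      c * (q - q₁) ^ 2 ≤ |h - f q| := by
  by_cases hpos : 0 < deriv f q₀ ∨ deriv f q₀ = 0 ∧ 0 < deriv (deriv f) q₀
  · obtain ⟨c, hc0, d, hd, hder⟩ := exists_deriv_ge hc.continuousAt hpos
    exact ⟨c, hc0, d, hd, fun h => exists_quadratic_separation_of_deriv_ge hf hc0 hd hder h⟩
  · have hn : deriv (fun q => -f q) = fun q => -deriv f q := funext fun q => deriv.fun_neg
    have hneg : 0 < deriv (fun q => -f q) q₀ ∨
        deriv (fun q => -f q) q₀ = 0 ∧ 0 < deriv (deriv fun q => -f q) q₀ := by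
      rw [hn, deriv.fun_neg]
      push Not at hpos
      rcases lt_or_eq_of_le hpos.1 with h | h
      · left; linarith
      · right
        exact ⟨by linarith, by linarith [lt_of_le_of_ne (hpos.2 h) (hs h)]⟩
    obtain ⟨c, hc0, d, hd, hder⟩ := exists_deriv_ge (by rw [hn]; exact hc.neg.continuousAt) hneg
    refine ⟨c, hc0, d, hd, fun h => ?_⟩
    obtain ⟨q₁, hq₁, hq⟩ := exists_quadratic_separation_of_deriv_ge hf.neg hc0 hd hder (-h)
    refine ⟨q₁, hq₁, fun q hq' => (hq q hq').trans_eq ?_⟩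
    rw [abs_sub_comm h]
    congr 1
    simp only [Pi.neg_apply]
    ring

lemma integral_one_div_le {s t a b q₁ : ℝ} (hs : 0 < s) (ht : 0 < t) (hq₁ : q₁ ∈ Icc a b) :
    ∫ q in a..b, 1 / (s * |q - q₁| + t) ≤ 2 / s * Real.log ((s * (b - a) + t) / t) := by
  have hcont : Continuous fun q : ℝ => 1 / (s * |q| + t) :=
    continuous_const.div (by fun_prop) fun q => by positivity
  have h1 : ∫ q in a..b, 1 / (s * |q - q₁| + t) = ∫ q in (a - q₁)..(b - q₁), 1 / (s * |q| + t) :=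
    intervalIntegral.integral_comp_sub_right (fun q => 1 / (s * |q| + t)) q₁
  have h2 : ∫ q in (a - q₁)..(b - q₁), 1 / (s * |q| + t) ≤
      ∫ q in (-(b - a))..(b - a), 1 / (s * |q| + t) :=
    intervalIntegral.integral_mono_interval (by linarith [hq₁.2]) (by linarith [hq₁.1, hq₁.2])
      (by linarith [hq₁.1]) (Eventually.of_forall fun q => by positivity)
      (hcont.intervalIntegrable _ _)
  have hab : 0 ≤ b - a := by linarith [hq₁.1, hq₁.2]
  have h3 : ∫ q in (0 : ℝ)..(b - a), 1 / (s * |q| + t) =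
      1 / s * Real.log ((s * (b - a) + t) / t) := by
    have hd : ∀ q ∈ uIcc 0 (b - a), HasDerivAt (fun q => 1 / s * Real.log (s * q + t))
        (1 / (s * |q| + t)) q := by
      intro q hq
      rw [uIcc_of_le hab] at hq
      have hpos : s * q + t ≠ 0 := by have := hq.1; positivity
      have h4 : HasDerivAt (fun q => s * q + t) s q := by
        simpa using ((hasDerivAt_id q).const_mul s).add_const t
      refine ((h4.log hpos).const_mul (1 / s)).congr_deriv ?_
      rw [abs_of_nonneg hq.1]
      field_simp
    rw [intervalIntegral.integral_eq_sub_of_hasDerivAt hd (hcont.intervalIntegrable _ _),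
      mul_zero, zero_add, Real.log_div (by positivity) ht.ne']
    ring
  have h4 : ∫ q in (-(b - a))..(0 : ℝ), 1 / (s * |q| + t) =
      ∫ q in (0 : ℝ)..(b - a), 1 / (s * |q| + t) := by
    have := intervalIntegral.integral_comp_neg (a := 0) (b := b - a)
      (fun q => 1 / (s * |q| + t))
    simp only [abs_neg, neg_zero] at this
    exact this.symm
  rw [h1]
  refine h2.trans (le_of_eq ?_)
  rw [← intervalIntegral.integral_add_adjacent_intervals (b := 0)
    (hcont.intervalIntegrable _ _) (hcont.intervalIntegrable _ _), h4, h3]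
  ring

/-- The growth of the momentum on `S` when the energy increases from `h` to `h + ε` is
`O(ε |ln ε|)`, uniformly in `h`. -/
def MomentumGrowth (V : ℝ → ℝ) (S : Set ℝ) : Prop :=
  ∃ C : ℝ, 0 ≤ C ∧ ∀ h ε : ℝ, 0 < ε → ε ≤ 1 / 2 →
    ∫⁻ q in S, ENNReal.ofReal (√(2 * (h - V q + ε)) - √(2 * (h - V q))) ≤
      ENNReal.ofReal (C * (ε * |Real.log ε|))

lemma MomentumGrowth.union {S T : Set ℝ} (hS : MomentumGrowth V S) (hT : MomentumGrowth V T) :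
    MomentumGrowth V (S ∪ T) := by
  obtain ⟨C, hC, h1⟩ := hS
  obtain ⟨C', hC', h2⟩ := hT
  refine ⟨C + C', by positivity, fun h ε hε hε' => ?_⟩
  refine (lintegral_union_le _ _ _).trans ((add_le_add (h1 h ε hε hε') (h2 h ε hε hε')).trans_eq ?_)
  rw [← ENNReal.ofReal_add (by positivity) (by positivity), add_mul]

lemma momentumGrowth_right {q₀ : ℝ} (hV : Differentiable ℝ V)
    (hc : Continuous (deriv V)) (hs : deriv V q₀ = 0 → deriv (deriv V) q₀ ≠ 0) :
    ∃ d > 0, MomentumGrowth V (Icc q₀ (q₀ + d)) := by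
  obtain ⟨c, hc0, d, hd, hsep⟩ := exists_quadratic_separation_right hV hc hs
  have hsc : 0 < √c := Real.sqrt_pos.2 hc0
  have hlog2 : 0 < Real.log 2 := Real.log_pos (by norm_num)
  have hlogd : 0 ≤ Real.log (√c * d + 1) := Real.log_nonneg (by nlinarith)
  set C := 4 * (2 / √c * (Real.log (√c * d + 1) / Real.log 2 + 1 / 2)) with hC
  refine ⟨d, hd, C, by positivity, fun h ε hε hε' => ?_⟩
  obtain ⟨q₁, hq₁, hq⟩ := hsep h
  have htε : 0 < √ε := Real.sqrt_pos.2 hε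
  have hint := integral_one_div_le hsc htε hq₁
  rw [add_sub_cancel_left] at hint
  have hcont : Continuous fun q : ℝ => 1 / (√c * |q - q₁| + √ε) :=
    continuous_const.div (by fun_prop) fun q => by positivity
  have hle : q₀ ≤ q₀ + d := by linarith
  calc ∫⁻ q in Icc q₀ (q₀ + d), ENNReal.ofReal (√(2 * (h - V q + ε)) - √(2 * (h - V q)))
      ≤ ∫⁻ q in Icc q₀ (q₀ + d), ENNReal.ofReal (4 * ε * (1 / (√c * |q - q₁| + √ε))) := by
        refine setLIntegral_mono' measurableSet_Icc fun q hq' => ENNReal.ofReal_le_ofReal ?_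
        refine (sqrt_increment_le hε).trans ?_
        rw [mul_one_div]
        have : √c * |q - q₁| ≤ √|h - V q| := by
          refine Real.le_sqrt_of_sq_le ?_
          rw [mul_pow, Real.sq_sqrt hc0.le, sq_abs]
          exact hq q hq'
        gcongr
    _ = ENNReal.ofReal (∫ q in Icc q₀ (q₀ + d), 4 * ε * (1 / (√c * |q - q₁| + √ε))) := by
        rw [ofReal_integral_eq_lintegral_ofReal]
        · exact (continuous_const.mul hcont).integrableOn_Icc
        · exact Eventually.of_forall fun q => by positivity
    _ ≤ ENNReal.ofReal (C * (ε * |Real.log ε|)) := by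
        refine ENNReal.ofReal_le_ofReal ?_
        rw [integral_Icc_eq_integral_Ioc, ← intervalIntegral.integral_of_le hle,
          intervalIntegral.integral_const_mul]
        have hlogε : Real.log ε < 0 := Real.log_neg hε (by linarith)
        have hlε : Real.log 2 ≤ |Real.log ε| := by
          rw [abs_of_neg hlogε, ← Real.log_inv]
          refine Real.log_le_log (by norm_num) ?_
          rw [le_inv_comm₀ (by norm_num) hε]
          linarith
        have h1 : Real.log ((√c * d + √ε) / √ε) ≤ Real.log (√c * d + 1) + |Real.log ε| / 2 := by
          rw [Real.log_div (by positivity) htε.ne', Real.log_sqrt hε.le, abs_of_neg hlogε]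
          have : Real.log (√c * d + √ε) ≤ Real.log (√c * d + 1) := by
            refine Real.log_le_log (by positivity) ?_
            have : √ε ≤ 1 := Real.sqrt_le_one.2 (by linarith)
            linarith
          linarith
        have h2 : Real.log (√c * d + 1) ≤ Real.log (√c * d + 1) / Real.log 2 * |Real.log ε| := by
          rw [div_mul_eq_mul_div, le_div_iff₀ hlog2]
          exact mul_le_mul_of_nonneg_left hlε hlogd
        calc 4 * ε * ∫ q in q₀..(q₀ + d), 1 / (√c * |q - q₁| + √ε)
            ≤ 4 * ε * (2 / √c * (Real.log (√c * d + 1) / Real.log 2 * |Real.log ε| +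
                |Real.log ε| / 2)) := by
              refine mul_le_mul_of_nonneg_left (hint.trans ?_) (by positivity)
              exact mul_le_mul_of_nonneg_left (by linarith) (by positivity)
          _ = C * (ε * |Real.log ε|) := by rw [hC]; ring

lemma momentumGrowth_left {q₀ : ℝ} (hV : Differentiable ℝ V)
    (hc : Continuous (deriv V)) (hs : deriv V q₀ = 0 → deriv (deriv V) q₀ ≠ 0) :
    ∃ d > 0, MomentumGrowth V (Icc (q₀ - d) q₀) := by
  have hn : (deriv fun q => V (-q)) = fun q => -deriv V (-q) :=
    funext fun q => deriv_comp_neg V q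
  obtain ⟨d, hd, C, hC, hb⟩ := momentumGrowth_right (V := fun q => V (-q)) (q₀ := -q₀)
    (hV.comp differentiable_neg) (by rw [hn]; fun_prop) (by
      rw [hn, deriv.fun_neg, deriv_comp_neg]
      simpa using hs)
  refine ⟨d, hd, C, hC, fun h ε hε hε' => ?_⟩
  have := hb h ε hε hε'
  have hpre : Icc (-q₀) (-q₀ + d) = (fun q : ℝ => -q) ⁻¹' Icc (q₀ - d) q₀ := by
    ext q
    simp only [mem_Icc, mem_preimage]
    constructor <;> intro h <;> constructor <;> linarith [h.1, h.2]
  rw [hpre] at this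
  rwa [(Measure.measurePreserving_neg (volume : Measure ℝ)).setLIntegral_comp_preimage_emb
    (MeasurableEquiv.neg ℝ).measurableEmbedding
    (fun q => ENNReal.ofReal (√(2 * (h - V q + ε)) - √(2 * (h - V q))))] at this

lemma momentumGrowth_of_isCompact (hV : IsS3B 2 V) {K : Set ℝ} (hK : IsCompact K) :
    MomentumGrowth V K := by
  refine hK.induction_on (p := MomentumGrowth V) ⟨0, le_rfl, fun h ε _ _ => by simp⟩ ?_
    (fun S T hS hT => hS.union hT) ?_
  · rintro S T hST ⟨C, hC, hb⟩
    exact ⟨C, hC, fun h ε hε hε' => (lintegral_mono_set hST).trans (hb h ε hε hε')⟩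
  · intro q₀ _
    obtain ⟨d, hd, h1⟩ := momentumGrowth_right hV.differentiable hV.continuous_deriv
      (hV.simple q₀)
    obtain ⟨d', hd', h2⟩ := momentumGrowth_left hV.differentiable hV.continuous_deriv
      (hV.simple q₀)
    refine ⟨_, mem_nhdsWithin_of_mem_nhds ?_, h2.union h1⟩
    rw [Icc_union_Icc_eq_Icc (by linarith) (by linarith)]
    exact Icc_mem_nhds (by linarith) (by linarith)

end

section

variable {V V₁ V₂ : ℝ → ℝ} {x y : ℝ × ℝ} {B : Set (ℝ × ℝ)} {H δ ρ E : ℝ}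

/-- The action has modulus of continuity `ε |ln ε|` as a function of the energy. -/
lemma exists_action_modulus (hV : IsS3B 2 V) (E : ℝ) :
    ∃ C : ℝ, 0 ≤ C ∧ ∀ x ∈ leaves V, ∀ y ∈ leaves V, SameCrit V x y → ∀ ε : ℝ, 0 < ε → ε ≤ 1 / 2 →
      V x.1 ≤ V y.1 → V y.1 ≤ V x.1 + ε → V y.1 ≤ E →
        |action V y - action V x| ≤ C * (ε * |Real.log ε|) := by
  obtain ⟨C, hC, hb⟩ := momentumGrowth_of_isCompact hV (hV.isCompact_sublevel E)
  have hpi := Real.pi_pos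
  refine ⟨1 / Real.pi * C, by positivity, fun x hx y hy hs ε hε hε' hle hle' hyE => ?_⟩
  rcases eq_or_lt_of_le hle with he | hlt
  · obtain ⟨c, hcx, hc⟩ := leaf_exists_crit hV hx
    rw [leaf_eq_of_energy_eq hx hy hc hcx ((hs c hc).1 hcx) he, sub_self, abs_zero]
    positivity
  obtain ⟨h1, h2⟩ := hs.nested hV hx hy hlt
  have hanti := (hs.strictAntiOn_left hV hx hy hlt).antitoneOn
  have hmono := (hs.strictMonoOn_right hV hx hy hlt).monotoneOn
  have hcx' := continuous_momentum hV (V x.1)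
  have hcy' := continuous_momentum hV (V y.1)
  have hV' := hV.continuous
  have hcε : Continuous fun q => √(2 * (V x.1 - V q + ε)) := by fun_prop
  have hx12 := leaf_le hx
  have hy12 := leaf_le hy
  have hact : ∫ q in y.1..y.2, √(2 * (V x.1 - V q)) = ∫ q in x.1..x.2, √(2 * (V x.1 - V q)) := by
    rw [← intervalIntegral.integral_add_adjacent_intervals (b := x.1)
      (hcx'.intervalIntegrable _ _) (hcx'.intervalIntegrable _ _),
      ← intervalIntegral.integral_add_adjacent_intervals (a := x.1) (b := x.2)
      (hcx'.intervalIntegrable _ _) (hcx'.intervalIntegrable _ _)]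
    have e1 : ∫ q in y.1..x.1, √(2 * (V x.1 - V q)) = 0 := by
      rw [← intervalIntegral.integral_zero (a := y.1) (b := x.1)]
      refine intervalIntegral.integral_congr fun q hq => Real.sqrt_eq_zero_of_nonpos ?_
      rw [uIcc_of_le h1.le] at hq
      linarith [hanti hq (right_mem_Icc.2 h1.le) hq.2]
    have e2 : ∫ q in x.2..y.2, √(2 * (V x.1 - V q)) = 0 := by
      rw [← intervalIntegral.integral_zero (a := x.2) (b := y.2)]
      refine intervalIntegral.integral_congr fun q hq => Real.sqrt_eq_zero_of_nonpos ?_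
      rw [uIcc_of_le h2.le] at hq
      have := hmono (left_mem_Icc.2 h2.le) hq hq.1
      rw [leaf_eq hx] at this
      linarith
    rw [e1, e2, zero_add, add_zero]
  obtain ⟨c, hcx, hc⟩ := leaf_exists_crit hV hx
  have hpos := action_lt_action hV hx hy hcx ((hs c hc).1 hcx) hlt
  rw [abs_of_pos (sub_pos.2 hpos)]
  simp only [action, energy]
  rw [← mul_sub, ← hact, ← intervalIntegral.integral_sub (hcy'.intervalIntegrable _ _)
    (hcx'.intervalIntegrable _ _), mul_assoc]
  refine mul_le_mul_of_nonneg_left ?_ (by positivity)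
  have hnn : ∀ q, 0 ≤ √(2 * (V x.1 - V q + ε)) - √(2 * (V x.1 - V q)) := fun q =>
    sub_nonneg.2 (Real.sqrt_le_sqrt (by linarith))
  have hcd : Continuous fun q => √(2 * (V x.1 - V q + ε)) - √(2 * (V x.1 - V q)) := hcε.sub hcx'
  calc ∫ q in y.1..y.2, (√(2 * (V y.1 - V q)) - √(2 * (V x.1 - V q)))
      ≤ ∫ q in y.1..y.2, (√(2 * (V x.1 - V q + ε)) - √(2 * (V x.1 - V q))) :=
        intervalIntegral.integral_mono_on hy12 ((hcy'.sub hcx').intervalIntegrable _ _)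
          ((hcε.sub hcx').intervalIntegrable _ _) fun q _ =>
          sub_le_sub_right (Real.sqrt_le_sqrt (by linarith)) _
    _ ≤ C * (ε * |Real.log ε|) := by
        rw [← ENNReal.ofReal_le_ofReal_iff (by positivity),
          intervalIntegral.integral_of_le hy12, ofReal_integral_eq_lintegral_ofReal
          hcd.integrableOn_Ioc (Eventually.of_forall hnn)]
        refine (lintegral_mono_set ?_).trans (hb _ ε hε hε')
        intro q hq
        exact (leaf_le_energy hy ⟨hq.1.le, hq.2⟩).trans hyE

lemma volume_le_of_forall_abs_sub_le {S : Set ℝ} {L : ℝ}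
    (h : ∀ a ∈ S, ∀ b ∈ S, |a - b| ≤ L) : volume S ≤ ENNReal.ofReal L := by
  refine (Real.volume_le_diam S).trans (Metric.ediam_le fun a ha b hb => ?_)
  rw [edist_dist, Real.dist_eq]
  exact ENNReal.ofReal_le_ofReal (h a ha b hb)

/-- The actions of a branch with energies in an interval of length `2δ` have measure
`O(δ |ln δ|)`. -/
lemma exists_volume_action_le (hV : IsS3B 2 V) (E : ℝ) :
    ∃ C : ℝ, 0 ≤ C ∧ ∀ B, IsBranch V B → ∀ e δ : ℝ, 0 < δ → δ ≤ 1 / 4 → e + δ ≤ E →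
      volume (action V '' {x ∈ B | energy V x ∈ Ioo (e - δ) (e + δ)}) ≤
        ENNReal.ofReal (C * (δ * |Real.log δ|)) := by
  obtain ⟨C, hC, hmod⟩ := exists_action_modulus hV E
  refine ⟨2 * C, by positivity, fun B hB e δ hδ hδ' he => ?_⟩
  refine volume_le_of_forall_abs_sub_le ?_
  have hlog : |Real.log (2 * δ)| ≤ |Real.log δ| := by
    rw [abs_of_neg (Real.log_neg (by linarith) (by linarith)),
      abs_of_neg (Real.log_neg hδ (by linarith))]
    linarith [Real.log_le_log hδ (by linarith : δ ≤ 2 * δ)]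
  have key : ∀ x ∈ B, ∀ y ∈ B, energy V x ∈ Ioo (e - δ) (e + δ) →
      energy V y ∈ Ioo (e - δ) (e + δ) → V x.1 ≤ V y.1 →
      |action V y - action V x| ≤ 2 * C * (δ * |Real.log δ|) := by
    intro x hx y hy hxe hye hle
    simp only [energy] at hxe hye
    refine (hmod x (hB.subset_leaves hx) y (hB.subset_leaves hy) (hB.sameCrit hV hx hy) (2 * δ)
      (by linarith) (by linarith) hle (by linarith [hxe.1, hye.2]) (by linarith [hye.2])).trans ?_
    have := mul_le_mul_of_nonneg_left hlog hδ.le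
    nlinarith
  rintro _ ⟨x, ⟨hx, hxe⟩, rfl⟩ _ ⟨y, ⟨hy, hye⟩, rfl⟩
  rcases le_total (V x.1) (V y.1) with h | h
  · rw [abs_sub_comm]
    exact key x hx y hy hxe hye h
  · exact key y hy x hx hye hxe h

lemma finite_saddles (hV : IsS3B 2 V) : (saddles V).Finite :=
  hV.finite_crit.subset fun _ hq => hq.1

lemma volume_biUnion_le_card {ι : Type*} {S : Set ι} (hS : S.Finite) {A : ι → Set ℝ}
    {c : ENNReal} (h : ∀ i ∈ S, volume (A i) ≤ c) :
    volume (⋃ i ∈ S, A i) ≤ hS.toFinset.card * c := by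
  have h1 : (⋃ i ∈ S, A i) = ⋃ i ∈ hS.toFinset, A i := by simp
  rw [h1]
  refine (measure_biUnion_finset_le _ _).trans ?_
  rw [← nsmul_eq_mul]
  exact Finset.sum_le_card_nsmul _ _ _ fun i hi => h i (hS.mem_toFinset.1 hi)

lemma volume_tangentInterval_le (hV₂ : IsS3B 2 V₂) (hB : IsBranch V₂ B) :
    volume (tangentInterval V₁ V₂ B ρ H) ≤ ENNReal.ofReal (2 * ρ) := by
  by_cases h : ∃ x ∈ B, energy V₂ x = H - V₁ 0
  · obtain ⟨x, hx, hxe⟩ := h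
    have hsub : tangentInterval V₁ V₂ B ρ H ⊆ Ioo (action V₂ x - ρ) (action V₂ x + ρ) := by
      refine iUnion₂_subset fun y hy => ?_
      rw [hB.energy_injOn hV₂ hy.1 hx (hy.2.trans hxe.symm)]
    refine (measure_mono hsub).trans_eq ?_
    rw [Real.volume_Ioo]
    congr 1
    ring
  · have : tangentInterval V₁ V₂ B ρ H = ∅ := by
      refine subset_eq_empty (iUnion₂_subset fun y hy => ?_) rfl
      exact absurd ⟨y, hy.1, hy.2⟩ h
    rw [this]
    simp

/-- The measure of the excluded actions on one branch. -/
lemma exists_volume_excludedActions_le (hV₁ : IsS3B 2 V₁) (hV₂ : IsS3B 2 V₂) (H : ℝ) :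
    ∃ C : ℝ, 0 ≤ C ∧ ∀ B, IsBranch V₂ B → ∀ δ ρ : ℝ, 0 < δ → δ ≤ 1 / 4 → 0 < ρ →
      volume (excludedActions V₁ V₂ B δ ρ H) ≤ ENNReal.ofReal (C * (δ * |Real.log δ| + ρ)) := by
  obtain ⟨E₁, hE₁⟩ := ((finite_saddles hV₁).image fun q => H - V₁ q).bddAbove
  obtain ⟨E₂, hE₂⟩ := ((finite_saddles hV₂).image V₂).bddAbove
  obtain ⟨C, hC, hvol⟩ := exists_volume_action_le hV₂ (max E₁ E₂ + 1)
  set n₁ := (finite_saddles hV₁).toFinset.card with hn₁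
  set n₂ := (finite_saddles hV₂).toFinset.card with hn₂
  refine ⟨(n₂ * C + n₁ * C) + 2, by positivity, fun B hB δ ρ hδ hδ' hρ => ?_⟩
  set X := δ * |Real.log δ| with hX
  have hX0 : 0 ≤ X := by positivity
  have hsub : excludedActions V₁ V₂ B δ ρ H ⊆
      ((⋃ q ∈ saddles V₂, action V₂ '' {x ∈ B | energy V₂ x ∈ Ioo (V₂ q - δ) (V₂ q + δ)}) ∪
        ⋃ q ∈ saddles V₁,
          action V₂ '' {x ∈ B | energy V₂ x ∈ Ioo (H - V₁ q - δ) (H - V₁ q + δ)}) ∪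
        tangentInterval V₁ V₂ B ρ H := by
    refine union_subset_union_left _ ?_
    rintro _ ⟨x, ⟨hx, hxe⟩, rfl⟩
    rcases hxe with hxe | hxe
    · left
      obtain ⟨q, hq, hq'⟩ := mem_iUnion₂.1 hxe
      exact mem_iUnion₂.2 ⟨q, hq, x, ⟨hx, hq'⟩, rfl⟩
    · right
      obtain ⟨q, hq, hq'⟩ := mem_iUnion₂.1 hxe
      exact mem_iUnion₂.2 ⟨q, hq, x, ⟨hx, hq'⟩, rfl⟩
  have b2 := volume_biUnion_le_card (finite_saddles hV₂) (c := ENNReal.ofReal (C * X))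
    (A := fun q => action V₂ '' {x ∈ B | energy V₂ x ∈ Ioo (V₂ q - δ) (V₂ q + δ)})
    fun q hq => hvol B hB (V₂ q) δ hδ hδ'
      (by linarith [hE₂ (mem_image_of_mem _ hq), le_max_right E₁ E₂])
  have b1 := volume_biUnion_le_card (finite_saddles hV₁) (c := ENNReal.ofReal (C * X))
    (A := fun q => action V₂ '' {x ∈ B | energy V₂ x ∈ Ioo (H - V₁ q - δ) (H - V₁ q + δ)})
    fun q hq => hvol B hB (H - V₁ q) δ hδ hδ'
      (by linarith [hE₁ (mem_image_of_mem (fun q => H - V₁ q) hq), le_max_left E₁ E₂])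
  have b3 := volume_tangentInterval_le (V₁ := V₁) (ρ := ρ) (H := H) hV₂ hB
  refine (measure_mono hsub).trans ((measure_union_le _ _).trans
    ((add_le_add ((measure_union_le _ _).trans (add_le_add b2 b1)) b3).trans ?_))
  rw [← hn₁, ← hn₂, ← ENNReal.ofReal_natCast n₁, ← ENNReal.ofReal_natCast n₂,
    ← ENNReal.ofReal_mul (by positivity), ← ENNReal.ofReal_mul (by positivity),
    ← ENNReal.ofReal_add (by positivity) (by positivity),
    ← ENNReal.ofReal_add (by positivity) (by positivity)]
  refine ENNReal.ofReal_le_ofReal ?_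
  have hn : 0 ≤ n₂ * C + n₁ * C := by positivity
  nlinarith [mul_nonneg hn hρ.le]

/-- The actions with bounded energy are bounded. -/
lemma exists_action_bound (hV : IsS3B 2 V) (E : ℝ) :
    ∃ A : ℝ, 0 ≤ A ∧ ∀ x ∈ leaves V, V x.1 ≤ E → |action V x| ≤ A := by
  have hK := (hV.isCompact_sublevel E).prod (hV.isCompact_sublevel E)
  obtain ⟨A, hA⟩ := hK.exists_bound_of_continuousOn (continuous_action hV.continuous).continuousOn
  refine ⟨max A 0, le_max_right _ _, fun x hx hxE => (hA x ⟨hxE, ?_⟩).trans (le_max_left _ _)⟩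
  exact (leaf_eq hx).trans_le hxE

lemma volume_regularActions_le {A : ℝ}
    (hA : ∀ x ∈ leaves V₂, V₂ x.1 ≤ H - minV V₁ → |action V₂ x| ≤ A) (hB : IsBranch V₂ B) :
    volume (regularActions V₁ V₂ B δ ρ H) ≤ ENNReal.ofReal (2 * A) := by
  have hsub : regularActions V₁ V₂ B δ ρ H ⊆ Icc (-A) A := by
    rintro _ ⟨⟨x, ⟨hx, hxe⟩, rfl⟩, -⟩
    exact abs_le.1 (hA x (hB.subset_leaves hx) hxe.1.2)
  refine (measure_mono hsub).trans_eq ?_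
  rw [Real.volume_Icc]
  congr 1
  ring

lemma minV_le (hV : IsS3B 2 V) (q : ℝ) : minV V ≤ V q := csInf_le hV.bddBelow ⟨q, rfl⟩

lemma exists_first_crossing {f : ℝ → ℝ} (hf : Continuous f) {q₀ q' h : ℝ} (hq : q₀ < q')
    (h0 : f q₀ < h) (h1 : h ≤ f q') : ∃ b, q₀ < b ∧ f b = h ∧ ∀ q ∈ Ico q₀ b, f q < h := by
  have hK : IsCompact (Icc q₀ q' ∩ {q | h ≤ f q}) :=
    isCompact_Icc.inter_right (isClosed_le continuous_const hf)
  obtain ⟨b, ⟨hb, hbh⟩, hleast⟩ := hK.exists_isLeast ⟨q', ⟨hq.le, le_rfl⟩, h1⟩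
  have hlt : ∀ q ∈ Ico q₀ b, f q < h := by
    intro q hq'
    by_contra! hge
    exact absurd (hleast ⟨⟨hq'.1, hq'.2.le.trans hb.2⟩, hge⟩) hq'.2.not_ge
  have hbh' : h ≤ f b := hbh
  obtain ⟨p, hp, hpf⟩ := intermediate_value_Icc hb.1 hf.continuousOn ⟨h0.le, hbh'⟩
  have hpb : p = b := by
    by_contra hne
    exact (hlt p ⟨hp.1, lt_of_le_of_ne hp.2 hne⟩).ne hpf
  refine ⟨b, lt_of_le_of_ne hb.1 ?_, hpb ▸ hpf, hlt⟩
  rintro rfl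
  exact absurd h0 hbh'.not_gt

/-- There are nonelliptic leaves of energies slightly above the minimum. -/
lemma exists_leaf_lt (hV : IsS3B 2 V) (hE : minV V < E) :
    ∃ y ∈ leaves V, y.1 < y.2 ∧ V y.1 < E := by
  obtain ⟨_, ⟨q₀, rfl⟩, hq₀⟩ := exists_lt_of_csInf_lt (range_nonempty V) hE
  obtain ⟨h, ⟨hh1, hh2⟩, hcrit⟩ : (Ioo (V q₀) E \ V '' {q | deriv V q = 0}).Nonempty :=
    ((Ioo_infinite hq₀).sdiff (hV.finite_crit.image V)).nonempty
  have hne : ∀ q, V q = h → deriv V q ≠ 0 := fun q hq hd => hcrit ⟨q, hd, hq⟩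
  have hev := hV.atTop.eventually (eventually_ge_atTop h)
  rw [cocompact_eq_atBot_atTop, eventually_sup] at hev
  obtain ⟨qr, hqr, hqr'⟩ := (hev.2.and (eventually_gt_atTop q₀)).exists
  obtain ⟨ql, hql, hql'⟩ := (hev.1.and (eventually_lt_atBot q₀)).exists
  obtain ⟨b, hb, hbh, hblt⟩ := exists_first_crossing hV.continuous hqr' hh1 hqr
  obtain ⟨a, ha, hah, halt⟩ := exists_first_crossing (f := fun q => V (-q)) (q₀ := -q₀) (q' := -ql)
    (h := h) (hV.continuous.comp continuous_neg) (by linarith) (by simpa using hh1)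
    (by simpa using hql)
  refine ⟨(-a, b), Or.inl ⟨by simp only; linarith, by rw [hah, hbh], fun q hq => ?_, hne _ hah,
    hne _ hbh⟩, by simp only; linarith, by simp only [hah]; exact hh2⟩
  simp only at hq ⊢
  rw [hah]
  rcases le_total q₀ q with h1 | h1
  · exact hblt q ⟨h1, hq.2⟩
  · simpa using halt (-q) ⟨by linarith, by linarith [hq.1]⟩

/-- Some branch has a positive measure of actions of admissible energies. -/
lemma exists_volume_action_pos (hV : IsS3B 2 V) (hE : minV V < E) :
    ∃ B, IsBranch V B ∧ ∃ L : ℝ, 0 < L ∧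
      ENNReal.ofReal L ≤ volume (action V '' {x ∈ B | energy V x ∈ Icc (minV V) E}) := by
  obtain ⟨y, hy, hlt, hyE⟩ := exists_leaf_lt hV hE
  obtain ⟨J, hJ⟩ := exists_localAction_of_lt (n := 1) le_rfl hV hy hlt
  have hder : HasDerivAt J (deriv J (V y.1)) (V y.1) :=
    (hJ.1.differentiableAt (by norm_num)).hasDerivAt
  have hslope := (hasDerivAt_iff_tendsto_slope.1 hder).mono_left
    (nhdsWithin_mono (V y.1) (fun h (hh : V y.1 < h) => ne_of_gt hh) : 𝓝[>] (V y.1) ≤ _)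
  have hev : ∀ᶠ h in 𝓝 (V y.1), (∃ z ∈ connectedComponentIn (leaves V) y,
      V z.1 = h ∧ action V z = J (V z.1)) ∧ ContinuousAt J h ∧ h < E :=
    (eventually_exists_leaf hV hy hlt hJ.2.2).and
      (((hJ.1.eventually (by simp)).mono fun h hh => hh.continuousAt).and (gt_mem_nhds hyE))
  obtain ⟨ε, hε, hεs⟩ := Metric.eventually_nhds_iff_ball.1 hev
  rw [Real.ball_eq_Ioo] at hεs
  obtain ⟨h, hJh, hh1, hh2⟩ := ((hslope.eventually (lt_mem_nhds hJ.2.1)).and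
    (Ioo_mem_nhdsGT (show V y.1 < V y.1 + ε by linarith))).exists
  have hJlt : J (V y.1) < J h := by
    rw [slope_def_field, lt_div_iff₀ (by linarith), zero_mul] at hJh
    linarith
  refine ⟨_, ⟨y, hy, rfl⟩, J h - J (V y.1), by linarith, ?_⟩
  rw [← Real.volume_Icc]
  refine measure_mono fun I hI => ?_
  obtain ⟨h', hh', rfl⟩ := intermediate_value_Icc hh1.le (f := J)
    (fun h' hh' => (hεs h' ⟨by linarith [hh'.1], hh'.2.trans_lt hh2⟩).2.1.continuousWithinAt) hI
  obtain ⟨⟨z, hz, hze, hzJ⟩, -, hE'⟩ := hεs h' ⟨by linarith [hh'.1], hh'.2.trans_lt hh2⟩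
  refine ⟨z, ⟨hz, minV_le hV _, ?_⟩, by rw [hzJ, hze]⟩
  rw [energy, hze]
  exact hE'.le

lemma action_image_subset (V₁ V₂ : ℝ → ℝ) (B : Set (ℝ × ℝ)) (δ ρ H : ℝ) :
    action V₂ '' {x ∈ B | energy V₂ x ∈ Icc (minV V₂) (H - minV V₁)} ⊆
      regularActions V₁ V₂ B δ ρ H ∪ excludedActions V₁ V₂ B δ ρ H := by
  rintro _ ⟨x, ⟨hx, hxe⟩, rfl⟩
  by_cases h1 : energy V₂ x ∈ singularEnergies V₂ V₁ δ H
  · exact Or.inr (Or.inl ⟨x, ⟨hx, h1⟩, rfl⟩)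
  by_cases h2 : action V₂ x ∈ tangentInterval V₁ V₂ B ρ H
  · exact Or.inr (Or.inr h2)
  · exact Or.inl ⟨⟨x, ⟨hx, hxe, h1⟩, rfl⟩, h2⟩

lemma minV_lt_of_deriv_ne_zero (hV : IsS3B 2 V) {q : ℝ} (hq : deriv V q ≠ 0) : minV V < V q := by
  refine lt_of_le_of_ne (minV_le hV q) fun he => hq ?_
  have : IsLocalMin V q := Eventually.of_forall fun p => he ▸ minV_le hV p
  exact this.deriv_eq_zero

lemma exists_mul_abs_log_le {a : ℝ} (ha : 0 < a) :
    ∃ δ₀ > 0, ∀ δ, 0 < δ → δ < δ₀ → δ * |Real.log δ| ≤ a := by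
  have h := (Real.continuous_mul_log.abs.tendsto 0).eventually
    (gt_mem_nhds (show |(0 : ℝ) * Real.log 0| < a by simpa using ha))
  obtain ⟨ε, hε, hεs⟩ := Metric.eventually_nhds_iff_ball.1 h
  rw [Real.ball_eq_Ioo] at hεs
  refine ⟨ε, hε, fun δ hδ hδ' => ?_⟩
  have := hεs δ ⟨by linarith, by linarith⟩
  rw [abs_mul, abs_of_pos hδ] at this
  exact this.le

lemma tsum_branches_le (hV : IsS3B 2 V) {f : Set (ℝ × ℝ) → ENNReal} {c : ℝ}
    (hf : ∀ B, IsBranch V B → f B ≤ ENNReal.ofReal c) :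
    ∑' B : {B : Set (ℝ × ℝ) // IsBranch V B}, f B ≤
      ENNReal.ofReal ((finite_branches hV).toFinset.card * c) := by
  let _ : Fintype {B : Set (ℝ × ℝ) // IsBranch V B} := (finite_branches hV).fintype
  have hcard : Fintype.card {B : Set (ℝ × ℝ) // IsBranch V B} =
      (finite_branches hV).toFinset.card :=
    Fintype.card_of_subtype _ fun B => by simp
  rw [tsum_fintype, ENNReal.ofReal_mul (by positivity), ENNReal.ofReal_natCast, ← nsmul_eq_mul,
    ← hcard]
  exact Finset.sum_le_card_nsmul _ _ _ fun B _ => hf B B.2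

theorem measure_excluded_regular (hV₁ : IsS3B 2 V₁) (hV₂ : IsS3B 2 V₂)
    (hwall : deriv V₁ 0 ≠ 0) (hH : V₁ 0 ≤ H - minV V₂) :
    ∃ C δ₀ ρ₀ c : ℝ, 0 < δ₀ ∧ 0 < ρ₀ ∧ 0 < c ∧
      (∀ δ ρ : ℝ, 0 < δ → δ < δ₀ → 0 < ρ →
        ∑' B₂ : {B : Set (ℝ × ℝ) // IsBranch V₂ B}, volume (excludedActions V₁ V₂ B₂ δ ρ H)
          ≤ ENNReal.ofReal (C * (δ * |Real.log δ| + ρ))) ∧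
      (∀ δ ρ : ℝ, 0 < δ → δ < δ₀ → 0 < ρ → ρ < ρ₀ →
        ENNReal.ofReal c ≤ ∑' B₂ : {B : Set (ℝ × ℝ) // IsBranch V₂ B},
          volume (regularActions V₁ V₂ B₂ δ ρ H) ∧
        ∑' B₂ : {B : Set (ℝ × ℝ) // IsBranch V₂ B}, volume (regularActions V₁ V₂ B₂ δ ρ H)
          ≤ ENNReal.ofReal C) := by
  obtain ⟨C, hC, hexc⟩ := exists_volume_excludedActions_le hV₁ hV₂ H
  obtain ⟨A, hA, hact⟩ := exists_action_bound hV₂ (H - minV V₁)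
  have hmin := minV_lt_of_deriv_ne_zero hV₁ hwall
  obtain ⟨B₀, hB₀, L, hL, hvol⟩ :=
    exists_volume_action_pos hV₂ (E := H - minV V₁) (by linarith)
  have ha : 0 < L / (4 * (C + 1)) := by positivity
  obtain ⟨δ₁, hδ₁, hlog⟩ := exists_mul_abs_log_le ha
  set N : ℝ := ((finite_branches hV₂).toFinset.card : ℝ) with hN
  have hN0 : 0 ≤ N := by positivity
  refine ⟨max (N * C) (N * (2 * A)), min δ₁ (1 / 4), L / (4 * (C + 1)), L / 2,
    lt_min hδ₁ (by norm_num), ha, by linarith, fun δ ρ hδ hδ' hρ => ?_,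
    fun δ ρ hδ hδ' hρ hρ' => ⟨?_, ?_⟩⟩
  · have hδ4 : δ ≤ 1 / 4 := hδ'.le.trans (min_le_right _ _)
    refine (tsum_branches_le hV₂ (f := fun B => volume (excludedActions V₁ V₂ B δ ρ H))
      fun B hB => hexc B hB δ ρ hδ hδ4 hρ).trans (ENNReal.ofReal_le_ofReal ?_)
    rw [← hN, ← mul_assoc]
    exact mul_le_mul_of_nonneg_right (le_max_left _ _) (by positivity)
  · have hδ4 : δ ≤ 1 / 4 := hδ'.le.trans (min_le_right _ _)
    have hδ1 := hlog δ hδ (hδ'.trans_le (min_le_left _ _))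
    have h1 := hvol.trans ((measure_mono (action_image_subset V₁ V₂ B₀ δ ρ H)).trans
      (measure_union_le _ _))
    have h2 : volume (excludedActions V₁ V₂ B₀ δ ρ H) ≤ ENNReal.ofReal (L / 2) := by
      refine (hexc B₀ hB₀ δ ρ hδ hδ4 hρ).trans (ENNReal.ofReal_le_ofReal ?_)
      have h3 : δ * |Real.log δ| + ρ ≤ L / (2 * (C + 1)) := by
        have : L / (2 * (C + 1)) = L / (4 * (C + 1)) + L / (4 * (C + 1)) := by
          field_simp; norm_num
        linarith
      calc C * (δ * |Real.log δ| + ρ) ≤ (C + 1) * (L / (2 * (C + 1))) := by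
            refine mul_le_mul (by linarith) h3 (by positivity) (by positivity)
        _ = L / 2 := by field_simp
    have h4 : ENNReal.ofReal (L / 2) + ENNReal.ofReal (L / 2) ≤
        volume (regularActions V₁ V₂ B₀ δ ρ H) + ENNReal.ofReal (L / 2) := by
      rw [← ENNReal.ofReal_add (by linarith) (by linarith), add_halves]
      exact h1.trans (add_le_add le_rfl h2)
    have h5 := (ENNReal.add_le_add_iff_right ENNReal.ofReal_ne_top).1 h4
    exact h5.trans (ENNReal.le_tsum (f := fun B : {B : Set (ℝ × ℝ) // IsBranch V₂ B} =>
      volume (regularActions V₁ V₂ B δ ρ H)) ⟨B₀, hB₀⟩)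
  · refine (tsum_branches_le hV₂ (f := fun B => volume (regularActions V₁ V₂ B δ ρ H))
      fun B hB => volume_regularActions_le hact hB).trans (ENNReal.ofReal_le_ofReal ?_)
    rw [← hN]
    exact le_max_right _ _

end

end ImpactMap

end

theorem mainTheorem2 (r : ℕ) (hr : 3 < r) (V₁ V₂ : ℝ → ℝ)
    (hV₁ : ImpactMap.IsS3B (r + 1) V₁) (hV₂ : ImpactMap.IsS3B (r + 1) V₂)
    (hwall : ImpactMap.RegularWall V₁) (H : ℝ) :
    -- smoothness, symplecticity and `C^r` bounds
    (∀ δ : ℝ, 0 < δ → ∀ ρ : ℝ, 0 < ρ → ImpactMap.DeltaRegular V₁ V₂ δ H →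
      (∀ (B₁ B₂ : Set (ℝ × ℝ)) (I : ℝ), ImpactMap.InDomain V₁ V₂ B₁ B₂ δ ρ H I →
        ∀ θ : ℝ, ContDiffAt ℝ r (ImpactMap.returnMap V₁ V₂ B₁ B₂ H) (I, θ) ∧
          ImpactMap.IsSymplecticAt (ImpactMap.returnMap V₁ V₂ B₁ B₂ H) (I, θ)) ∧
      (∀ η : ℝ, 0 < η → ∃ M : ℝ, ∀ (B₁ B₂ : Set (ℝ × ℝ)) (I : ℝ),
        ImpactMap.InDomain V₁ V₂ B₁ B₂ δ ρ H I →
        η ≤ I → η ≤ ImpactMap.complementaryAction V₁ V₂ B₁ B₂ H I →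
        ∀ k : ℕ, k ≤ r → |iteratedDeriv k (ImpactMap.rotation V₁ V₂ B₁ B₂ H) I| < M) ∧
      (ContDiff ℝ ((2 * r + 2 : ℕ) : WithTop ℕ∞) V₁ →
        ContDiff ℝ ((2 * r + 2 : ℕ) : WithTop ℕ∞) V₂ →
        ∃ M : ℝ, ∀ (B₁ B₂ : Set (ℝ × ℝ)) (I : ℝ),
          ImpactMap.InDomain V₁ V₂ B₁ B₂ δ ρ H I →
          ∀ k : ℕ, k ≤ r → |iteratedDeriv k (ImpactMap.rotation V₁ V₂ B₁ B₂ H) I| < M)) ∧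
    -- measure of the excluded and of the regular actions, over all branches
    ((∃ δ : ℝ, 0 < δ ∧ ImpactMap.DeltaRegular V₁ V₂ δ H) →
      ∃ C δ₀ ρ₀ c : ℝ, 0 < δ₀ ∧ 0 < ρ₀ ∧ 0 < c ∧
        (∀ δ ρ : ℝ, 0 < δ → δ < δ₀ → 0 < ρ →
          ∑' B₂ : {B : Set (ℝ × ℝ) // ImpactMap.IsBranch V₂ B},
            MeasureTheory.volume (ImpactMap.excludedActions V₁ V₂ B₂ δ ρ H)
              ≤ ENNReal.ofReal (C * (δ * |Real.log δ| + ρ))) ∧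
        (∀ δ ρ : ℝ, 0 < δ → δ < δ₀ → 0 < ρ → ρ < ρ₀ →
          ENNReal.ofReal c ≤
            ∑' B₂ : {B : Set (ℝ × ℝ) // ImpactMap.IsBranch V₂ B},
              MeasureTheory.volume (ImpactMap.regularActions V₁ V₂ B₂ δ ρ H) ∧
          ∑' B₂ : {B : Set (ℝ × ℝ) // ImpactMap.IsBranch V₂ B},
              MeasureTheory.volume (ImpactMap.regularActions V₁ V₂ B₂ δ ρ H)
            ≤ ENNReal.ofReal C)) := by
  have hV₁' : ImpactMap.IsS3B 2 V₁ := hV₁.of_le (by omega)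
  have hV₂' : ImpactMap.IsS3B 2 V₂ := hV₂.of_le (by omega)
  refine ⟨fun δ hδ ρ hρ _ => ⟨fun B₁ B₂ I hI θ => ?_, fun η hη => ?_, fun hs₁ hs₂ => ?_⟩, ?_⟩
  · obtain ⟨y₁, hy₁, y₂, hy₂, rfl, rfl, rfl, -, hreg⟩ := hI.exists_regularPair hV₁' hV₂'
    have hrot := ImpactMap.contDiffAt_rotation (by omega) hV₁ hV₂ hy₁ hreg.lt₁ hy₂ hreg.lt₂
      hreg.energy_eq (hreg.energy_ne hρ hy₂)
    refine ⟨ImpactMap.contDiffAt_shear hrot, ImpactMap.isSymplecticAt_shear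
      (hrot.differentiableAt ?_)⟩
    exact_mod_cast (by omega : r ≠ 0)
  · obtain ⟨M, hM⟩ := ImpactMap.exists_uniform_bound (H := H) (by omega) hV₁ hV₂ hδ hρ
      (fun x hx => ImpactMap.localAction_or_action_lt (by omega) hV₁ hη hx)
      (fun x hx => ImpactMap.localAction_or_action_lt (by omega) hV₂ hη hx)
    refine ⟨M, fun B₁ B₂ I hI hηI hηJ => ?_⟩
    obtain ⟨y₁, hy₁, y₂, hy₂, rfl, rfl, rfl, hJ, hreg⟩ := hI.exists_regularPair hV₁' hV₂'
    rw [hJ] at hηJ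
    exact hM y₁ hy₁ y₂ hy₂ hηJ hηI hreg
  · obtain ⟨M, hM⟩ := ImpactMap.exists_uniform_bound (H := H) (Q₁ := fun _ => True)
      (Q₂ := fun _ => True) (by omega) hV₁ hV₂ hδ hρ
      (fun x hx => Or.inl (ImpactMap.exists_localAction (by omega) hV₁ hs₁ hx))
      (fun x hx => Or.inl (ImpactMap.exists_localAction (by omega) hV₂ hs₂ hx))
    refine ⟨M, fun B₁ B₂ I hI => ?_⟩
    obtain ⟨y₁, hy₁, y₂, hy₂, rfl, rfl, rfl, -, hreg⟩ := hI.exists_regularPair hV₁' hV₂'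
    exact hM y₁ hy₁ y₂ hy₂ trivial trivial hreg
  · rintro ⟨δ, _, hreg⟩
    exact ImpactMap.measure_excluded_regular hV₁' hV₂' hwall.1 hreg.1.2
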